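/- Let $M$ be a smooth manifold of dimension $n\ge 2$ and let $\mathbf m$ be a metric projective structure on $M$, i.e. an equivalence class of pseudo-Riemannian metrics (of any signature) whose Levi-Civita connections are projectively equivalent: $\bar\nabla_aY^b=\nabla_aY^b+\Upsilon_aY^b+\Upsilon_cY^c\delta^b_a$ for a 1-form $\Upsilon$. Let $\mathcal E(1)$ be the positive $(2n+2)$-nd root of $(\Lambda^nTM)^2$, let $\mathcal E(w)$ be its real powers, and write $\mathcal V(w)=\mathcal V\otimes\mathcal E(w)$. Let $S^2\mathcal T$ be the second symmetric power of the projective tractor bundle: in the scale of each $g\in\mathbf m$ it splits as $S^2TM(-2)\oplus TM(-2)\oplus\mathcal E(-2)$, so that its sections are triples $(\sigma^{bc},\mu^b,\rho)$, and a change of scale with 1-form $\Upsilon$ maps such a triple to $(\sigma^{bc},\ \mu^b-\Upsilon_c\sigma^{bc},\ \rho-2\Upsilon_b\mu^b+\Upsilon_b\Upsilon_c\sigma^{bc})$. Fix $g\in\mathbf m$ with Levi-Civita connection $\nabla$ and curvature $[\nabla_k,\nabla_l]v^i=R^i{}_{jkl}v^j$. Put $R_{jk}=R^a{}_{jak}$,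 $\mathrm P_{jk}=\frac1{n-1}R_{jk}$, $\mathrm P^i{}_j=g^{ik}\mathrm P_{kj}$ and $W^i{}_{jkl}=R^i{}_{jkl}+\delta^i_l\mathrm P_{jk}-\delta^i_k\mathrm P_{jl}$. Suppose that there is Weyl nullity almost everywhere: at each point of an open dense set there is a nonzero tangent vector $v$ with $W^i{}_{jkl}v^j=0$. Suppose also that the function $B$ on $M$, determined by $\mathrm P^i{}_jv^j=Bv^i$ for nonzero $v$ in the Weyl nullity, is smooth. Then $(\sigma^{bc},\mu^b,\rho)\mapsto\sigma^{bc}$ is a bijection from the set of smooth sections of $S^2\mathcal T$ that satisfy, in the scale $g$, $$\nabla^{\mathcal T_1}_a\begin{pmatrix}\sigma^{bc}\\ \mu^b\\ \rho\end{pmatrix}+\frac1{n-1}\begin{pmatrix}0\\0\\ \sigma^{bc}(g_{ab}\nabla_cB-g_{bc}\nabla_aB)\end{pmatrix}=0,$$ where $$\nabla^{\mathcal T_1}_a\begin{pmatrix}\sigma^{bc}\\ \mu^b\\ \rho\end{pmatrix}=\begin{pmatrix}\nabla_a\sigma^{bc}+\delta^b_a\mu^c+\delta^c_a\mu^b\\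 \nabla_a\mu^b+\delta^b_a\rho-Bg_{ac}\sigma^{bc}\\ \nabla_a\rho-2Bg_{ab}\mu^b\end{pmatrix},$$ onto the set of smooth solutions $\sigma^{bc}\in\Gamma(S^2TM(-2))$ of the metrisability equation $\operatorname{trace-free}(\nabla_a\sigma^{bc})=0$. In particular, if $B$ is constant, then the same map is a bijection from the set of sections of $S^2\mathcal T$ that are parallel for $\nabla^{\mathcal T_1}$ onto this set of solutions. -/

import Mathlib

open scoped Manifold ContDiff

noncomputable section

/-- The smooth charts (local coordinate systems) of a smooth `n`-manifold `M`. -/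
abbrev Chart (n : ℕ) (M : Type*) [TopologicalSpace M]
    [ChartedSpace (EuclideanSpace ℝ (Fin n)) M] :=
  {e : OpenPartialHomeomorph M (EuclideanSpace ℝ (Fin n)) //
    e ∈ IsManifold.maximalAtlas (𝓡 n) ∞ M}

section

variable {n : ℕ} {M : Type*} [TopologicalSpace M] [ChartedSpace (EuclideanSpace ℝ (Fin n)) M]

/-- The coordinate derivative `∂_a f` at `x`, in the chart `e`. -/
def pd (e : Chart n M) (a : Fin n) (f : M → ℝ) (x : M) : ℝ :=
  fderiv ℝ (fun y => f (e.1.symm y)) (e.1 x) (EuclideanSpace.single a 1)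

/-- The Jacobian matrix `∂x'^i / ∂x^j` at `x` of the change of coordinates from the chart `e`
(coordinates `x^j`) to the chart `e'` (coordinates `x'^i`). -/
def jac (e e' : Chart n M) (x : M) : Matrix (Fin n) (Fin n) ℝ :=
  Matrix.of fun i j => pd e j (fun y => e'.1 y i) x

/-- A function given on the domain of the chart `e` is smooth there. -/
def SmoothIn (e : Chart n M) (f : M → ℝ) : Prop :=
  ContDiffOn ℝ ∞ (fun y => f (e.1.symm y)) e.1.target

/-- The Kronecker delta. -/
def kron (a b : Fin n) : ℝ := if a = b then 1 else 0

end

/-- A smooth pseudo-Riemannian metric `g_{ij}` (of any signature) on `M`, through its components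
in all smooth charts. The components in a chart are set to zero outside of the chart domain. -/
@[ext]
structure PseudoRiemMetric (n : ℕ) (M : Type*) [TopologicalSpace M]
    [ChartedSpace (EuclideanSpace ℝ (Fin n)) M] where
  comp : Chart n M → M → Matrix (Fin n) (Fin n) ℝ
  comp_of_notMem : ∀ (e : Chart n M) (x : M), x ∉ e.1.source → comp e x = 0
  smooth : ∀ (e : Chart n M) (i j : Fin n), SmoothIn e (fun x => comp e x i j)
  transform : ∀ (e e' : Chart n M) (x : M), x ∈ e.1.source → x ∈ e'.1.source →
    ∀ i j, comp e x i j = ∑ k, ∑ l, jac e e' x k i * jac e e' x l j * comp e' x k l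
  symm : ∀ (e : Chart n M) (x : M) (i j : Fin n), comp e x i j = comp e x j i
  nondegenerate : ∀ (e : Chart n M) (x : M), x ∈ e.1.source → (comp e x).det ≠ 0

/-- A smooth section of the bundle `E(w)` of projective densities of weight `w`: here `E(1)` is the
positive `(2n+2)`-nd root of `(Λ^n TM)^2`, so that `E(w)` has in each chart the frame
`|∂_1 ∧ ... ∧ ∂_n|^{w/(n+1)}`. -/
@[ext]
structure WDensity (n : ℕ) (M : Type*) [TopologicalSpace M]
    [ChartedSpace (EuclideanSpace ℝ (Fin n)) M] (w : ℝ) where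
  comp : Chart n M → M → ℝ
  comp_of_notMem : ∀ (e : Chart n M) (x : M), x ∉ e.1.source → comp e x = 0
  smooth : ∀ e : Chart n M, SmoothIn e (comp e)
  transform : ∀ (e e' : Chart n M) (x : M), x ∈ e.1.source → x ∈ e'.1.source →
    comp e' x = |(jac e e' x).det| ^ (w / (n + 1)) * comp e x

/-- A smooth section `μ^b` of `TM(w) = TM ⊗ E(w)`. -/
@[ext]
structure WVector (n : ℕ) (M : Type*) [TopologicalSpace M]
    [ChartedSpace (EuclideanSpace ℝ (Fin n)) M] (w : ℝ) where
  comp : Chart n M → M → Fin n → ℝ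
  comp_of_notMem : ∀ (e : Chart n M) (x : M), x ∉ e.1.source → comp e x = 0
  smooth : ∀ (e : Chart n M) (b : Fin n), SmoothIn e (fun x => comp e x b)
  transform : ∀ (e e' : Chart n M) (x : M), x ∈ e.1.source → x ∈ e'.1.source →
    ∀ b, comp e' x b = |(jac e e' x).det| ^ (w / (n + 1)) * ∑ k, jac e e' x b k * comp e x k

/-- A smooth section `σ^{bc}` of `S²TM(w) = S²TM ⊗ E(w)`. -/
@[ext]
structure WSymBivector (n : ℕ) (M : Type*) [TopologicalSpace M]
    [ChartedSpace (EuclideanSpace ℝ (Fin n)) M] (w : ℝ) where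
  comp : Chart n M → M → Fin n → Fin n → ℝ
  comp_of_notMem : ∀ (e : Chart n M) (x : M), x ∉ e.1.source → comp e x = 0
  smooth : ∀ (e : Chart n M) (b c : Fin n), SmoothIn e (fun x => comp e x b c)
  transform : ∀ (e e' : Chart n M) (x : M), x ∈ e.1.source → x ∈ e'.1.source →
    ∀ b c, comp e' x b c = |(jac e e' x).det| ^ (w / (n + 1)) *
      ∑ k, ∑ l, jac e e' x b k * jac e e' x c l * comp e x k l
  symm : ∀ (e : Chart n M) (x : M) (b c : Fin n), comp e x b c = comp e x c b

section

variable {n : ℕ} {M : Type*} [TopologicalSpace M] [ChartedSpace (EuclideanSpace ℝ (Fin n)) M]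

/-- The Christoffel symbols `Γ^c_{ab}` of the Levi-Civita connection of `g`. -/
def christoffel (g : PseudoRiemMetric n M) (e : Chart n M) (x : M) (c a b : Fin n) : ℝ :=
  (1 / 2) * ∑ d, (g.comp e x)⁻¹ c d *
    (pd e a (fun y => g.comp e y b d) x + pd e b (fun y => g.comp e y a d) x
      - pd e d (fun y => g.comp e y a b) x)

/-- The trace `Γ^c_{ac}`, which gives the induced connection on densities. -/
def christoffelTrace (g : PseudoRiemMetric n M) (e : Chart n M) (x : M) (a : Fin n) : ℝ :=
  ∑ c, christoffel g e x c a c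

/-- The curvature `R^i_{jkl}`, with the convention `(∇_k ∇_l - ∇_l ∇_k) v^i = R^i_{jkl} v^j`. -/
def riemann (g : PseudoRiemMetric n M) (e : Chart n M) (x : M) (i j k l : Fin n) : ℝ :=
  pd e k (fun y => christoffel g e y i l j) x - pd e l (fun y => christoffel g e y i k j) x
    + ∑ m, (christoffel g e x i k m * christoffel g e x m l j
      - christoffel g e x i l m * christoffel g e x m k j)

/-- The Ricci curvature `R_{jk} = R^a_{jak}`. -/
def ricci (g : PseudoRiemMetric n M) (e : Chart n M) (x : M) (j k : Fin n) : ℝ :=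
  ∑ a, riemann g e x a j a k

/-- The projective Schouten tensor `P_{jk} = R_{jk} / (n-1)`. -/
def schouten (g : PseudoRiemMetric n M) (e : Chart n M) (x : M) (j k : Fin n) : ℝ :=
  1 / ((n : ℝ) - 1) * ricci g e x j k

/-- The projective Schouten tensor with an index raised, `P^i_j = g^{ik} P_{kj}`. -/
def schoutenUp (g : PseudoRiemMetric n M) (e : Chart n M) (x : M) (i j : Fin n) : ℝ :=
  ∑ k, (g.comp e x)⁻¹ i k * schouten g e x k j

/-- The projective Weyl tensor `W^i_{jkl} = R^i_{jkl} + δ^i_l P_{jk} - δ^i_k P_{jl}`. -/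
def weyl (g : PseudoRiemMetric n M) (e : Chart n M) (x : M) (i j k l : Fin n) : ℝ :=
  riemann g e x i j k l + (kron i l * schouten g e x j k - kron i k * schouten g e x j l)

/-- The tangent vector at `x` with components `v` in the chart `e` is in the nullity of the
projective Weyl tensor: `W^i_{jkl} v^j = 0`. -/
def InWeylNullity (g : PseudoRiemMetric n M) (e : Chart n M) (x : M) (v : Fin n → ℝ) : Prop :=
  ∀ i k l, ∑ j, weyl g e x i j k l * v j = 0

/-- The projective Weyl tensor has nullity at `x`: there is a nonzero tangent vector at `x` in its
nullity. (The condition does not depend on the chart around `x`.) -/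
def HasWeylNullityAt (g : PseudoRiemMetric n M) (x : M) : Prop :=
  ∀ e : Chart n M, x ∈ e.1.source → ∃ v : Fin n → ℝ, v ≠ 0 ∧ InWeylNullity g e x v

/-- Weyl nullity almost everywhere, that is on an open dense set. -/
def HasWeylNullityAE (g : PseudoRiemMetric n M) : Prop :=
  ∃ U : Set M, IsOpen U ∧ Dense U ∧ ∀ x ∈ U, HasWeylNullityAt g x

/-- `B` is the function determined by the metric `g` through `P^i_j v^j = B v^i` for nonzero `v` in
the Weyl nullity: whenever `b` is an eigenvalue of `P^i_j` at `x` with a nonzero eigenvector in the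
Weyl nullity, `B x = b`. -/
def IsNullityFunction (g : PseudoRiemMetric n M) (B : M → ℝ) : Prop :=
  ∀ (e : Chart n M) (x : M), x ∈ e.1.source → ∀ (v : Fin n → ℝ) (b : ℝ),
    v ≠ 0 → InWeylNullity g e x v → (∀ i, ∑ j, schoutenUp g e x i j * v j = b * v i) → B x = b

/-- `∇_a ρ` for a density `ρ` of weight `w`. -/
def covDensity {w : ℝ} (g : PseudoRiemMetric n M) (ρ : WDensity n M w) (e : Chart n M) (x : M)
    (a : Fin n) : ℝ :=
  pd e a (ρ.comp e) x + w / (n + 1) * christoffelTrace g e x a * ρ.comp e x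

/-- `∇_a μ^b` for `μ` in `TM(w)`. -/
def covVector {w : ℝ} (g : PseudoRiemMetric n M) (μ : WVector n M w) (e : Chart n M) (x : M)
    (a b : Fin n) : ℝ :=
  pd e a (fun y => μ.comp e y b) x + ∑ d, christoffel g e x b a d * μ.comp e x d
    + w / (n + 1) * christoffelTrace g e x a * μ.comp e x b

/-- `∇_a σ^{bc}` for `σ` in `S²TM(w)`. -/
def covSymBivector {w : ℝ} (g : PseudoRiemMetric n M) (σ : WSymBivector n M w) (e : Chart n M) (x : M)
    (a b c : Fin n) : ℝ :=
  pd e a (fun y => σ.comp e y b c) x + ∑ d, christoffel g e x b a d * σ.comp e x d c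
    + ∑ d, christoffel g e x c a d * σ.comp e x b d
    + w / (n + 1) * christoffelTrace g e x a * σ.comp e x b c

/-- The metrisability equation `D σ = 0`, where `D_a σ^{bc}` is the trace-free part of
`∇_a σ^{bc}`. -/
def SolvesMetrisability (g : PseudoRiemMetric n M) (σ : WSymBivector n M (-2)) : Prop :=
  ∀ (e : Chart n M) (x : M), x ∈ e.1.source → ∀ a b c,
    covSymBivector g σ e x a b c
      - 1 / ((n : ℝ) + 1) * (kron b a * ∑ d, covSymBivector g σ e x d d c
        + kron c a * ∑ d, covSymBivector g σ e x d b d) = 0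

/-- The metrics `g` and `h` are projectively equivalent: their Levi-Civita connections are related
by `∇̂_a Y^b = ∇_a Y^b + Υ_a Y^b + Υ_c Y^c δ^b_a` for a 1-form `Υ`. (Such a `Υ` is
smooth, as the contraction of the difference of the Christoffel symbols is `(n+1) Υ_a`.) -/
def ProjEquiv (g h : PseudoRiemMetric n M) : Prop :=
  ∀ (e : Chart n M) (x : M), x ∈ e.1.source → ∃ Υ : Fin n → ℝ, ∀ a b c,
    christoffel h e x b a c = christoffel g e x b a c + Υ a * kron b c + Υ c * kron b a

/-- A metric projective structure: an equivalence class of projectively equivalent metrics. -/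
def IsMetricProjectiveStructure (m : Set (PseudoRiemMetric n M)) : Prop :=
  ∃ g : PseudoRiemMetric n M, m = {h | ProjEquiv g h}

/-- The 1-form `Υ_a` of the change of scale from `g` to `h`. -/
def upsilon (g h : PseudoRiemMetric n M) (e : Chart n M) (x : M) (a : Fin n) : ℝ :=
  1 / ((n : ℝ) + 1) * (christoffelTrace h e x a - christoffelTrace g e x a)

/-- A smooth section of the tractor bundle `S²T` of the metric projective structure `m`. In the
scale of each `g ∈ m` the bundle splits as `S²TM(-2) ⊕ TM(-2) ⊕ E(-2)`, so that a section is a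
triple `(σ^{bc}, μ^b, ρ)`. A change of scale maps it to
`(σ^{bc}, μ^b - Υ_c σ^{bc}, ρ - 2 Υ_b μ^b + Υ_b Υ_c σ^{bc})`. -/
@[ext]
structure S2Tractor (m : Set (PseudoRiemMetric n M)) where
  σ : WSymBivector n M (-2)
  μ : m → WVector n M (-2)
  ρ : m → WDensity n M (-2)
  μ_transform : ∀ (g h : m) (e : Chart n M) (x : M), x ∈ e.1.source → ∀ b,
    (μ h).comp e x b = (μ g).comp e x b - ∑ c, upsilon g.1 h.1 e x c * σ.comp e x b c
  ρ_transform : ∀ (g h : m) (e : Chart n M) (x : M), x ∈ e.1.source →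
    (ρ h).comp e x = (ρ g).comp e x - 2 * ∑ b, upsilon g.1 h.1 e x b * (μ g).comp e x b
      + ∑ b, ∑ c, upsilon g.1 h.1 e x b * upsilon g.1 h.1 e x c * σ.comp e x b c

/-- The tractor connection `∇^{T_1}` on `S²T`: the three slots, in the scale `g`, of
`∇^{T_1}_a V` at `x`,
`(∇_a σ^{bc} + δ^b_a μ^c + δ^c_a μ^b, ∇_a μ^b + δ^b_a ρ - B g_{ac} σ^{bc}, ∇_a ρ - 2 B g_{ab} μ^b)`. -/
def nablaT1 {m : Set (PseudoRiemMetric n M)} (g : m) (B : M → ℝ) (V : S2Tractor m) (e : Chart n M)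
    (x : M) (a : Fin n) : (Fin n → Fin n → ℝ) × (Fin n → ℝ) × ℝ :=
  (fun b c => covSymBivector g.1 V.σ e x a b c
      + kron b a * (V.μ g).comp e x c + kron c a * (V.μ g).comp e x b,
   fun b => covVector g.1 (V.μ g) e x a b + kron b a * (V.ρ g).comp e x
      - ∑ c, B x * g.1.comp e x a c * V.σ.comp e x b c,
   covDensity g.1 (V.ρ g) e x a - 2 * ∑ b, B x * g.1.comp e x a b * (V.μ g).comp e x b)

/-- The connection `∇^{T_1}` modified in the bottom slot by
`(1/(n-1)) σ^{bc} (g_{ab} ∇_c B - g_{bc} ∇_a B)`. -/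
def nablaMetr {m : Set (PseudoRiemMetric n M)} (g : m) (B : M → ℝ) (V : S2Tractor m) (e : Chart n M)
    (x : M) (a : Fin n) : (Fin n → Fin n → ℝ) × (Fin n → ℝ) × ℝ :=
  nablaT1 g B V e x a + (1 / ((n : ℝ) - 1)) •
    ((0, 0, ∑ b, ∑ c, V.σ.comp e x b c *
      (g.1.comp e x a b * pd e c B x - g.1.comp e x b c * pd e a B x)) :
        (Fin n → Fin n → ℝ) × (Fin n → ℝ) × ℝ)

end

end

noncomputable section

/-! ### Calculus in charts -/

section

variable {n : ℕ} {M : Type*} [TopologicalSpace M] [ChartedSpace (EuclideanSpace ℝ (Fin n)) M]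

/-! Injectivity is a matter of traces: the first slot of the system expresses μ through the
divergence of σ, and the second expresses ρ through σ and the divergence of μ
(`eq_div_of_covSymBivector_add`, `eq_div_of_covVector_add`). For surjectivity, μ and ρ are defined
by these formulas from a solution σ (`divBivector`, `divVector`). The first slot is then the
metrisability equation, and the other two have to be proved. Write X = σg, e_k for the coordinate
vectors, and Z = R - B·T, where T is the curvature tensor of constant curvature one (`reducedCurv`).

Second slot. If v lies in the Weyl nullity, then R_{kl}v = p_l e_k - p_k e_l with p_l = P_{jl}v^j.
Skewness of R makes p a multiple of g(v,·), so v is an eigenvector of P; the eigenvalue is B, and Zv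
= 0 (`exists_reducedCurv_nullity`). The Ricci identity for σ reads Z_{kl}σ + σZ_{kl}ᵀ = e_k⊙N_l -
e_l⊙N_k with N_l = ∇_lμ - B X e_l. By pair symmetry of Z, contraction with v^k kills the left side,
and what remains forces N_l to be a multiple of e_l (`eq_smul_single_of_nullity`). This holds on a
dense set, hence everywhere.

Third slot. Now the Ricci identity for μ reads Z_{kl}μ = A_l e_k - A_k e_l + (∇_kB) X e_l - (∇_lB) X
e_k with A = ∇ρ - 2Bμ, and its contraction over k is n-1 times the third slot
(`obstruction_eq_sum`). Moreover Z_{kl}σ + σZ_{kl}ᵀ = 0, so that X commutes with Z_{kl} and can also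
be moved into the index k; this yields a quadratic equation for X with leading coefficient ∇B
(`X_quadratic`). At a point with nullity: - if ∇B = 0, contraction with v gives A = 0; - if ∇B ≠ 0
and X is not a multiple of the identity, the quadratic equation and its derivative give Zμ = 0 when
n ≠ 2 (`mulVec_eq_zero_of_quadratic`), while for n = 2 already Z = 0. Thus a nonzero obstruction
would force X to be a multiple of the identity on a nonempty open set; differentiating this gives μ
= 0 there (`map_μ_eq_zero_of_scalar`), and the obstruction vanishes after all
(`SolvesMetrisability.obstruction_eq_zero`).

Local computations take place over the ring of smooth functions on an open set of a chart, with the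
coordinate derivatives as commuting derivations. They become matrix identities over a commutative
ring, and evaluation at a point is a ring homomorphism. -/

theorem contMDiffOn_iff_contDiffOn_chart [IsManifold (𝓡 n) ∞ M] (e : Chart n M) {V : Set M}
    (hV : V ⊆ e.1.source) (f : M → ℝ) :
    ContMDiffOn (𝓡 n) 𝓘(ℝ, ℝ) ∞ f V ↔
      ContDiffOn ℝ ∞ (fun y => f (e.1.symm y)) (e.1 '' V) := by
  rw [contMDiffOn_iff_of_mem_maximalAtlas' (e' := OpenPartialHomeomorph.refl ℝ) e.2
    (contDiffGroupoid ∞ 𝓘(ℝ, ℝ)).id_mem_maximalAtlas hV (fun _ _ => trivial)]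
  rfl

theorem smoothIn_iff [IsManifold (𝓡 n) ∞ M] (e : Chart n M) (f : M → ℝ) :
    SmoothIn e f ↔ ContMDiffOn (𝓡 n) 𝓘(ℝ, ℝ) ∞ f e.1.source := by
  rw [contMDiffOn_iff_contDiffOn_chart e subset_rfl, e.1.image_source_eq_target]
  rfl

theorem contDiffAt_chart [IsManifold (𝓡 n) ∞ M] (e : Chart n M) {V : Set M} (hVo : IsOpen V)
    (hV : V ⊆ e.1.source) {f : M → ℝ} (hf : ContMDiffOn (𝓡 n) 𝓘(ℝ, ℝ) ∞ f V) {x : M}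
    (hx : x ∈ V) : ContDiffAt ℝ ∞ (fun y => f (e.1.symm y)) (e.1 x) :=
  ((contMDiffOn_iff_contDiffOn_chart e hV f).1 hf).contDiffAt
    ((e.1.isOpen_image_of_subset_source hVo hV).mem_nhds ⟨x, hx, rfl⟩)

theorem differentiableAt_chart [IsManifold (𝓡 n) ∞ M] (e : Chart n M) {V : Set M}
    (hVo : IsOpen V) (hV : V ⊆ e.1.source) {f : M → ℝ}
    (hf : ContMDiffOn (𝓡 n) 𝓘(ℝ, ℝ) ∞ f V) {x : M}
    (hx : x ∈ V) : DifferentiableAt ℝ (fun y => f (e.1.symm y)) (e.1 x) :=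
  (contDiffAt_chart e hVo hV hf hx).differentiableAt (by simp)

theorem pd_congr (e : Chart n M) (a : Fin n) {f g : M → ℝ} {V : Set M} (hVo : IsOpen V)
    (hV : V ⊆ e.1.source) (h : ∀ y ∈ V, f y = g y) {x : M} (hx : x ∈ V) :
    pd e a f x = pd e a g x := by
  unfold pd
  congr 1
  apply Filter.EventuallyEq.fderiv_eq
  filter_upwards [(e.1.isOpen_image_of_subset_source hVo hV).mem_nhds ⟨x, hx, rfl⟩] with y hy
  obtain ⟨z, hz, rfl⟩ := hy
  simp only [e.1.left_inv (hV hz)]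
  exact h z hz

theorem contMDiffOn_pd [IsManifold (𝓡 n) ∞ M] (e : Chart n M) (a : Fin n) {V : Set M}
    (hVo : IsOpen V) (hV : V ⊆ e.1.source) {f : M → ℝ}
    (hf : ContMDiffOn (𝓡 n) 𝓘(ℝ, ℝ) ∞ f V) :
    ContMDiffOn (𝓡 n) 𝓘(ℝ, ℝ) ∞ (pd e a f) V := by
  rw [contMDiffOn_iff_contDiffOn_chart e hV] at hf ⊢
  have ho := e.1.isOpen_image_of_subset_source hVo hV
  have h1 : ContDiffOn ℝ ∞ (fun y => fderiv ℝ (fun y => f (e.1.symm y)) y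
      (EuclideanSpace.single a 1)) (e.1 '' V) :=
    (hf.fderiv_of_isOpen ho (by simp)).clm_apply contDiffOn_const
  refine h1.congr fun y hy => ?_
  obtain ⟨z, hz, rfl⟩ := hy
  simp only [pd, e.1.left_inv (hV hz)]

theorem pd_comm [IsManifold (𝓡 n) ∞ M] (e : Chart n M) (a b : Fin n) {V : Set M}
    (hVo : IsOpen V) (hV : V ⊆ e.1.source) {f : M → ℝ}
    (hf : ContMDiffOn (𝓡 n) 𝓘(ℝ, ℝ) ∞ f V) {x : M} (hx : x ∈ V) :
    pd e a (pd e b f) x = pd e b (pd e a f) x := by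
  set F := fun y => f (e.1.symm y) with hF
  have hC : ContDiffAt ℝ ∞ F (e.1 x) := contDiffAt_chart e hVo hV hf hx
  have hsymm : IsSymmSndFDerivAt ℝ F (e.1 x) :=
    hC.isSymmSndFDerivAt (by
      rw [minSmoothness_of_isRCLikeNormedField]
      exact WithTop.coe_le_coe.2 (le_top : (2 : ℕ∞) ≤ ⊤))
  have hd : DifferentiableAt ℝ (fderiv ℝ F) (e.1 x) :=
    (hC.fderiv_right (m := 1) (WithTop.coe_le_coe.2 le_top)).differentiableAt (by simp)
  have key : ∀ c d : Fin n, pd e c (pd e d f) x =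
      fderiv ℝ (fderiv ℝ F) (e.1 x) (EuclideanSpace.single c 1) (EuclideanSpace.single d 1) := by
    intro c d
    have h1 : (fun y => pd e d f (e.1.symm y)) =ᶠ[nhds (e.1 x)]
        fun y => fderiv ℝ F y (EuclideanSpace.single d 1) := by
      filter_upwards [(e.1.isOpen_image_of_subset_source hVo hV).mem_nhds ⟨x, hx, rfl⟩] with y hy
      obtain ⟨z, hz, rfl⟩ := hy
      simp only [pd, e.1.left_inv (hV hz), hF]
    rw [pd, h1.fderiv_eq, fderiv_clm_apply hd (differentiableAt_const _)]
    simp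
  rw [key, key, hsymm]

/-- The coordinate functions of a chart. -/
def coordFn (e : Chart n M) (i : Fin n) (y : M) : ℝ := e.1 y i

theorem jac_apply (e e' : Chart n M) (x : M) (i j : Fin n) :
    jac e e' x i j = pd e j (coordFn e' i) x := rfl

theorem contMDiffOn_coordFn [IsManifold (𝓡 n) ∞ M] (e : Chart n M) (i : Fin n) :
    ContMDiffOn (𝓡 n) 𝓘(ℝ, ℝ) ∞ (coordFn e i) e.1.source := by
  rw [contMDiffOn_iff_contDiffOn_chart e subset_rfl, e.1.image_source_eq_target]
  have h : ContDiffOn ℝ ∞ (fun y : EuclideanSpace ℝ (Fin n) => y i) e.1.target := by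
    fun_prop
  refine h.congr fun y hy => ?_
  simp only [coordFn, e.1.right_inv hy]

/-- The chain rule for a change of coordinates. -/
theorem pd_eq_sum_jac [IsManifold (𝓡 n) ∞ M] (e e' : Chart n M) (a : Fin n) {V : Set M}
    (hVo : IsOpen V) (hV : V ⊆ e.1.source) (hV' : V ⊆ e'.1.source) {f : M → ℝ}
    (hf : ContMDiffOn (𝓡 n) 𝓘(ℝ, ℝ) ∞ f V) {x : M} (hx : x ∈ V) :
    pd e a f x = ∑ b, jac e e' x b a * pd e' b f x := by
  set φ : EuclideanSpace ℝ (Fin n) → EuclideanSpace ℝ (Fin n) := fun y => e'.1 (e.1.symm y)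
    with hφ
  set F' := fun y => f (e'.1.symm y) with hF'
  have hφx : φ (e.1 x) = e'.1 x := by simp only [hφ, e.1.left_inv (hV hx)]
  have hcomp : ∀ i, DifferentiableAt ℝ (fun y => φ y i) (e.1 x) := fun i =>
    differentiableAt_chart e hVo hV ((contMDiffOn_coordFn e' i).mono hV') hx
  have hφd : DifferentiableAt ℝ φ (e.1 x) := differentiableAt_euclidean.2 hcomp
  have hF'd : DifferentiableAt ℝ F' (φ (e.1 x)) := by
    rw [hφx]
    exact differentiableAt_chart e' hVo hV' hf hx
  have h1 : (fun y => f (e.1.symm y)) =ᶠ[nhds (e.1 x)] F' ∘ φ := by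
    filter_upwards [(e.1.isOpen_image_of_subset_source hVo hV).mem_nhds ⟨x, hx, rfl⟩] with y hy
    obtain ⟨z, hz, rfl⟩ := hy
    simp only [hφ, hF', Function.comp, e.1.left_inv (hV hz), e'.1.left_inv (hV' hz)]
  have hco : ∀ b, fderiv ℝ φ (e.1 x) (EuclideanSpace.single a 1) b = jac e e' x b a := by
    intro b
    have := ((EuclideanSpace.proj b : EuclideanSpace ℝ (Fin n) →L[ℝ] ℝ).hasFDerivAt.comp _
      hφd.hasFDerivAt).fderiv
    rw [jac_apply, pd]
    change _ = fderiv ℝ (fun y => φ y b) (e.1 x) _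
    exact (congrArg (· (EuclideanSpace.single a 1)) this).symm
  set w := fderiv ℝ φ (e.1 x) (EuclideanSpace.single a 1) with hw
  have hwsum : w = ∑ b, w b • EuclideanSpace.single b (1 : ℝ) := by
    ext i
    simp [Finset.sum_apply, Pi.single_apply]
  rw [pd, h1.fderiv_eq, fderiv_comp _ hF'd hφd, ContinuousLinearMap.comp_apply, ← hw, hφx]
  conv_lhs => rw [hwsum]
  rw [map_sum]
  refine Finset.sum_congr rfl fun b _ => ?_
  rw [map_smul, hco, smul_eq_mul, pd]

theorem pd_coordFn [IsManifold (𝓡 n) ∞ M] (e : Chart n M) (a i : Fin n) {x : M}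
    (hx : x ∈ e.1.source) : pd e a (coordFn e i) x = (1 : Matrix (Fin n) (Fin n) ℝ) i a := by
  have h1 : (fun y => coordFn e i (e.1.symm y)) =ᶠ[nhds (e.1 x)] fun y => y i := by
    filter_upwards [e.1.open_target.mem_nhds (e.1.map_source hx)] with y hy
    simp only [coordFn, e.1.right_inv hy]
  rw [pd, h1.fderiv_eq]
  have : HasFDerivAt (fun y : EuclideanSpace ℝ (Fin n) => y i)
      (EuclideanSpace.proj i : EuclideanSpace ℝ (Fin n) →L[ℝ] ℝ) (e.1 x) :=
    (EuclideanSpace.proj i : EuclideanSpace ℝ (Fin n) →L[ℝ] ℝ).hasFDerivAt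
  rw [this.fderiv]
  simp [Matrix.one_apply]

theorem jac_mul_jac [IsManifold (𝓡 n) ∞ M] (e e' : Chart n M) {x : M}
    (hx : x ∈ e.1.source) (hx' : x ∈ e'.1.source) : jac e' e x * jac e e' x = 1 := by
  ext i a
  have ho : IsOpen (e.1.source ∩ e'.1.source) := e.1.open_source.inter e'.1.open_source
  rw [← pd_coordFn e a i hx, pd_eq_sum_jac e e' a ho Set.inter_subset_left Set.inter_subset_right
    ((contMDiffOn_coordFn e i).mono Set.inter_subset_left) ⟨hx, hx'⟩, Matrix.mul_apply]
  refine Finset.sum_congr rfl fun b _ => ?_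
  rw [jac_apply e' e, mul_comm]

/-! ### Rings of smooth functions with coordinate derivations -/

/-- The ring of smooth functions on a subset of the manifold. -/
def smoothRing (V : Set M) : Subalgebra ℝ (V → ℝ) where
  carrier := {f | ∃ F : M → ℝ, ContMDiffOn (𝓡 n) 𝓘(ℝ, ℝ) ∞ F V ∧ ∀ x : V, f x = F x}
  mul_mem' := by
    rintro f g ⟨F, hF, hf⟩ ⟨G, hG, hg⟩
    exact ⟨F * G, hF.mul hG, fun x => by simp [hf, hg]⟩
  add_mem' := by
    rintro f g ⟨F, hF, hf⟩ ⟨G, hG, hg⟩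
    exact ⟨F + G, hF.add hG, fun x => by simp [hf, hg]⟩
  algebraMap_mem' r := ⟨fun _ => r, contMDiffOn_const, fun _ => rfl⟩

namespace smoothRing

variable {V : Set M}

/-- A smooth function as an element of the ring of smooth functions. -/
def mk (F : M → ℝ) (hF : ContMDiffOn (𝓡 n) 𝓘(ℝ, ℝ) ∞ F V) : smoothRing (n := n) V :=
  ⟨fun x => F x, F, hF, fun _ => rfl⟩

/-- The value at a point. -/
def eval (x : V) : smoothRing (n := n) V →ₐ[ℝ] ℝ :=
  (Pi.evalAlgHom ℝ (fun _ : V => ℝ) x).comp (smoothRing V).val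

@[simp] theorem eval_mk (F : M → ℝ) (hF : ContMDiffOn (𝓡 n) 𝓘(ℝ, ℝ) ∞ F V) (x : V) :
    eval x (mk F hF) = F x := rfl

theorem ext_eval {f g : smoothRing (n := n) V} (h : ∀ x : V, eval x f = eval x g) : f = g :=
  Subtype.ext (funext h)

/-- The extension of a smooth function by zero. -/
def ext (f : smoothRing (n := n) V) : M → ℝ := Function.extend Subtype.val f.1 0

theorem ext_apply (f : smoothRing (n := n) V) (x : V) : ext f x = eval x f :=
  Subtype.val_injective.extend_apply _ _ _

theorem contMDiffOn_ext (f : smoothRing (n := n) V) :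
    ContMDiffOn (𝓡 n) 𝓘(ℝ, ℝ) ∞ (ext f) V := by
  obtain ⟨f, F, hF, hf⟩ := f
  exact hF.congr fun x hx => (ext_apply _ ⟨x, hx⟩).trans (hf ⟨x, hx⟩)

theorem mk_ext (f : smoothRing (n := n) V) : mk (ext f) (contMDiffOn_ext f) = f :=
  ext_eval fun x => ext_apply f x

variable [IsManifold (𝓡 n) ∞ M]

/-- The coordinate derivative of a chart as a derivation of the ring of smooth functions. -/
def deriv (e : Chart n M) (hVo : IsOpen V) (hV : V ⊆ e.1.source) (a : Fin n) :
    Derivation ℝ (smoothRing (n := n) V) (smoothRing (n := n) V) where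
  toFun f := mk (pd e a (ext f)) (contMDiffOn_pd e a hVo hV (contMDiffOn_ext f))
  map_add' f g := by
    refine ext_eval fun x => ?_
    have h : pd e a (ext (f + g)) x = pd e a (ext f + ext g) x :=
      pd_congr e a hVo hV (fun y hy => by simp [ext_apply _ ⟨y, hy⟩]) x.2
    simp only [eval_mk, map_add, h]
    exact congrArg (· (EuclideanSpace.single a 1))
      (fderiv_add (differentiableAt_chart e hVo hV (contMDiffOn_ext f) x.2)
        (differentiableAt_chart e hVo hV (contMDiffOn_ext g) x.2))
  map_smul' r f := by
    refine ext_eval fun x => ?_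
    have h : pd e a (ext (r • f)) x = pd e a (r • ext f) x :=
      pd_congr e a hVo hV (fun y hy => by simp [ext_apply _ ⟨y, hy⟩]) x.2
    simp only [eval_mk, map_smul, h, RingHom.id_apply]
    exact congrArg (· (EuclideanSpace.single a 1))
      (fderiv_const_smul (differentiableAt_chart e hVo hV (contMDiffOn_ext f) x.2) r)
  map_one_eq_zero' := by
    refine ext_eval fun x => ?_
    have h : pd e a (ext (1 : smoothRing (n := n) V)) x = pd e a (fun _ => 1) x :=
      pd_congr e a hVo hV (fun y hy => by simp [ext_apply _ ⟨y, hy⟩]) x.2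
    change pd e a (ext (1 : smoothRing (n := n) V)) x = _
    rw [h]
    simp [pd]
  leibniz' f g := by
    refine ext_eval fun x => ?_
    have h : pd e a (ext (f * g)) x = pd e a (ext f * ext g) x :=
      pd_congr e a hVo hV (fun y hy => by simp [ext_apply _ ⟨y, hy⟩]) x.2
    change pd e a (ext (f * g)) x = _
    rw [h]
    have := congrArg (· (EuclideanSpace.single a 1))
      (fderiv_fun_mul (differentiableAt_chart e hVo hV (contMDiffOn_ext f) x.2)
        (differentiableAt_chart e hVo hV (contMDiffOn_ext g) x.2))
    refine this.trans ?_
    simp [e.1.left_inv (hV x.2), ext_apply, pd]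

theorem eval_deriv (e : Chart n M) (hVo : IsOpen V) (hV : V ⊆ e.1.source) (a : Fin n)
    (f : smoothRing (n := n) V) (x : V) : eval x (deriv e hVo hV a f) = pd e a (ext f) x := rfl

theorem eval_deriv_mk (e : Chart n M) (hVo : IsOpen V) (hV : V ⊆ e.1.source) (a : Fin n)
    (F : M → ℝ) (hF : ContMDiffOn (𝓡 n) 𝓘(ℝ, ℝ) ∞ F V) (x : V) :
    eval x (deriv e hVo hV a (mk F hF)) = pd e a F x :=
  pd_congr e a hVo hV (fun y hy => ext_apply _ ⟨y, hy⟩) x.2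

theorem deriv_mk (e : Chart n M) (hVo : IsOpen V) (hV : V ⊆ e.1.source) (a : Fin n)
    (F : M → ℝ) (hF : ContMDiffOn (𝓡 n) 𝓘(ℝ, ℝ) ∞ F V) :
    deriv e hVo hV a (mk F hF) = mk (pd e a F) (contMDiffOn_pd e a hVo hV hF) :=
  ext_eval fun x => eval_deriv_mk e hVo hV a F hF x

theorem deriv_comm (e : Chart n M) (hVo : IsOpen V) (hV : V ⊆ e.1.source) (a b : Fin n)
    (f : smoothRing (n := n) V) :
    deriv e hVo hV a (deriv e hVo hV b f) = deriv e hVo hV b (deriv e hVo hV a f) := by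
  rw [← mk_ext f]
  simp only [deriv_mk]
  exact ext_eval fun x => pd_comm e a b hVo hV (contMDiffOn_ext f) x.2

end smoothRing

end

/-! ### Derivations acting on matrices and vectors -/

section

open Matrix

variable {n : ℕ} {R : Type*} [CommRing R] [Algebra ℝ R]

/-- Rings of smooth functions have zero divisors, but 2 is a unit in every real algebra. -/
theorem two_mul_cancel_of_algebra {a b : R} (h : 2 * a = 2 * b) : a = b := by
  have h2 : algebraMap ℝ R (1 / 2) * 2 = 1 := by
    rw [← map_ofNat (algebraMap ℝ R) 2, ← map_mul]
    norm_num
  calc a = algebraMap ℝ R (1 / 2) * 2 * a := by rw [h2, one_mul]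
    _ = algebraMap ℝ R (1 / 2) * 2 * b := by rw [mul_assoc, h, mul_assoc]
    _ = b := by rw [h2, one_mul]

/-- The entrywise application of a derivation to a matrix. -/
def dMat (d : Derivation ℝ R R) (A : Matrix (Fin n) (Fin n) R) : Matrix (Fin n) (Fin n) R :=
  Matrix.of fun i j => d (A i j)

/-- The entrywise application of a derivation to a vector. -/
def dVec (d : Derivation ℝ R R) (u : Fin n → R) : Fin n → R := fun i => d (u i)

section

variable (d : Derivation ℝ R R)

@[simp] theorem dMat_apply (A : Matrix (Fin n) (Fin n) R) (i j : Fin n) :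
    dMat d A i j = d (A i j) := rfl

@[simp] theorem dVec_apply (u : Fin n → R) (i : Fin n) : dVec d u i = d (u i) := rfl

theorem dMat_mul (A B : Matrix (Fin n) (Fin n) R) :
    dMat d (A * B) = dMat d A * B + A * dMat d B := by
  ext i j
  simp only [dMat_apply, Matrix.mul_apply, Matrix.add_apply, map_sum, Derivation.leibniz,
    smul_eq_mul, Finset.sum_add_distrib]
  rw [add_comm]
  congr 1
  exact Finset.sum_congr rfl fun _ _ => mul_comm _ _

theorem dMat_add (A B : Matrix (Fin n) (Fin n) R) : dMat d (A + B) = dMat d A + dMat d B := by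
  ext; simp

theorem dMat_sub (A B : Matrix (Fin n) (Fin n) R) : dMat d (A - B) = dMat d A - dMat d B := by
  ext; simp

theorem dMat_neg (A : Matrix (Fin n) (Fin n) R) : dMat d (-A) = -dMat d A := by
  ext; simp

theorem dMat_one : dMat d (1 : Matrix (Fin n) (Fin n) R) = 0 := by
  ext i j
  by_cases h : i = j <;> simp [h]

theorem dMat_transpose (A : Matrix (Fin n) (Fin n) R) : dMat d Aᵀ = (dMat d A)ᵀ := rfl

theorem dMat_smul (f : R) (A : Matrix (Fin n) (Fin n) R) :
    dMat d (f • A) = d f • A + f • dMat d A := by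
  ext
  simp only [dMat_apply, Matrix.smul_apply, Matrix.add_apply, smul_eq_mul, Derivation.leibniz]
  ring

theorem dVec_smul (f : R) (u : Fin n → R) : dVec d (f • u) = d f • u + f • dVec d u := by
  ext
  simp only [dVec_apply, Pi.smul_apply, Pi.add_apply, smul_eq_mul, Derivation.leibniz]
  ring

theorem dVec_add (u v : Fin n → R) : dVec d (u + v) = dVec d u + dVec d v := by
  ext; simp

theorem dVec_sub (u v : Fin n → R) : dVec d (u - v) = dVec d u - dVec d v := by
  ext; simp

theorem dVec_neg (u : Fin n → R) : dVec d (-u) = -dVec d u := by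
  ext; simp

theorem dVec_single (k : Fin n) : dVec d (Pi.single k (1 : R)) = 0 := by
  ext i
  by_cases h : i = k
  · subst h; simp
  · simp [h]

theorem dVec_mulVec (A : Matrix (Fin n) (Fin n) R) (u : Fin n → R) :
    dVec d (A *ᵥ u) = dMat d A *ᵥ u + A *ᵥ dVec d u := by
  ext i
  simp only [dVec_apply, Matrix.mulVec, dotProduct, Pi.add_apply, map_sum, Derivation.leibniz,
    smul_eq_mul, Finset.sum_add_distrib, dMat_apply]
  rw [add_comm]
  congr 1
  exact Finset.sum_congr rfl fun _ _ => mul_comm _ _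

theorem dMat_vecMulVec (u v : Fin n → R) :
    dMat d (vecMulVec u v) = vecMulVec (dVec d u) v + vecMulVec u (dVec d v) := by
  ext
  simp only [dMat_apply, vecMulVec_apply, Matrix.add_apply, dVec_apply, smul_eq_mul,
    Derivation.leibniz]
  ring

theorem derivation_trace (A : Matrix (Fin n) (Fin n) R) : d A.trace = (dMat d A).trace := by
  simp [Matrix.trace]

theorem derivation_prod {ι : Type*} [DecidableEq ι] (s : Finset ι) (f : ι → R) :
    d (∏ i ∈ s, f i) = ∑ i ∈ s, d (f i) * ∏ j ∈ s.erase i, f j := by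
  induction s using Finset.induction_on with
  | empty => simp
  | insert a s ha ih =>
    rw [Finset.prod_insert ha, Derivation.leibniz, ih, Finset.sum_insert ha,
      Finset.erase_insert ha, smul_eq_mul, smul_eq_mul, Finset.mul_sum, add_comm,
      mul_comm (∏ i ∈ s, f i)]
    congr 1
    refine Finset.sum_congr rfl fun i hi => ?_
    rw [Finset.erase_insert_of_ne (by rintro rfl; exact ha hi),
      Finset.prod_insert (fun h => ha (Finset.mem_of_mem_erase h))]
    ring

/-- Jacobi's formula for the derivative of a determinant. -/
theorem derivation_det (A : Matrix (Fin n) (Fin n) R) :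
    d A.det = (A.adjugate * dMat d A).trace := by
  -- By Cramer's rule each diagonal entry is the determinant of A with one column differentiated,
  -- which matches the Leibniz expansion of the derivative of the determinant.
  have h1 : (A.adjugate * dMat d A).trace = ∑ i, (A.updateCol i fun j => d (A j i)).det := by
    refine Finset.sum_congr rfl fun i _ => ?_
    rw [← Matrix.cramer_apply, Matrix.cramer_eq_adjugate_mulVec]
    rfl
  rw [h1]
  simp only [Matrix.det_apply, map_sum]
  rw [Finset.sum_comm]
  refine Finset.sum_congr rfl fun p _ => ?_
  rw [← Finset.smul_sum, Units.smul_def, Units.smul_def, map_zsmul, derivation_prod]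
  congr 1
  refine Finset.sum_congr rfl fun i _ => ?_
  rw [← Finset.mul_prod_erase _ _ (Finset.mem_univ i)]
  congr 1
  · simp
  · refine Finset.prod_congr rfl fun j hj => ?_
    rw [Matrix.updateCol_ne (Finset.ne_of_mem_erase hj)]

end

/-! ### Local metric connections and their curvature -/

/-- A torsion-free metric connection in local coordinates, over a ring with commuting
derivations. The matrix `Γ k` has the entry `Γ^i_{kj}` in row `i` and column `j`. -/
structure MetricConnection (n : ℕ) (R : Type*) [CommRing R] [Algebra ℝ R] where
  D : Fin n → Derivation ℝ R R
  D_comm : ∀ a b f, D a (D b f) = D b (D a f)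
  G : Matrix (Fin n) (Fin n) R
  Ginv : Matrix (Fin n) (Fin n) R
  Γ : Fin n → Matrix (Fin n) (Fin n) R
  symm : Gᵀ = G
  inv_mul : Ginv * G = 1
  torsion : ∀ a b c, Γ a c b = Γ b c a
  compat : ∀ a, dMat (D a) G = (Γ a)ᵀ * G + G * Γ a

/-- The algebraic symmetries of a curvature tensor `Z^i_{jkl}`, given by the matrices
`Z k l`. -/
structure IsCurvatureLike (G : Matrix (Fin n) (Fin n) R)
    (Z : Fin n → Fin n → Matrix (Fin n) (Fin n) R) : Prop where
  skew : ∀ k l, (G * Z k l)ᵀ = -(G * Z k l)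
  swap : ∀ k l, Z k l = -Z l k
  bianchi : ∀ i j k l, Z k l i j + Z l j i k + Z j k i l = 0

/-- The classical octahedron argument: a signed sum of four Bianchi identities, simplified by the
two skew symmetries, leaves twice the claim. -/
theorem pair_symm_of_symmetries {F : Fin n → Fin n → Fin n → Fin n → R}
    (h1 : ∀ i j k l, F j i k l = -F i j k l) (h2 : ∀ i j k l, F i j l k = -F i j k l)
    (h3 : ∀ i j k l, F i j k l + F i k l j + F i l j k = 0) (i j k l : Fin n) :
    F i j k l = F k l i j := by
  apply two_mul_cancel_of_algebra
  linear_combination h3 i j k l - h3 j k l i - h3 k l i j + h3 l i j k + h1 i j k l + h1 i k j l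
    - h2 i k j l + h1 j k l i - h1 i l j k - h1 j l k i + h2 j l k i - h1 k l i j

theorem IsCurvatureLike.pair_symm {G : Matrix (Fin n) (Fin n) R}
    {Z : Fin n → Fin n → Matrix (Fin n) (Fin n) R} (hZ : IsCurvatureLike G Z) (i j k l : Fin n) :
    (G * Z k l) i j = (G * Z i j) k l := by
  refine pair_symm_of_symmetries (F := fun i j k l => (G * Z k l) i j) ?_ ?_ ?_ i j k l
  · intro i j k l
    exact congrFun (congrFun (hZ.skew k l) i) j
  · intro i j k l
    rw [hZ.swap l k, mul_neg, Matrix.neg_apply]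
  · intro i j k l
    simp only [Matrix.mul_apply, ← Finset.sum_add_distrib, ← mul_add]
    exact Finset.sum_eq_zero fun p _ => by rw [hZ.bianchi, mul_zero]

/-- The symmetrised product of the coordinate vector `e_k` with a vector. -/
def symProd (k : Fin n) (u : Fin n → R) : Matrix (Fin n) (Fin n) R :=
  vecMulVec (Pi.single k 1) u + (vecMulVec (Pi.single k 1) u)ᵀ

namespace MetricConnection

variable (C : MetricConnection n R)

theorem mul_inv : C.G * C.Ginv = 1 := mul_eq_one_comm.1 C.inv_mul

theorem Ginv_symm : C.Ginvᵀ = C.Ginv := by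
  have h : C.Ginvᵀ * C.G = 1 := by
    rw [← C.symm, ← Matrix.transpose_mul, C.mul_inv, Matrix.transpose_one]
  calc C.Ginvᵀ = C.Ginvᵀ * (C.G * C.Ginv) := by rw [C.mul_inv, mul_one]
    _ = C.Ginv := by rw [← mul_assoc, h, one_mul]

theorem dMat_comm (k l : Fin n) (A : Matrix (Fin n) (Fin n) R) :
    dMat (C.D k) (dMat (C.D l) A) = dMat (C.D l) (dMat (C.D k) A) := by
  ext i j
  exact C.D_comm k l (A i j)

theorem dVec_comm (k l : Fin n) (u : Fin n → R) :
    dVec (C.D k) (dVec (C.D l) u) = dVec (C.D l) (dVec (C.D k) u) := by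
  ext i
  exact C.D_comm k l (u i)

theorem Γ_mulVec_single (k l : Fin n) :
    C.Γ k *ᵥ Pi.single l 1 = C.Γ l *ᵥ Pi.single k 1 := by
  ext i
  simp [C.torsion k l i]

/-- The curvature: the entry `(i, j)` of `C.curv k l` is `R^i_{jkl}`. -/
def curv (k l : Fin n) : Matrix (Fin n) (Fin n) R :=
  dMat (C.D k) (C.Γ l) - dMat (C.D l) (C.Γ k) + C.Γ k * C.Γ l - C.Γ l * C.Γ k

/-- Skewness comes from commuting the second derivatives of the metric, each expressed by metric
compatibility; the Bianchi identity comes from the vanishing torsion. -/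
theorem curv_isCurvatureLike : IsCurvatureLike C.G C.curv where
  skew k l := by
    have h := C.dMat_comm k l C.G
    simp only [C.compat, dMat_add, dMat_mul, dMat_transpose] at h
    rw [Matrix.transpose_mul, C.symm, curv]
    simp only [Matrix.transpose_add, Matrix.transpose_sub, Matrix.transpose_mul]
    rw [← sub_eq_zero] at h ⊢
    rw [← h]
    noncomm_ring
  swap k l := by
    unfold curv
    abel
  bianchi i j k l := by
    have hd : ∀ a b c, C.D a (C.Γ b i c) = C.D a (C.Γ c i b) := fun a b c => by rw [C.torsion]
    have hm : ∀ a b c, (C.Γ a * C.Γ b) i c = (C.Γ a * C.Γ c) i b := fun a b c => by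
      simp only [Matrix.mul_apply, C.torsion b c]
    simp only [curv, Matrix.add_apply, Matrix.sub_apply, dMat_apply]
    linear_combination hd k l j + hd l j k + hd j k l + hm k l j + hm l j k + hm j k l

theorem trace_curv (k l : Fin n) : (C.curv k l).trace = 0 := by
  have h1 : C.curv k l = -(C.Ginv * ((C.curv k l)ᵀ * C.G)) := by
    have := C.curv_isCurvatureLike.skew k l
    rw [Matrix.transpose_mul, C.symm] at this
    rw [this, mul_neg, neg_neg, ← mul_assoc, C.inv_mul, one_mul]
  have h2 : (C.curv k l).trace = -(C.curv k l).trace := by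
    conv_lhs => rw [h1]
    rw [Matrix.trace_neg, Matrix.trace_mul_comm, mul_assoc, C.mul_inv, mul_one,
      Matrix.trace_transpose]
  apply two_mul_cancel_of_algebra
  linear_combination h2

/-- The density bundles are flat, because the curvature is trace-free. Hence the weights contribute
nothing to the Ricci identities below. -/
theorem trace_Γ_closed (k l : Fin n) :
    C.D k (C.Γ l).trace = C.D l (C.Γ k).trace := by
  have h := C.trace_curv k l
  rw [curv, Matrix.trace_sub, Matrix.trace_add, Matrix.trace_sub, Matrix.trace_mul_comm,
    ← derivation_trace, ← derivation_trace] at h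
  linear_combination h

/-- The Ricci identity for a solution of the metrisability equation. -/
theorem curv_mul_add {σ : Matrix (Fin n) (Fin n) R} {μ : Fin n → R} {γ : Fin n → R}
    (hγ : ∀ k l, C.D k (γ l) = C.D l (γ k))
    (hσ : ∀ l, dMat (C.D l) σ
      = -(C.Γ l * σ) - σ * (C.Γ l)ᵀ - γ l • σ - symProd l μ)
    {N : Fin n → Fin n → R} (hN : ∀ l, N l = dVec (C.D l) μ + C.Γ l *ᵥ μ + γ l • μ)
    (k l : Fin n) :
    C.curv k l * σ + σ * (C.curv k l)ᵀ = symProd k (N l) - symProd l (N k) := by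
  -- The components of e_l are constant, so only μ is differentiated, and its derivative is traded
  -- for the covariant derivative N.
  have hE : ∀ k l, dMat (C.D k) (vecMulVec (Pi.single l 1) μ)
      = vecMulVec (Pi.single l 1) (N k) - vecMulVec (Pi.single l 1) μ * (C.Γ k)ᵀ
        - γ k • vecMulVec (Pi.single l 1) μ := by
    intro k l
    rw [dMat_vecMulVec, dVec_single, zero_vecMulVec, zero_add, vecMulVec_mul, vecMul_transpose,
      ← vecMulVec_smul, ← vecMulVec_sub, ← vecMulVec_sub, hN]
    congr 1
    abel
  -- Vanishing torsion removes the Christoffel terms that act on e_k and e_l.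
  have hΓ : ∀ k l, C.Γ k * vecMulVec (Pi.single l 1) μ = C.Γ l * vecMulVec (Pi.single k 1) μ := by
    intro k l
    rw [mul_vecMulVec, mul_vecMulVec, C.Γ_mulVec_single]
  have hΓ' := congrArg Matrix.transpose (hΓ k l)
  have hΓ := hΓ k l
  have h := C.dMat_comm k l σ
  simp only [hσ, symProd, dMat_add, dMat_sub, dMat_neg, dMat_mul, dMat_transpose, dMat_smul, hE,
    hγ k l] at h
  unfold curv symProd
  generalize vecMulVec (Pi.single l 1) μ = El at *
  generalize vecMulVec (Pi.single k 1) μ = Ek at *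
  simp only [Matrix.transpose_add, Matrix.transpose_sub, Matrix.transpose_mul,
    Matrix.transpose_smul, Matrix.transpose_transpose, mul_add, add_mul, mul_sub, sub_mul, mul_neg,
    neg_mul, Matrix.smul_mul, Matrix.mul_smul, smul_add, smul_sub, smul_neg, neg_sub, neg_add,
    mul_assoc, smul_smul] at h hΓ hΓ' ⊢
  linear_combination (norm := skip) -h - hΓ - hΓ'
  module

end MetricConnection

end

/-! ### Integrability conditions of the prolonged system -/

section

open Matrix

variable {n : ℕ} {R : Type*} [CommRing R] [Algebra ℝ R]

/-- Multiplication by G on the right turns the transpose of Z into -GZ, so the integrability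
condition becomes a commutator. -/
theorem IsCurvatureLike.mul_comm_of {G σ : Matrix (Fin n) (Fin n) R} (hG : Gᵀ = G)
    {Z : Fin n → Fin n → Matrix (Fin n) (Fin n) R} (hZ : IsCurvatureLike G Z)
    (h : ∀ k l, Z k l * σ + σ * (Z k l)ᵀ = 0) (k l : Fin n) :
    Z k l * (σ * G) = σ * G * Z k l := by
  have h1 := hZ.skew k l
  rw [Matrix.transpose_mul, hG] at h1
  have h2 : Z k l * σ = -(σ * (Z k l)ᵀ) := eq_neg_of_add_eq_zero_left (h k l)
  rw [← mul_assoc, h2, neg_mul, mul_assoc, h1, mul_neg, neg_neg, mul_assoc]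

/-- A symmetric solution of the integrability condition `Z k l * σ + σ * (Z k l)ᵀ = 0`
can be moved to each slot of a curvature tensor. -/
theorem IsCurvatureLike.mul_eq_sum {G Ginv σ : Matrix (Fin n) (Fin n) R} (hG : Gᵀ = G)
    (hinv : Ginv * G = 1) (hσ : σᵀ = σ)
    {Z : Fin n → Fin n → Matrix (Fin n) (Fin n) R} (hZ : IsCurvatureLike G Z)
    (h : ∀ k l, Z k l * σ + σ * (Z k l)ᵀ = 0) (k l : Fin n) :
    σ * G * Z k l = ∑ p, (σ * G) p k • Z p l := by
  set X := σ * G with hX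
  have hGX : Xᵀ * G = G * X := by
    rw [hX, Matrix.transpose_mul, hG, hσ, mul_assoc]
  -- X is self-adjoint for G and commutes with Z, so GXZ inherits the skewness of GZ. It thus has
  -- all the Riemann symmetries, and its pair symmetry carries X from one index pair to the other.
  have hF1 : ∀ i j k l, (G * X * Z k l) j i = -(G * X * Z k l) i j := by
    intro i j k l
    have h1 := hZ.skew k l
    rw [Matrix.transpose_mul, hG] at h1
    have h2 : (G * X * Z k l)ᵀ = -(G * X * Z k l) := by
      rw [Matrix.transpose_mul, ← hGX, Matrix.transpose_mul, Matrix.transpose_transpose, hG,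
        ← mul_assoc, h1, neg_mul, mul_assoc, hX, hZ.mul_comm_of hG h k l, ← hX, ← mul_assoc,
        hGX]
    exact congrFun (congrFun h2 i) j
  have hF2 : ∀ i j k l, (G * X * Z l k) i j = -(G * X * Z k l) i j := by
    intro i j k l
    rw [hZ.swap l k, mul_neg, Matrix.neg_apply]
  have hF3 : ∀ i j k l, (G * X * Z k l) i j + (G * X * Z l j) i k + (G * X * Z j k) i l = 0 := by
    intro i j k l
    rw [Matrix.mul_apply, Matrix.mul_apply, Matrix.mul_apply, ← Finset.sum_add_distrib,
      ← Finset.sum_add_distrib]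
    exact Finset.sum_eq_zero fun p _ => by rw [← mul_add, ← mul_add, hZ.bianchi, mul_zero]
  have hpair := pair_symm_of_symmetries (F := fun i j k l => (G * X * Z k l) i j) hF1 hF2 hF3
  have key : G * (X * Z k l) = G * ∑ p, X p k • Z p l := by
    ext b j
    rw [← mul_assoc]
    refine (hpair b j k l).trans ?_
    rw [← hGX, mul_assoc, Matrix.mul_apply, Finset.mul_sum, Matrix.sum_apply]
    refine Finset.sum_congr rfl fun p _ => ?_
    rw [Matrix.transpose_apply, hZ.pair_symm, Matrix.mul_smul, Matrix.smul_apply, smul_eq_mul]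
  calc X * Z k l = Ginv * (G * (X * Z k l)) := by rw [← mul_assoc, hinv, one_mul]
    _ = _ := by rw [key, ← mul_assoc, hinv, one_mul]

theorem symProd_sub (k : Fin n) (u v : Fin n → R) :
    symProd k (u - v) = symProd k u - symProd k v := by
  simp only [symProd, vecMulVec_sub, transpose_sub]
  abel

theorem symProd_smul (k : Fin n) (r : R) (u : Fin n → R) :
    symProd k (r • u) = r • symProd k u := by
  simp only [symProd, vecMulVec_smul, transpose_smul, smul_add]

theorem symProd_single (k l : Fin n) :
    symProd k (Pi.single l (1 : R)) = symProd l (Pi.single k 1) := by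
  simp only [symProd, transpose_vecMulVec]
  exact add_comm _ _

namespace MetricConnection

variable (C : MetricConnection n R)

/-- The curvature tensor of constant curvature one. -/
def unitCurv (k l : Fin n) : Matrix (Fin n) (Fin n) R :=
  vecMulVec (Pi.single k 1) (C.G l) - vecMulVec (Pi.single l 1) (C.G k)

theorem G_mulVec_single (k : Fin n) : C.G *ᵥ Pi.single k 1 = C.G k := by
  ext i
  simp only [mulVec_single_one, col_apply]
  exact congrFun (congrFun C.symm k) i

theorem unitCurv_isCurvatureLike : IsCurvatureLike C.G C.unitCurv where
  skew k l := by
    rw [unitCurv, mul_sub, mul_vecMulVec, mul_vecMulVec, G_mulVec_single, G_mulVec_single,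
      transpose_sub, transpose_vecMulVec, transpose_vecMulVec, neg_sub]
  swap k l := by
    unfold unitCurv
    abel
  bianchi i j k l := by
    have h : ∀ a b, C.G a b = C.G b a := fun a b => congrFun (congrFun C.symm b) a
    simp only [unitCurv, Matrix.sub_apply, vecMulVec_apply]
    rw [h l j, h j k, h k l]
    ring

/-- The difference of the curvature and the curvature tensor of constant curvature `B`. -/
def reducedCurv (B : R) (k l : Fin n) : Matrix (Fin n) (Fin n) R :=
  C.curv k l - B • C.unitCurv k l

theorem reducedCurv_isCurvatureLike (B : R) : IsCurvatureLike C.G (C.reducedCurv B) where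
  skew k l := by
    simp only [reducedCurv, mul_sub, Matrix.mul_smul, transpose_sub, transpose_smul,
      C.curv_isCurvatureLike.skew, C.unitCurv_isCurvatureLike.skew]
    module
  swap k l := by
    rw [reducedCurv, reducedCurv, C.curv_isCurvatureLike.swap, C.unitCurv_isCurvatureLike.swap]
    module
  bianchi i j k l := by
    simp only [reducedCurv, Matrix.sub_apply, Matrix.smul_apply, smul_eq_mul]
    linear_combination C.curv_isCurvatureLike.bianchi i j k l
      - B * C.unitCurv_isCurvatureLike.bianchi i j k l

/-- The constant curvature part acts on σ by products of the same shape as the right side of the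
Ricci identity, so it is absorbed by subtracting B X e_l from the derivative of μ. -/
theorem reducedCurv_mul_add {σ : Matrix (Fin n) (Fin n) R} (hs : σᵀ = σ) {μ : Fin n → R}
    {γ : Fin n → R}
    (hγ : ∀ k l, C.D k (γ l) = C.D l (γ k))
    (hσ : ∀ l, dMat (C.D l) σ
      = -(C.Γ l * σ) - σ * (C.Γ l)ᵀ - γ l • σ - symProd l μ)
    {N : Fin n → Fin n → R} {B : R}
    (hN : ∀ l, N l = dVec (C.D l) μ + C.Γ l *ᵥ μ + γ l • μ - B • (σ * C.G) *ᵥ Pi.single l 1)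
    (k l : Fin n) :
    C.reducedCurv B k l * σ + σ * (C.reducedCurv B k l)ᵀ = symProd k (N l) - symProd l (N k) := by
  have h := C.curv_mul_add hγ hσ (fun l => rfl) k l
  have hT : C.unitCurv k l * σ + σ * (C.unitCurv k l)ᵀ
      = symProd k ((σ * C.G) *ᵥ Pi.single l 1) - symProd l ((σ * C.G) *ᵥ Pi.single k 1) := by
    have h1 : ∀ k l : Fin n, vecMulVec (Pi.single k 1) (C.G l) * σ
        = vecMulVec (Pi.single k 1) ((σ * C.G) *ᵥ Pi.single l 1) := by
      intro k l
      rw [vecMulVec_mul, ← mulVec_mulVec, G_mulVec_single, ← mulVec_transpose, hs]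
    have h2 : ∀ k l : Fin n, σ * (vecMulVec (Pi.single k 1) (C.G l))ᵀ
        = (vecMulVec (Pi.single k 1) ((σ * C.G) *ᵥ Pi.single l 1))ᵀ := by
      intro k l
      rw [← h1, transpose_mul, hs]
    simp only [unitCurv, transpose_sub, sub_mul, mul_sub, h1, h2, symProd]
    abel
  rw [hN, hN, symProd_sub, symProd_sub, symProd_smul, symProd_smul,
    reducedCurv, sub_mul, transpose_sub, mul_sub, transpose_smul, Matrix.smul_mul, Matrix.mul_smul]
  linear_combination (norm := module) h - B • hT

theorem dMat_mul_G {σ : Matrix (Fin n) (Fin n) R} {μ : Fin n → R} {γ : Fin n → R}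
    (hσ : ∀ l, dMat (C.D l) σ
      = -(C.Γ l * σ) - σ * (C.Γ l)ᵀ - γ l • σ - symProd l μ) (k : Fin n) :
    dMat (C.D k) (σ * C.G) = σ * C.G * C.Γ k - C.Γ k * (σ * C.G) - γ k • (σ * C.G)
      - symProd k μ * C.G := by
  rw [dMat_mul, hσ, C.compat]
  simp only [mul_add, sub_mul, neg_mul, Matrix.smul_mul, mul_assoc]
  abel

/-- The solutions of the first two equations of the prolonged metrisability system. -/
structure ProlongedSolution (B : R) where
  σ : Matrix (Fin n) (Fin n) R
  μ : Fin n → R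
  ρ : R
  γ : Fin n → R
  symm : σᵀ = σ
  closed : ∀ k l, C.D k (γ l) = C.D l (γ k)
  deriv_σ : ∀ l, dMat (C.D l) σ = -(C.Γ l * σ) - σ * (C.Γ l)ᵀ - γ l • σ - symProd l μ
  deriv_μ : ∀ l, dVec (C.D l) μ = -(C.Γ l *ᵥ μ) - γ l • μ - ρ • Pi.single l 1
    + B • (σ * C.G) *ᵥ Pi.single l 1

namespace ProlongedSolution

variable {C} {B : R} (S : C.ProlongedSolution B)

/-- The endomorphism given by `σ` and the metric. -/
def X : Matrix (Fin n) (Fin n) R := S.σ * C.G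

/-- The covector `∇_l ρ - 2 B μ_l`. -/
def A (l : Fin n) : R := C.D l S.ρ + S.γ l * S.ρ - 2 * B * (C.G *ᵥ S.μ) l

/-- The gradient of the function `B`. -/
def dB (_ : C.ProlongedSolution B) (l : Fin n) : R := C.D l B

/-- Once the second equation holds, N_l = -ρ e_l, and the right side cancels because e_k⊙e_l is
symmetric in k and l. -/
theorem reducedCurv_mul_add_eq_zero (k l : Fin n) :
    C.reducedCurv B k l * S.σ + S.σ * (C.reducedCurv B k l)ᵀ = 0 := by
  rw [C.reducedCurv_mul_add S.symm S.closed S.deriv_σ (N := fun l => -S.ρ • Pi.single l 1)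
    (fun l => by rw [S.deriv_μ]; module), symProd_smul, symProd_smul, symProd_single, sub_self]

theorem reducedCurv_mul_X (k l : Fin n) :
    C.reducedCurv B k l * S.X = S.X * C.reducedCurv B k l :=
  (C.reducedCurv_isCurvatureLike B).mul_comm_of C.symm S.reducedCurv_mul_add_eq_zero k l

theorem X_mul_reducedCurv (k l : Fin n) :
    S.X * C.reducedCurv B k l = ∑ p, S.X p k • C.reducedCurv B p l :=
  (C.reducedCurv_isCurvatureLike B).mul_eq_sum C.symm C.inv_mul S.symm
    S.reducedCurv_mul_add_eq_zero k l

/-- The Ricci identity for the vector `μ`. -/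
theorem reducedCurv_mulVec_μ (k l : Fin n) :
    C.reducedCurv B k l *ᵥ S.μ = S.A l • Pi.single k 1 - S.A k • Pi.single l 1
      + S.dB k • S.X *ᵥ Pi.single l 1 - S.dB l • S.X *ᵥ Pi.single k 1 := by
  have h := C.dVec_comm k l S.μ
  -- This term comes from differentiating X. Its part with C.G k l is symmetric in k and l and drops
  -- out; the other part, together with the action of the constant curvature tensor, makes up the
  -- factor 2 in `A`.
  have hsym : ∀ k l, (symProd k S.μ * C.G) *ᵥ Pi.single l 1
      = (C.G *ᵥ S.μ) l • Pi.single k 1 + C.G k l • S.μ := by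
    intro k l
    rw [← mulVec_mulVec, G_mulVec_single, symProd, add_mulVec, vecMulVec_mulVec,
      transpose_vecMulVec, vecMulVec_mulVec]
    congr 1
    · rw [dotProduct_comm]
      ext i
      simp [mulVec, mul_comm]
    · ext i
      simp only [Pi.smul_apply, single_one_dotProduct, MulOpposite.smul_eq_mul_unop,
        MulOpposite.unop_op, smul_eq_mul]
      rw [mul_comm, ← congrFun (congrFun C.symm l) k, transpose_apply]
  have hu : ∀ k l, C.unitCurv k l *ᵥ S.μ
      = (C.G *ᵥ S.μ) l • Pi.single k 1 - (C.G *ᵥ S.μ) k • Pi.single l 1 := by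
    intro k l
    rw [unitCurv, sub_mulVec, vecMulVec_mulVec, vecMulVec_mulVec]
    congr 1 <;> · ext i; simp [mulVec, mul_comm]
  have hG : C.G k l = C.G l k := congrFun (congrFun C.symm l) k
  have hΓ := congrArg (S.X *ᵥ ·) (C.Γ_mulVec_single k l)
  have hΓ1 := C.Γ_mulVec_single k l
  have hX := C.dMat_mul_G S.deriv_σ
  change ∀ k, dMat (C.D k) S.X = S.X * C.Γ k - C.Γ k * S.X - S.γ k • S.X - symProd k S.μ * C.G
    at hX
  have hm : ∀ l, dVec (C.D l) S.μ = -(C.Γ l *ᵥ S.μ) - S.γ l • S.μ - S.ρ • Pi.single l 1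
    + B • S.X *ᵥ Pi.single l 1 := S.deriv_μ
  rw [reducedCurv, sub_mulVec, smul_mulVec, hu]
  simp only [hm, dVec_add, dVec_sub, dVec_neg, dVec_mulVec, dVec_smul, dVec_single, hX,
    S.closed k l, sub_mulVec, smul_mulVec, hsym, mulVec_zero, hG] at h
  unfold curv A dB
  simp only [sub_mulVec, add_mulVec, mulVec_add, mulVec_sub, mulVec_neg, mulVec_smul,
    ← mulVec_mulVec, smul_add, smul_sub, smul_neg, smul_smul, neg_sub, neg_add] at h hΓ hΓ1 ⊢
  linear_combination (norm := skip) -h - S.ρ • hΓ1 + B • hΓ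
  module

/-- The quadratic equation satisfied by the endomorphism `X`. -/
theorem X_quadratic (k : Fin n) :
    S.dB k • (S.X * S.X) - (S.A k + (S.dB ᵥ* S.X) k) • S.X + (S.A ᵥ* S.X) k • 1 = 0 := by
  ext1 i l
  -- X is applied to the Ricci identity for μ in two ways: directly, and through the index k of the
  -- curvature. In the comparison, the terms carrying A_l or ∇_lB cancel.
  have h : ∀ l, S.X *ᵥ (C.reducedCurv B k l *ᵥ S.μ)
      = ∑ p, S.X p k • (C.reducedCurv B p l *ᵥ S.μ) := by
    intro l
    rw [mulVec_mulVec, X_mul_reducedCurv, sum_mulVec]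
    simp only [smul_mulVec]
  have hl := congrFun (h l) i
  simp only [reducedCurv_mulVec_μ, mulVec_add, mulVec_sub, mulVec_smul, Finset.sum_apply,
    Pi.add_apply, Pi.sub_apply, Pi.smul_apply, smul_eq_mul, mulVec_single_one, col_apply,
    mul_add, mul_sub, Finset.sum_add_distrib, Finset.sum_sub_distrib] at hl
  have e1 : ∑ p, S.X p k * (S.A l * (Pi.single p 1 : Fin n → R) i) = S.A l * S.X i k := by
    simp [Pi.single_apply, mul_comm]
  have e2 : ∑ p, S.X p k * (S.A p * (Pi.single l 1 : Fin n → R) i)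
      = (S.A ᵥ* S.X) k * (1 : Matrix (Fin n) (Fin n) R) i l := by
    rw [vecMul, dotProduct, Finset.sum_mul]
    exact Finset.sum_congr rfl fun p _ => by rw [Matrix.one_apply, Pi.single_apply]; ring
  have e3 : ∑ p, S.X p k * (S.dB p * S.X i l) = (S.dB ᵥ* S.X) k * S.X i l := by
    rw [vecMul, dotProduct, Finset.sum_mul]
    exact Finset.sum_congr rfl fun p _ => by ring
  have e4 : ∑ p, S.X p k * (S.dB l * S.X i p) = S.dB l * (S.X * S.X) i k := by
    rw [Matrix.mul_apply, Finset.mul_sum]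
    exact Finset.sum_congr rfl fun p _ => by ring
  have e5 : ∀ l, (S.X *ᵥ S.X.col l) i = (S.X * S.X) i l := fun l => rfl
  rw [e1, e2, e3, e4, e5, e5] at hl
  simp only [Matrix.add_apply, Matrix.sub_apply, Matrix.smul_apply, smul_eq_mul,
    Matrix.zero_apply]
  linear_combination hl

/-- The weight-free part of the covariant derivative of `X`. -/
def K (e : Fin n) : Matrix (Fin n) (Fin n) R := -(symProd e S.μ * C.G)

/-- The covariant derivative of the quadratic equation for `X`. -/
theorem exists_deriv_X_quadratic (k e : Fin n) : ∃ a b c : R,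
    S.dB k • (S.X * S.K e + S.K e * S.X) = (S.A k + (S.dB ᵥ* S.X) k) • S.K e
      + a • (S.X * S.X) + b • S.X + c • 1 := by
  have hX : dMat (C.D e) S.X = S.X * C.Γ e - C.Γ e * S.X - S.γ e • S.X + S.K e := by
    rw [K, ← sub_eq_add_neg]
    exact C.dMat_mul_G S.deriv_σ e
  have hq := S.X_quadratic k
  generalize S.A k + (S.dB ᵥ* S.X) k = t at hq ⊢
  generalize (S.A ᵥ* S.X) k = d at hq
  generalize S.dB k = p at hq ⊢
  have h := congrArg (dMat (C.D e)) hq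
  have h0 : dMat (C.D e) (0 : Matrix (Fin n) (Fin n) R) = 0 := by
    ext; simp
  simp only [dMat_add, dMat_sub, dMat_smul, dMat_mul, dMat_one, hX, h0, smul_zero, add_zero] at h
  -- The Christoffel terms of the derivative assemble into the commutator of the quadratic equation
  -- with Γ_e, which is zero.
  have h1 := congrArg (C.Γ e * ·) hq
  have h2 := congrArg (· * C.Γ e) hq
  -- The witnesses collect the derivatives of the three coefficients and the weight terms, of which
  -- X² carries two and X one.
  refine ⟨-C.D e p + 2 * S.γ e * p, C.D e t - t * S.γ e, -C.D e d, ?_⟩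
  simp only [mul_add, add_mul, mul_sub, sub_mul, Matrix.smul_mul, Matrix.mul_smul, mul_assoc,
    mul_one, one_mul, mul_zero, zero_mul, smul_add, smul_sub, smul_smul] at h h1 h2 ⊢
  linear_combination (norm := skip) h + h1 - h2
  module

end ProlongedSolution

end MetricConnection

end

/-! ### Linear algebra of the quadratic equation -/

section

open Matrix

variable {n : ℕ} {F : Type*} [Field F] [CharZero F]

/-- A symmetric matrix for which `P_{ae} ν_b + ν_a P_{eb}` is a multiple of `P_{ab}` for each `e`
has rank at most one, unless `ν` vanishes. -/
theorem eq_smul_vecMulVec {P : Matrix (Fin n) (Fin n) F} (hP : Pᵀ = P) {ν r : Fin n → F}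
    (hν : ν ≠ 0) (h : ∀ e a b, P a e * ν b + ν a * P e b = r e * P a b) :
    ∃ κ : F, P = κ • vecMulVec ν ν := by
  have hs : ∀ a b, P a b = P b a := fun a b => congrFun (congrFun hP b) a
  obtain ⟨i, hi⟩ := Function.ne_iff.1 hν
  simp only [Pi.zero_apply] at hi
  have h1 : ∀ e, 2 * P i e * ν i = r e * P i i := fun e => by
    rw [← h e i i, hs e i]; ring
  by_cases h0 : P i i = 0
  · have h2 : ∀ e, P i e = 0 := fun e => by
      have := h1 e
      rw [h0, mul_zero] at this
      simpa [hi] using this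
    refine ⟨0, ?_⟩
    ext e b
    have := h e i b
    rw [h2, h2, zero_mul, mul_zero, zero_add] at this
    simpa [hi] using this
  · have h2 : ∀ e b, P i i * (P i e * ν b + ν i * P e b) = 2 * P i e * ν i * P i b := fun e b => by
      rw [h e i b, h1]; ring
    -- The right side of `h2` is symmetric in e and b, so the left side is too; hence row i of P is
    -- proportional to ν.
    have h3 : ∀ e b, P i e * ν b = P i b * ν e := fun e b => by
      apply mul_left_cancel₀ h0
      have := h2 b e
      rw [hs b e] at this
      linear_combination h2 e b - this
    refine ⟨P i i / ν i ^ 2, ?_⟩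
    ext e b
    have h4 : ∀ e, P i e = P i i * ν e / ν i := fun e => by
      rw [eq_div_iff hi, h3]
    have h5 := h2 e b
    rw [h4 e, h4 b] at h5
    have h6 : P i i * (ν i ^ 2 * P e b) = P i i * (P i i * (ν e * ν b)) := by
      field_simp at h5
      linear_combination P i i * h5
    have h7 := mul_left_cancel₀ h0 h6
    simp only [Matrix.smul_apply, vecMulVec_apply, smul_eq_mul]
    field_simp
    linear_combination h7

/-- If ν ≠ 0, then P is a nonzero multiple of ν⊗ν, so PZ is a multiple of ν⊗νZ. A skew matrix of
rank at most one is zero. -/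
theorem vecMul_eq_zero_of_skew {P Z : Matrix (Fin n) (Fin n) F} (hP : Pᵀ = P) (hP0 : P ≠ 0)
    (hPZ : (P * Z)ᵀ = -(P * Z)) {ν r : Fin n → F}
    (h : ∀ e a b, P a e * ν b + ν a * P e b = r e * P a b) : ν ᵥ* Z = 0 := by
  by_cases hν : ν = 0
  · rw [hν, zero_vecMul]
  obtain ⟨κ, hκ⟩ := eq_smul_vecMulVec hP hν h
  have hκ0 : κ ≠ 0 := by
    rintro rfl
    exact hP0 (by rw [hκ, zero_smul])
  obtain ⟨i, hi⟩ := Function.ne_iff.1 hν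
  simp only [Pi.zero_apply] at hi
  rw [hκ, Matrix.smul_mul, vecMulVec_mul] at hPZ
  generalize ν ᵥ* Z = z at hPZ ⊢
  have h1 : ∀ a b, ν b * z a = -(ν a * z b) := fun a b => by
    have := congrFun (congrFun hPZ a) b
    simp only [transpose_apply, Matrix.smul_apply, vecMulVec_apply, smul_eq_mul,
      Matrix.neg_apply] at this
    apply mul_left_cancel₀ hκ0
    linear_combination this
  have h2 : z i = 0 := by
    have : 2 * (ν i * z i) = 0 := by linear_combination h1 i i
    simpa [hi] using this
  ext b
  have := h1 i b
  rw [h2, mul_zero, eq_comm, neg_eq_zero] at this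
  simpa [hi] using this

theorem mul_symProd_mul_mul {G N : Matrix (Fin n) (Fin n) F} (μ : Fin n → F)
    (e : Fin n) (hP : (G * N)ᵀ = G * N) :
    G * (N * (symProd e μ * G) * N) = Matrix.of fun a b => (G * N) a e * (μ ᵥ* (G * N)) b
      + (μ ᵥ* (G * N)) a * (G * N) e b := by
  have h1 : G * (N * (symProd e μ * G) * N) = (G * N) * symProd e μ * (G * N) := by
    simp only [mul_assoc]
  rw [h1, symProd, mul_add, add_mul, transpose_vecMulVec, mul_vecMulVec, mul_vecMulVec,
    vecMulVec_mul, vecMulVec_mul, ← vecMul_transpose, ← vecMul_transpose, hP]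
  ext a b
  have h2 : ∀ a, (G * N) a e = (G * N) e a := fun a => congrFun (congrFun hP e) a
  simp [vecMulVec_apply, h2 a]

/-- Sandwiching the differentiated equation between copies of X - t gives the index identity of
`eq_smul_vecMulVec` for P = G(X - t) and ν = μP, hence (X - t)Zμ = 0. Exchanging the roots gives (X
- s)Zμ = 0. Distinct roots finish the proof by subtraction; a double root, where X - s is nilpotent,
needs a second round and n ≠ 2. -/
theorem mulVec_eq_zero_of_quadratic {G Ginv X Z : Matrix (Fin n) (Fin n) F} (hn : n ≠ 2)
    (hG : Gᵀ = G) (hinv : Ginv * G = 1) (hX : (G * X)ᵀ = G * X) (hZ : (G * Z)ᵀ = -(G * Z))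
    (hZX : Z * X = X * Z) {s t : F} (hquad : (X - s • 1) * (X - t • 1) = 0)
    (hXs : ∀ r : F, X ≠ r • 1) {μ : Fin n → F} {c d : Fin n → F}
    (hK : ∀ e, X * (symProd e μ * G) + symProd e μ * G * X
      = (s + t) • (symProd e μ * G) + c e • X + d e • 1) : Z *ᵥ μ = 0 := by
  have hinj : ∀ A : Matrix (Fin n) (Fin n) F, G * A = 0 → A = 0 := fun A hA => by
    rw [← one_mul A, ← hinv, mul_assoc, hA, mul_zero]
  have hinj' : ∀ u : Fin n → F, G *ᵥ u = 0 → u = 0 := fun u hu => by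
    rw [← one_mulVec u, ← hinv, ← mulVec_mulVec, hu, mulVec_zero]
  have hP : ∀ r : F, (G * (X - r • 1))ᵀ = G * (X - r • 1) := fun r => by
    rw [mul_sub, transpose_sub, hX, Matrix.mul_smul, mul_one, transpose_smul, hG]
  have hP0 : ∀ r : F, G * (X - r • 1) ≠ 0 := fun r h => hXs r (sub_eq_zero.1 (hinj _ h))
  have hcomm : ∀ r : F, Z * (X - r • 1) = (X - r • 1) * Z := fun r => by
    rw [mul_sub, sub_mul, hZX, Matrix.mul_smul, Matrix.smul_mul, mul_one, one_mul]
  have hZ' : Zᵀ * G = -(G * Z) := by rw [← hZ, transpose_mul, hG]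
  have hPZ : ∀ r : F, (G * (X - r • 1) * Z)ᵀ = -(G * (X - r • 1) * Z) := fun r => by
    rw [transpose_mul, hP, ← mul_assoc, hZ', neg_mul, mul_assoc, hcomm, mul_assoc]
  have hquad' : (X - t • 1) * (X - s • 1) = 0 := by
    rw [← hquad]
    simp only [mul_sub, sub_mul, Matrix.mul_smul, Matrix.smul_mul, mul_one, one_mul, smul_smul]
    module
  have stage : ∀ s t : F, (X - s • 1) * (X - t • 1) = 0 → (X - t • 1) * (X - s • 1) = 0 →
      (∀ e, X * (symProd e μ * G) + symProd e μ * G * X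
        = (s + t) • (symProd e μ * G) + c e • X + d e • 1) →
      ∀ e, (X - t • 1) * (symProd e μ * G) * (X - t • 1)
        = (d e + c e * s) • (X - t • 1) := by
    intro s t h1 h2 h3 e
    have h5 : X * (symProd e μ * G) + symProd e μ * G * X - (s + t) • (symProd e μ * G)
        = (X - s • 1) * (symProd e μ * G) + symProd e μ * G * (X - t • 1) := by
      simp only [mul_sub, sub_mul, Matrix.mul_smul, Matrix.smul_mul, mul_one, one_mul]
      module
    have h6 : (X - s • 1) * (symProd e μ * G) + symProd e μ * G * (X - t • 1)
        = c e • (X - s • 1) + (d e + c e * s) • 1 := by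
      rw [← h5, h3 e]
      module
    -- Multiplication by X - t annihilates every term with the factor X - s on the left.
    have h7 := congrArg ((X - t • 1) * ·) h6
    simp only [mul_add, ← mul_assoc, h2, zero_mul, zero_add, Matrix.mul_smul, smul_zero,
      mul_one] at h7
    rw [← h7]
    simp only [mul_assoc]
  have stage' : ∀ s t : F, (X - s • 1) * (X - t • 1) = 0 → (X - t • 1) * (X - s • 1) = 0 →
      (∀ e, X * (symProd e μ * G) + symProd e μ * G * X
        = (s + t) • (symProd e μ * G) + c e • X + d e • 1) →
      ∀ e a b, (G * (X - t • 1)) a e * (μ ᵥ* (G * (X - t • 1))) b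
        + (μ ᵥ* (G * (X - t • 1))) a * (G * (X - t • 1)) e b
        = (d e + c e * s) * (G * (X - t • 1)) a b := by
    intro s t h1 h2 h3 e a b
    have h4 := congrFun (congrFun (mul_symProd_mul_mul μ e (hP t)) a) b
    rw [stage s t h1 h2 h3 e, Matrix.mul_smul, Matrix.smul_apply, smul_eq_mul, of_apply] at h4
    exact h4.symm
  have final : ∀ s t : F, (X - s • 1) * (X - t • 1) = 0 → (X - t • 1) * (X - s • 1) = 0 →
      (∀ e, X * (symProd e μ * G) + symProd e μ * G * X
        = (s + t) • (symProd e μ * G) + c e • X + d e • 1) →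
      (X - t • 1) *ᵥ (Z *ᵥ μ) = 0 := by
    intro s t h1 h2 h3
    have h4 := vecMul_eq_zero_of_skew (hP t) (hP0 t) (hPZ t) (stage' s t h1 h2 h3)
    rw [vecMul_vecMul] at h4
    apply hinj'
    rw [mulVec_mulVec, mulVec_mulVec, ← vecMul_transpose, hPZ, vecMul_neg, h4, neg_zero]
  have f1 := final s t hquad hquad' hK
  have f2 := final t s hquad' hquad (fun e => by rw [hK e, add_comm s t])
  by_cases hst : s = t
  · subst hst
    set N := X - s • (1 : Matrix (Fin n) (Fin n) F) with hN
    have hXN : X = N + s • 1 := by rw [hN]; abel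
    set ν := μ ᵥ* (G * N) with hν
    have hνc : (G * N) *ᵥ μ = ν := by rw [← vecMul_transpose, hP s]
    have hKN : ∀ e, N * (symProd e μ * G) + symProd e μ * G * N
        = c e • N + (d e + c e * s) • 1 := by
      intro e
      have := hK e
      rw [hXN] at this
      simp only [add_mul, mul_add, Matrix.smul_mul, Matrix.mul_smul, one_mul, mul_one] at this
      linear_combination (norm := module) this
    have hr := stage' s s hquad hquad' hK
    -- If ν ≠ 0, then N has rank one and N² = 0, so N is trace-free. The trace of `hKN` then reads
    -- 4ν_i = 2nν_i, which is where n ≠ 2 enters.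
    have hν0 : ν = 0 := by
      by_contra hν0
      obtain ⟨κ, hκ⟩ := eq_smul_vecMulVec (hP s) hν0 hr
      have hκ0 : κ ≠ 0 := by
        rintro rfl
        exact hP0 s (by rw [hκ, zero_smul])
      obtain ⟨i, hi⟩ := Function.ne_iff.1 hν0
      simp only [Pi.zero_apply] at hi
      have hri : d i + c i * s = 2 * ν i := by
        have := hr i i i
        simp only [← hN, ← hν] at this hκ
        rw [hκ] at this
        simp only [Matrix.smul_apply, vecMulVec_apply, smul_eq_mul] at this
        have h3 : κ * (ν i * ν i) ≠ 0 := mul_ne_zero hκ0 (mul_ne_zero hi hi)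
        apply mul_right_cancel₀ h3
        linear_combination -this
      simp only [← hN] at hκ
      have hNf : N = κ • vecMulVec (Ginv *ᵥ ν) ν := by
        rw [← one_mul N, ← hinv, mul_assoc, hκ, Matrix.mul_smul, mul_vecMulVec]
      have htr : N.trace = 0 := by
        have h1 : N * N = (κ * (ν ⬝ᵥ (Ginv *ᵥ ν))) • N := by
          conv_lhs => rw [hNf]
          conv_rhs => rw [hNf]
          simp only [Matrix.smul_mul, Matrix.mul_smul, vecMulVec_mul_vecMulVec, smul_smul,
            vecMulVec_smul]
          congr 1
          ring
        have h2 : N ≠ 0 := fun h => hP0 s (by rw [← hN, h, mul_zero])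
        rw [hquad, eq_comm, smul_eq_zero, or_iff_left h2] at h1
        rw [hNf, trace_smul, trace_vecMulVec, dotProduct_comm, smul_eq_mul, h1]
      have h4 := congrArg Matrix.trace (hKN i)
      rw [trace_add, trace_mul_comm (symProd i μ * G), trace_add, trace_smul, trace_smul, htr,
        trace_one, hri, Fintype.card_fin, smul_zero, zero_add, ← mul_assoc, trace_mul_comm,
        ← mul_assoc, symProd, transpose_vecMulVec, mul_add, mul_vecMulVec, mul_vecMulVec,
        trace_add, trace_vecMulVec, trace_vecMulVec, hνc, mulVec_single_one,
        smul_eq_mul] at h4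
      have h5 : (G * N).col i ⬝ᵥ μ = ν i := by
        rw [hν, vecMul, dotProduct_comm]; rfl
      rw [h5, dotProduct_single_one] at h4
      have h6 : ((n : F) - 2) * ν i = 0 := by linear_combination (-1 / 2) * h4
      rcases mul_eq_zero.1 h6 with h7 | h7
      · exact hn (by exact_mod_cast sub_eq_zero.1 h7)
      · exact hi h7
    have hr0 : ∀ e, d e + c e * s = 0 := by
      intro e
      by_contra h0
      apply hP0 s
      ext a b
      have := hr e a b
      simp only [← hN, ← hν, hν0, Pi.zero_apply, mul_zero, zero_mul, zero_add] at this ⊢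
      simpa [h0] using this.symm
    -- With ν = 0, and hence d + cs = 0, the unsandwiched equation already has the required form,
    -- now with Gμ in place of ν; this gives Zμ = 0 directly.
    have hm : ∀ e a b, (G * N) a e * (μ ᵥ* G) b + (μ ᵥ* G) a * (G * N) e b
        = c e * (G * N) a b := by
      intro e a b
      have h1 := congrArg (G * ·) (hKN e)
      simp only [hr0, zero_smul, add_zero, mul_add, symProd, transpose_vecMulVec, add_mul,
        mul_vecMulVec, vecMulVec_mul, Matrix.mul_smul] at h1
      have h2 := congrFun (congrFun h1 a) b
      have h3 : μ ᵥ* G ᵥ* N = 0 := by rw [vecMul_vecMul]; exact hν0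
      have h4 : (G * N) *ᵥ μ = 0 := hνc.trans hν0
      have h5 : (Pi.single e 1 ᵥ* G) ᵥ* N = (G * N) e := by
        rw [vecMul_vecMul, single_one_vecMul]; rfl
      have h6 : G *ᵥ μ = μ ᵥ* G := by rw [← vecMul_transpose, hG]
      have h7 : (G * N) *ᵥ Pi.single e 1 = fun a => (G * N) a e := by
        rw [mulVec_single_one]; rfl
      simp only [mulVec_mulVec, h3, h4, h5, h6, h7, vecMulVec_zero, zero_vecMulVec, add_zero, zero_add,
        Matrix.add_apply, vecMulVec_apply, Matrix.smul_apply, smul_eq_mul] at h2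
      exact h2
    have h1 := vecMul_eq_zero_of_skew (hP s) (hP0 s) (hPZ s) hm
    rw [vecMul_vecMul] at h1
    apply hinj'
    rw [mulVec_mulVec, ← vecMul_transpose, hZ, vecMul_neg, h1, neg_zero]
  · have h1 : (s - t) • (Z *ᵥ μ) = 0 := by
      rw [sub_mulVec, smul_mulVec, one_mulVec] at f1 f2
      linear_combination (norm := module) f1 - f2
    exact (smul_eq_zero.1 h1).resolve_left (sub_ne_zero.2 hst)

end

/-! ### Pointwise consequences of nullity -/

section

open Matrix

variable {n : ℕ}

theorem IsCurvatureLike.map {R S : Type*} [CommRing R] [CommRing S]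
    {G : Matrix (Fin n) (Fin n) R} {Z : Fin n → Fin n → Matrix (Fin n) (Fin n) R}
    (hZ : IsCurvatureLike G Z) (φ : R →+* S) :
    IsCurvatureLike (φ.mapMatrix G) (fun k l => φ.mapMatrix (Z k l)) where
  skew k l := by
    rw [← map_mul, ← map_neg, ← hZ.skew k l]
    rfl
  swap k l := by rw [hZ.swap k l, map_neg]
  bianchi i j k l := by
    have h := congrArg φ (hZ.bianchi i j k l)
    rwa [map_add, map_add, map_zero] at h

section

variable {R : Type*} [CommRing R] [Algebra ℝ R]

/-- The Ricci contraction of a curvature tensor is symmetric. -/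
theorem IsCurvatureLike.ricci_symm {G Ginv : Matrix (Fin n) (Fin n) R} (hinv : Ginv * G = 1)
    (hs : Ginvᵀ = Ginv) {Z : Fin n → Fin n → Matrix (Fin n) (Fin n) R}
    (hZ : IsCurvatureLike G Z) (j k : Fin n) : ∑ a, Z a k a j = ∑ a, Z a j a k := by
  have h : ∀ j k, ∑ a, Z a k a j = ∑ a, ∑ i, Ginv a i * (G * Z a k) i j := fun j k =>
    Finset.sum_congr rfl fun a _ => by
      rw [← Matrix.mul_apply, ← mul_assoc, hinv, one_mul]
  rw [h, h, Finset.sum_comm]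
  refine Finset.sum_congr rfl fun a _ => Finset.sum_congr rfl fun i _ => ?_
  rw [hZ.pair_symm, ← congrFun (congrFun hs a) i, transpose_apply]

/-- Pair symmetry transfers a null vector from the endomorphism slot to a form slot, where it can be
contracted with the integrability condition. -/
theorem IsCurvatureLike.sum_smul_eq_zero {G Ginv : Matrix (Fin n) (Fin n) R}
    (hinv : Ginv * G = 1) {Z : Fin n → Fin n → Matrix (Fin n) (Fin n) R}
    (hZ : IsCurvatureLike G Z) {v : Fin n → R} (hv : ∀ k l, Z k l *ᵥ v = 0) (l : Fin n) :
    ∑ k, v k • Z k l = 0 := by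
  have h : G * ∑ k, v k • Z k l = 0 := by
    ext i j
    rw [Finset.mul_sum, Matrix.sum_apply]
    simp only [Matrix.mul_smul, Matrix.smul_apply, smul_eq_mul, hZ.pair_symm i j]
    have h1 : ((G * Z i j) *ᵥ v) l = 0 := by
      rw [← mulVec_mulVec, hv, mulVec_zero, Pi.zero_apply]
    have h2 : ∀ k, (G * Z i j) k l = -(G * Z i j) l k := fun k =>
      congrFun (congrFun (hZ.skew i j) l) k
    rw [mulVec, dotProduct] at h1
    rw [Matrix.zero_apply, ← neg_eq_zero, ← Finset.sum_neg_distrib, ← h1]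
    exact Finset.sum_congr rfl fun k _ => by rw [h2]; ring
  rw [← one_mul (∑ k, v k • Z k l), ← hinv, mul_assoc, h, mul_zero]

end

section

variable {F : Type*} [Field F] [CharZero F]

/-- Pairing `hp` with v gives zero by skewness, that is p_l(Gv)_k = p_k(Gv)_l. Since Gv ≠ 0 in any
signature, p is proportional to Gv; it is not necessary that v be non-isotropic. -/
theorem exists_eigenvalue_of_nullity {G Ginv : Matrix (Fin n) (Fin n) F} (hG : Gᵀ = G)
    (hinv : Ginv * G = 1) {Rm : Fin n → Fin n → Matrix (Fin n) (Fin n) F}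
    (hskew : ∀ k l, (G * Rm k l)ᵀ = -(G * Rm k l)) {v p : Fin n → F} (hv : v ≠ 0)
    (hp : ∀ k l, Rm k l *ᵥ v = p l • Pi.single k 1 - p k • Pi.single l 1) :
    ∃ b : F, p = b • (G *ᵥ v) := by
  have h1 : ∀ k l, v ⬝ᵥ ((G * Rm k l) *ᵥ v) = 0 := fun k l => by
    have h2 : v ⬝ᵥ ((G * Rm k l) *ᵥ v) = -(v ⬝ᵥ ((G * Rm k l) *ᵥ v)) := by
      conv_lhs => rw [dotProduct_mulVec, ← mulVec_transpose, hskew, neg_mulVec, neg_dotProduct,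
        dotProduct_comm]
    have h3 : 2 * (v ⬝ᵥ ((G * Rm k l) *ᵥ v)) = 0 := by linear_combination h2
    simpa using h3
  have h2 : ∀ k l, p l * (G *ᵥ v) k = p k * (G *ᵥ v) l := fun k l => by
    have h3 := h1 k l
    rw [← mulVec_mulVec, hp, dotProduct_mulVec, ← mulVec_transpose, hG, dotProduct_sub,
      dotProduct_smul, dotProduct_smul, dotProduct_single_one, dotProduct_single_one] at h3
    simp only [smul_eq_mul] at h3
    linear_combination h3
  have h3 : G *ᵥ v ≠ 0 := fun h => hv (by
    rw [← one_mulVec v, ← hinv, ← mulVec_mulVec, h, mulVec_zero])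
  obtain ⟨i, hi⟩ := Function.ne_iff.1 h3
  simp only [Pi.zero_apply] at hi
  refine ⟨p i / (G *ᵥ v) i, ?_⟩
  ext l
  rw [Pi.smul_apply, smul_eq_mul, div_mul_eq_mul_div, eq_div_iff hi, h2]

/-- In the presence of nullity the integrability condition of the metrisability equation
determines the trace-free part of the derivative of `μ`. -/
theorem eq_smul_single_of_nullity (hn : n ≠ 0) {σ : Matrix (Fin n) (Fin n) F}
    {Z : Fin n → Fin n → Matrix (Fin n) (Fin n) F} {v : Fin n → F} (hv : v ≠ 0)
    (hZv : ∀ l, ∑ k, v k • Z k l = 0) {N : Fin n → Fin n → F}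
    (h : ∀ k l, Z k l * σ + σ * (Z k l)ᵀ = symProd k (N l) - symProd l (N k)) (l : Fin n) :
    N l = ((∑ i, N i i) / n) • Pi.single l 1 := by
  set lam := (∑ i, N i i) / (n : F) with hlam
  have hn' : (n : F) ≠ 0 := Nat.cast_ne_zero.2 hn
  set q : Fin n → F := fun c => ∑ k, v k * N k c with hq
  -- The contraction of the integrability condition with v^k, whose left side vanishes by `hZv`.
  have h1 : ∀ l b c, v b * N l c + v c * N l b
      = (1 : Matrix (Fin n) (Fin n) F) b l * q c + (1 : Matrix (Fin n) (Fin n) F) c l * q b := by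
    intro l b c
    have h2 : ∑ k, v k • (symProd k (N l) - symProd l (N k)) = 0 := by
      have h3 : ∑ k, v k • (Z k l * σ + σ * (Z k l)ᵀ)
          = (∑ k, v k • Z k l) * σ + σ * (∑ k, v k • Z k l)ᵀ := by
        rw [Finset.sum_mul, transpose_sum, Finset.mul_sum, ← Finset.sum_add_distrib]
        simp only [smul_add, Matrix.smul_mul, transpose_smul, Matrix.mul_smul]
      simp only [← h]
      rw [h3, hZv]
      simp
    have h3 := congrFun (congrFun h2 b) c
    simp only [Matrix.sum_apply, Matrix.smul_apply, Matrix.sub_apply, symProd, Matrix.add_apply,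
      transpose_apply, vecMulVec_apply, smul_eq_mul, Matrix.zero_apply, mul_sub, mul_add,
      Finset.sum_sub_distrib, Finset.sum_add_distrib] at h3
    have e1 : ∀ b c, ∑ k, v k * ((Pi.single k 1 : Fin n → F) b * N l c) = v b * N l c := by
      intro b c
      simp [Pi.single_apply]
    have e2 : ∀ b c, ∑ k, v k * ((Pi.single l 1 : Fin n → F) b * N k c)
        = (1 : Matrix (Fin n) (Fin n) F) b l * q c := by
      intro b c
      rw [hq, Finset.mul_sum]
      exact Finset.sum_congr rfl fun k _ => by rw [Matrix.one_apply, Pi.single_apply]; ring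
    rw [e1, e1, e2, e2] at h3
    linear_combination h3
  -- Setting b = l and summing identifies q, so that `h1` becomes a symmetrised product of v with
  -- the trace-free part of N_l; such a product vanishes only if a factor does.
  have h2 : ∀ c, q c = lam * v c := by
    intro c
    have h3 : ∑ l, (v l * N l c + v c * N l l)
        = ∑ l, ((1 : Matrix (Fin n) (Fin n) F) l l * q c
          + (1 : Matrix (Fin n) (Fin n) F) c l * q l) :=
      Finset.sum_congr rfl fun l _ => h1 l l c
    simp only [Finset.sum_add_distrib, ← Finset.mul_sum, Matrix.one_apply_eq, one_mul,
      Finset.sum_const, Finset.card_univ, Fintype.card_fin, nsmul_eq_mul] at h3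
    have h4 : ∑ l, (1 : Matrix (Fin n) (Fin n) F) c l * q l = q c := by
      simp [Matrix.one_apply]
    rw [h4] at h3
    rw [hlam, div_mul_eq_mul_div, eq_div_iff hn']
    linear_combination -h3
  obtain ⟨b, hb⟩ := Function.ne_iff.1 hv
  simp only [Pi.zero_apply] at hb
  have h3 : ∀ l b c, v b * (N l c - lam * (1 : Matrix (Fin n) (Fin n) F) c l)
      + v c * (N l b - lam * (1 : Matrix (Fin n) (Fin n) F) b l) = 0 := by
    intro l b c
    have := h1 l b c
    rw [h2, h2] at this
    linear_combination this
  have h4 : N l b - lam * (1 : Matrix (Fin n) (Fin n) F) b l = 0 := by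
    have : 2 * (v b * (N l b - lam * (1 : Matrix (Fin n) (Fin n) F) b l)) = 0 := by
      linear_combination h3 l b b
    simpa [hb] using this
  ext c
  have h5 := h3 l b c
  rw [h4, mul_zero, add_zero] at h5
  have h6 := (mul_eq_zero.1 h5).resolve_left hb
  rw [Pi.smul_apply, smul_eq_mul, Pi.single_apply, ← Matrix.one_apply]
  linear_combination h6

end

namespace MetricConnection.ProlongedSolution

variable {R : Type*} [CommRing R] [Algebra ℝ R] {C : MetricConnection n R} {B : R}
  (S : C.ProlongedSolution B)

/-- The obstruction to the third equation of the prolonged metrisability system. -/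
def obstruction (l : Fin n) : R :=
  ((n : R) - 1) * S.A l + (S.dB ᵥ* S.X) l - S.X.trace * S.dB l

/-- The contraction of the Ricci identity for μ. Consequently the obstruction vanishes wherever Zμ
or μ does. -/
theorem obstruction_eq_sum (l : Fin n) :
    S.obstruction l = ∑ k, (C.reducedCurv B k l *ᵥ S.μ) k := by
  simp only [S.reducedCurv_mulVec_μ, Pi.add_apply, Pi.sub_apply, Pi.smul_apply, smul_eq_mul,
    Pi.single_eq_same, mulVec_single_one, col_apply, Finset.sum_add_distrib,
    Finset.sum_sub_distrib, ← Finset.mul_sum]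
  have e1 : ∑ k, S.A k * (Pi.single l 1 : Fin n → R) k = S.A l := by
    simp [Pi.single_apply]
  have e2 : ∑ k, S.dB k * S.X k l = (S.dB ᵥ* S.X) l := rfl
  have e3 : ∑ k, S.X k k = S.X.trace := rfl
  rw [e1, e2, e3, obstruction]
  simp
  ring

theorem X_skew : (C.G * S.X)ᵀ = C.G * S.X := by
  rw [X, transpose_mul, transpose_mul, S.symm, C.symm, mul_assoc]

variable {F : Type*} [Field F] [CharZero F]

theorem map_symProd (φ : R →+* F) (e : Fin n) (u : Fin n → R) :
    φ.mapMatrix (symProd e u) = symProd e (φ ∘ u) := by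
  ext a b
  simp [symProd, vecMulVec_apply, Pi.single_apply, apply_ite φ]

/-- Since the leading coefficient is invertible, the quadratic equation factors over an
algebraically closed field, and `mulVec_eq_zero_of_quadratic` applies. The homomorphism φ will be
evaluation at a point followed by the inclusion of ℝ in ℂ, since X may have complex eigenvalues. -/
theorem map_mulVec_μ_eq_zero_of_not_scalar [IsAlgClosed F] (φ : R →+* F) (hn : n ≠ 2)
    {k : Fin n} (hk : φ (S.dB k) ≠ 0) (hX : ∀ r : F, φ.mapMatrix S.X ≠ r • 1) (i l : Fin n) :
    φ.mapMatrix (C.reducedCurv B i l) *ᵥ (φ ∘ S.μ) = 0 := by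
  have hsmul : ∀ (r : R) (A : Matrix (Fin n) (Fin n) R),
      φ.mapMatrix (r • A) = φ r • φ.mapMatrix A := fun r A => by ext; simp
  have hq := congrArg φ.mapMatrix (S.X_quadratic k)
  simp only [map_add, map_sub, hsmul, map_mul, map_one, map_zero] at hq
  have hd : ∀ e, ∃ a b c : F, φ (S.dB k) • (φ.mapMatrix S.X * φ.mapMatrix (S.K e)
      + φ.mapMatrix (S.K e) * φ.mapMatrix S.X)
      = φ (S.A k + (S.dB ᵥ* S.X) k) • φ.mapMatrix (S.K e)
        + a • (φ.mapMatrix S.X * φ.mapMatrix S.X) + b • φ.mapMatrix S.X + c • 1 := by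
    intro e
    obtain ⟨a, b, c, h⟩ := S.exists_deriv_X_quadratic k e
    have h := congrArg φ.mapMatrix h
    simp only [hsmul, map_mul φ.mapMatrix, map_add φ.mapMatrix, map_one φ.mapMatrix] at h
    exact ⟨φ a, φ b, φ c, h⟩
  have hK : ∀ e, φ.mapMatrix (S.K e) = -(symProd e (φ ∘ S.μ) * φ.mapMatrix C.G) := fun e => by
    rw [K, map_neg, map_mul, map_symProd]
  have hGX := congrArg φ.mapMatrix S.X_skew
  have hGZ := congrArg φ.mapMatrix ((C.reducedCurv_isCurvatureLike B).skew i l)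
  have hZX := congrArg φ.mapMatrix (S.reducedCurv_mul_X i l)
  have hG := congrArg φ.mapMatrix C.symm
  have hinv := congrArg φ.mapMatrix C.inv_mul
  have htr : ∀ A : Matrix (Fin n) (Fin n) R, φ.mapMatrix Aᵀ = (φ.mapMatrix A)ᵀ := fun A => rfl
  simp only [htr, map_mul, map_neg, map_one] at hGX hGZ hZX hG hinv
  simp only [← map_add] at hq
  generalize φ (S.A k + (S.dB ᵥ* S.X) k) = t at hq hd
  generalize φ ((S.A ᵥ* S.X) k) = d at hq
  generalize φ (S.dB k) = p at hq hd hk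
  -- A square root of the discriminant of the monic equation.
  obtain ⟨w, hw⟩ := IsAlgClosed.exists_pow_nat_eq ((t / p) ^ 2 - 4 * (d / p)) (n := 2) (by norm_num)
  generalize φ.mapMatrix S.X = Y at *
  set s₁ := (t / p + w) / 2 with hs₁
  set s₂ := (t / p - w) / 2 with hs₂
  have hsum : s₁ + s₂ = t / p := by rw [hs₁, hs₂]; ring
  have hprod : s₁ * s₂ = d / p := by rw [hs₁, hs₂]; linear_combination (-1 / 4) * hw
  have hYY : Y * Y = (t / p) • Y - (d / p) • 1 := by
    have h1 : p⁻¹ • (p • (Y * Y) - t • Y + d • (1 : Matrix (Fin n) (Fin n) F)) = 0 := by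
      rw [← smul_zero p⁻¹, ← hq]
    simp only [smul_add, smul_sub, smul_smul, inv_mul_cancel₀ hk, one_smul] at h1
    rw [div_eq_inv_mul, div_eq_inv_mul]
    linear_combination (norm := module) h1
  choose a b c habc using hd
  refine mulVec_eq_zero_of_quadratic (s := s₁) (t := s₂) hn hG hinv hGX hGZ hZX ?_ hX
    (c := fun e => -(p⁻¹ * (a e * (t / p) + b e))) (d := fun e => -(p⁻¹ * (c e - a e * (d / p)))) ?_
  · simp only [mul_sub, sub_mul, Matrix.mul_smul, Matrix.smul_mul, mul_one, one_mul, hYY, smul_smul]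
    rw [mul_comm s₂ s₁, hprod, ← hsum]
    module
  · intro e
    have h1 := habc e
    rw [hK, hYY] at h1
    have h2 := congrArg (p⁻¹ • ·) h1
    simp only [smul_smul, inv_mul_cancel₀ hk, one_smul, mul_neg, neg_mul, smul_add, smul_sub] at h2
    rw [hsum, div_eq_inv_mul, div_eq_inv_mul]
    rw [div_eq_inv_mul, div_eq_inv_mul] at h2
    linear_combination (norm := module) -h2

/-- If the trace-free part of X vanishes to first order at the point, then the derivative K_e is
pure trace there. But K_e is built from e_e, μ and their duals, which leaves room only for μ = 0. -/
theorem map_μ_eq_zero_of_scalar (ev : R →+* F) (hn : 2 ≤ n) {r : F}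
    (hX : ev.mapMatrix S.X = r • 1)
    (hd : ∀ e, ev.mapMatrix (dMat (C.D e) ((n : R) • S.X - S.X.trace • 1)) = 0) :
    ev ∘ S.μ = 0 := by
  have hsmul : ∀ (r : R) (A : Matrix (Fin n) (Fin n) R),
      ev.mapMatrix (r • A) = ev r • ev.mapMatrix A := fun r A => by ext; simp
  have hdX : ∀ e, dMat (C.D e) S.X
      = S.X * C.Γ e - C.Γ e * S.X - S.γ e • S.X + S.K e := fun e => by
    rw [K, ← sub_eq_add_neg]
    exact C.dMat_mul_G S.deriv_σ e
  have htr : ev S.X.trace = n * r := by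
    have : ev S.X.trace = (ev.mapMatrix S.X).trace := by simp [Matrix.trace]
    rw [this, hX, trace_smul, trace_one, Fintype.card_fin, smul_eq_mul, mul_comm]
  have h1 : ∀ e, (n : F) • ev.mapMatrix (S.K e) = ev (S.K e).trace • 1 := by
    intro e
    have h := hd e
    have htr' : (S.X * C.Γ e - C.Γ e * S.X - S.γ e • S.X + S.K e).trace
        = -(S.γ e * S.X.trace) + (S.K e).trace := by
      rw [trace_add, trace_sub, trace_sub, trace_mul_comm, sub_self, zero_sub, trace_smul,
        smul_eq_mul]
    rw [dMat_sub, dMat_smul, dMat_smul, dMat_one, derivation_trace, hdX, htr'] at h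
    simp only [map_sub, map_add, map_mul, map_neg, hsmul, hX, htr, map_natCast,
      Derivation.map_natCast, zero_smul, zero_add, smul_zero, add_zero,
      map_one, Matrix.mul_smul, Matrix.smul_mul, mul_one, one_mul, sub_self] at h
    linear_combination (norm := module) h
  set m := ev ∘ (C.G *ᵥ S.μ) with hm
  have hK : ∀ e a b, ev (S.K e a b)
      = -((1 : Matrix (Fin n) (Fin n) F) a e * m b + ev (S.μ a) * ev (C.G e b)) := by
    intro e a b
    have h2 : (symProd e S.μ * C.G) a b
        = (1 : Matrix (Fin n) (Fin n) R) a e * (C.G *ᵥ S.μ) b + S.μ a * C.G e b := by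
      have h3 : S.μ ᵥ* C.G = C.G *ᵥ S.μ := by rw [← vecMul_transpose, C.symm]
      rw [symProd, add_mul, transpose_vecMulVec, vecMulVec_mul, vecMulVec_mul, h3,
        single_one_vecMul, Matrix.add_apply, vecMulVec_apply, vecMulVec_apply, Pi.single_apply,
        Matrix.one_apply]
      rfl
    rw [K, Matrix.neg_apply, h2, map_neg, map_add, map_mul, map_mul, hm]
    congr 3
    simp [Matrix.one_apply, apply_ite ev]
  have hμm : ∀ e, ∑ a, ev (S.μ a) * ev (C.G e a) = m e := by
    intro e
    rw [hm, Function.comp, mulVec, dotProduct, map_sum]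
    exact Finset.sum_congr rfl fun a _ => by rw [map_mul, mul_comm]
  have hGs : ∀ a b, C.G a b = C.G b a := fun a b => congrFun (congrFun C.symm b) a
  have htrK : ∀ e, ev (S.K e).trace = -2 * m e := by
    intro e
    rw [Matrix.trace, map_sum]
    simp only [diag_apply, hK, Finset.sum_neg_distrib, Finset.sum_add_distrib, hμm]
    have : ∑ a, (1 : Matrix (Fin n) (Fin n) F) a e * m a = m e := by simp [Matrix.one_apply]
    rw [this]
    ring
  have hm0 : ∀ b, m b = 0 := by
    intro b
    have h2 : ∑ e, (n : F) * ev (S.K e e b)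
        = ∑ e, -2 * m e * (1 : Matrix (Fin n) (Fin n) F) e b :=
      Finset.sum_congr rfl fun e _ => by
        have := congrFun (congrFun (h1 e) e) b
        rw [Matrix.smul_apply, Matrix.smul_apply, smul_eq_mul, smul_eq_mul, htrK] at this
        exact this
    have h3 : ∑ e, -2 * m e * (1 : Matrix (Fin n) (Fin n) F) e b = -2 * m b := by
      simp [Matrix.one_apply]
    have h4 : ∑ e, ev (S.μ e) * ev (C.G e b) = m b := by
      rw [← hμm b]
      exact Finset.sum_congr rfl fun e _ => by rw [hGs]
    rw [h3, ← Finset.mul_sum] at h2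
    simp only [hK, Matrix.one_apply_eq, one_mul, Finset.sum_neg_distrib, Finset.sum_add_distrib,
      h4, Finset.sum_const, Finset.card_univ, Fintype.card_fin, nsmul_eq_mul] at h2
    -- Contraction of `h1` gives n(n+1)m = 2m, and n² + n - 2 = (n-1)(n+2).
    have h5 : (((n : F) - 1) * ((n : F) + 2)) * m b = 0 := by linear_combination -h2
    have h6 : (n : F) - 1 ≠ 0 := by
      rw [sub_ne_zero]
      exact_mod_cast (by omega : n ≠ 1)
    have h7 : (n : F) + 2 ≠ 0 := by exact_mod_cast (by omega : n + 2 ≠ 0)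
    exact (mul_eq_zero.1 h5).resolve_left (mul_ne_zero h6 h7)
  have h2 : S.μ = C.Ginv *ᵥ (C.G *ᵥ S.μ) := by rw [mulVec_mulVec, C.inv_mul, one_mulVec]
  ext a
  rw [h2, Function.comp, mulVec, dotProduct, map_sum, Pi.zero_apply]
  exact Finset.sum_eq_zero fun b _ => by rw [map_mul, show ev ((C.G *ᵥ S.μ) b) = 0 from hm0 b,
    mul_zero]

theorem map_reducedCurv_mulVec_μ (ev : R →+* F) (k l : Fin n) :
    ev ((C.reducedCurv B k l *ᵥ S.μ) k)
      = (ev.mapMatrix (C.reducedCurv B k l) *ᵥ (ev ∘ S.μ)) k := by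
  simp [mulVec, dotProduct]

theorem map_obstruction_eq_zero_of_map_μ (ev : R →+* F) (h : ev ∘ S.μ = 0) (l : Fin n) :
    ev (S.obstruction l) = 0 := by
  rw [obstruction_eq_sum, map_sum]
  exact Finset.sum_eq_zero fun k _ => by rw [map_reducedCurv_mulVec_μ, h, mulVec_zero, Pi.zero_apply]

/-- Either ∇B = 0 at the point, and contraction of the Ricci identity for μ with v gives A = 0, or
∇B ≠ 0, and Zμ = 0. -/
theorem map_obstruction_eq_zero (ev : R →+* ℝ) (hn : 2 ≤ n) {v : Fin n → ℝ} (hv : v ≠ 0)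
    (hZv : ∀ k l, ev.mapMatrix (C.reducedCurv B k l) *ᵥ v = 0)
    (hX : ∀ r : ℝ, ev.mapMatrix S.X ≠ r • 1) (l : Fin n) : ev (S.obstruction l) = 0 := by
  have hZ : IsCurvatureLike (ev.mapMatrix C.G)
      (fun k l => ev.mapMatrix (C.reducedCurv B k l)) :=
    (C.reducedCurv_isCurvatureLike B).map ev
  have hinv : ev.mapMatrix C.Ginv * ev.mapMatrix C.G = 1 := by
    rw [← map_mul, C.inv_mul, map_one]
  obtain ⟨i, hi⟩ := Function.ne_iff.1 hv
  simp only [Pi.zero_apply] at hi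
  by_cases hdB : ∀ k, ev (S.dB k) = 0
  · have hsum := hZ.sum_smul_eq_zero hinv hZv
    have hZμ : ∀ k l, ev.mapMatrix (C.reducedCurv B k l) *ᵥ (ev ∘ S.μ)
        = ev (S.A l) • Pi.single k 1 - ev (S.A k) • Pi.single l 1 := by
      intro k l
      ext a
      have h := congrArg ev (congrFun (S.reducedCurv_mulVec_μ k l) a)
      simp only [Pi.add_apply, Pi.sub_apply, Pi.smul_apply, smul_eq_mul, map_add, map_sub,
        map_mul, hdB, zero_mul, add_zero, sub_zero, Pi.single_apply, apply_ite ev, map_one,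
        map_zero] at h
      simp only [Pi.sub_apply, Pi.smul_apply, smul_eq_mul, Pi.single_apply]
      rw [← h]
      simp [mulVec, dotProduct]
    have h1 : ∀ l a, v a * ev (S.A l)
        = (∑ k, v k * ev (S.A k)) * (1 : Matrix (Fin n) (Fin n) ℝ) a l := by
      intro l a
      have h2 : ∑ k, v k • (ev.mapMatrix (C.reducedCurv B k l) *ᵥ (ev ∘ S.μ)) = 0 := by
        simp only [← smul_mulVec]
        rw [← sum_mulVec, hsum, zero_mulVec]
      have h3 := congrFun h2 a
      simp only [hZμ, Finset.sum_apply, Pi.smul_apply, Pi.sub_apply, smul_eq_mul, mul_sub,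
        Finset.sum_sub_distrib, Pi.zero_apply] at h3
      have e1 : ∑ k, v k * (ev (S.A l) * (Pi.single k 1 : Fin n → ℝ) a) = v a * ev (S.A l) := by
        simp [Pi.single_apply]
      have e2 : ∑ k, v k * (ev (S.A k) * (Pi.single l 1 : Fin n → ℝ) a)
          = (∑ k, v k * ev (S.A k)) * (1 : Matrix (Fin n) (Fin n) ℝ) a l := by
        rw [Finset.sum_mul]
        exact Finset.sum_congr rfl fun k _ => by rw [Matrix.one_apply, Pi.single_apply]; ring
      rw [e1, e2] at h3
      linear_combination h3
    -- The trace of `h1` equates v·A with n times itself.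
    have h2 : ∑ k, v k * ev (S.A k) = 0 := by
      have h3 : ∑ a, v a * ev (S.A a)
          = ∑ a, (∑ k, v k * ev (S.A k)) * (1 : Matrix (Fin n) (Fin n) ℝ) a a :=
        Finset.sum_congr rfl fun a _ => h1 a a
      simp only [Matrix.one_apply_eq, mul_one, Finset.sum_const, Finset.card_univ,
        Fintype.card_fin, nsmul_eq_mul] at h3
      have h4 : ((n : ℝ) - 1) * ∑ k, v k * ev (S.A k) = 0 := by linear_combination -h3
      have h5 : (n : ℝ) - 1 ≠ 0 := by
        rw [sub_ne_zero]
        exact_mod_cast (by omega : n ≠ 1)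
      exact (mul_eq_zero.1 h4).resolve_left h5
    have hA : ev (S.A l) = 0 := by
      have := h1 l i
      rw [h2, zero_mul] at this
      exact (mul_eq_zero.1 this).resolve_left hi
    rw [obstruction, map_sub, map_add, map_mul, map_mul, hA, hdB, vecMul, dotProduct, map_sum]
    simp [hdB]
  · push Not at hdB
    obtain ⟨k, hk⟩ := hdB
    rw [obstruction_eq_sum, map_sum]
    refine Finset.sum_eq_zero fun j _ => ?_
    rw [map_reducedCurv_mulVec_μ]
    by_cases hn2 : n = 2
    · subst hn2
      -- In dimension two, a skew matrix with a nonzero kernel is zero, so GZ, and with it Z,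
      -- vanishes.
      have h0 : ∀ A : Matrix (Fin 2) (Fin 2) ℝ, Aᵀ = -A → A *ᵥ v = 0 → A = 0 := by
        intro A hA hAv
        have ha := congrFun (congrFun hA 0) 0
        have hb := congrFun (congrFun hA 1) 1
        have hc := congrFun (congrFun hA 0) 1
        have hd := congrFun hAv 0
        have he := congrFun hAv 1
        simp only [transpose_apply, Matrix.neg_apply, mulVec, dotProduct, Fin.sum_univ_two,
          Pi.zero_apply] at ha hb hc hd he
        have ha' : A 0 0 = 0 := by linarith
        have hb' : A 1 1 = 0 := by linarith
        rw [ha'] at hd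
        rw [hb', hc] at he
        have hf : A 0 1 = 0 := by
          by_contra hne
          have h1 : v 1 = 0 := by simpa [hne] using hd
          have h0 : v 0 = 0 := by simpa [hne] using he
          exact hv (by ext i; fin_cases i <;> simpa)
        ext a b
        fin_cases a <;> fin_cases b <;> simp [ha', hb', hc, hf]
      have h1 := h0 _ (hZ.skew j l) (by rw [← mulVec_mulVec, hZv, mulVec_zero])
      have h2 : ev.mapMatrix (C.reducedCurv B j l) = 0 := by
        rw [← one_mul (ev.mapMatrix (C.reducedCurv B j l)), ← hinv, mul_assoc, h1, mul_zero]
      rw [h2, zero_mulVec, Pi.zero_apply]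
    · have h1 := S.map_mulVec_μ_eq_zero_of_not_scalar (Complex.ofRealHom.comp ev) hn2 (k := k)
        (by simpa using hk) (fun r hr => ?_) j l
      · have h2 := congrFun h1 j
        simp only [mulVec, dotProduct, RingHom.mapMatrix_apply, Matrix.map_apply,
          RingHom.coe_comp, Function.comp, Complex.ofRealHom_eq_coe, Pi.zero_apply] at h2 ⊢
        exact_mod_cast h2
      · have h2 : ∀ a b, ((ev (S.X a b) : ℝ) : ℂ) = r * (1 : Matrix (Fin n) (Fin n) ℂ) a b :=
          fun a b => congrFun (congrFun hr a) b
        refine hX (ev (S.X i i)) ?_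
        have h3 := h2 i i
        rw [Matrix.one_apply_eq, mul_one] at h3
        ext a b
        have h4 := h2 a b
        rw [← h3, Matrix.one_apply] at h4
        rw [Matrix.smul_apply, Matrix.one_apply, smul_eq_mul, RingHom.mapMatrix_apply,
          Matrix.map_apply]
        split_ifs at h4 ⊢ <;> exact_mod_cast h4

end MetricConnection.ProlongedSolution

end

/-! ### Changes of coordinates -/

section

open Matrix

variable {n : ℕ} {R : Type*} [CommRing R] [Algebra ℝ R]

namespace MetricConnection

/-- The covariant derivative of a vector of the weight given by `γ`. -/
def covVec (C : MetricConnection n R) (γ : Fin n → R) (μ : Fin n → R) (a : Fin n) : Fin n → R :=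
  dVec (C.D a) μ + C.Γ a *ᵥ μ + γ a • μ

/-- The covariant derivative of a bivector of the weight given by `γ`. -/
def covMat (C : MetricConnection n R) (γ : Fin n → R) (σ : Matrix (Fin n) (Fin n) R) (a : Fin n) :
    Matrix (Fin n) (Fin n) R :=
  dMat (C.D a) σ + C.Γ a * σ + σ * (C.Γ a)ᵀ + γ a • σ

/-- Uniqueness of the torsion-free metric connection. -/
theorem Γ_unique (C : MetricConnection n R) {Γ' : Fin n → Matrix (Fin n) (Fin n) R}
    (ht : ∀ a b c, Γ' a c b = Γ' b c a)
    (hc : ∀ a, dMat (C.D a) C.G = (Γ' a)ᵀ * C.G + C.G * Γ' a) (a : Fin n) : Γ' a = C.Γ a := by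
  -- The lowered difference tensor is skew in i, b by compatibility and symmetric in a, b by
  -- vanishing torsion; such a tensor is zero.
  set T : Fin n → Fin n → Fin n → R := fun a i b => (C.G * (Γ' a - C.Γ a)) i b with hT
  have h1 : ∀ a i b, T a i b = -T a b i := by
    intro a i b
    have h : (Γ' a - C.Γ a)ᵀ * C.G + C.G * (Γ' a - C.Γ a) = 0 := by
      have := (hc a).symm.trans (C.compat a)
      rw [transpose_sub, sub_mul, mul_sub]
      linear_combination (norm := abel) this
    have h2 : (C.G * (Γ' a - C.Γ a))ᵀ = -(C.G * (Γ' a - C.Γ a)) := by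
      rw [transpose_mul, C.symm]
      exact eq_neg_of_add_eq_zero_left h
    exact congrFun (congrFun h2 b) i
  have h2 : ∀ a i b, T a i b = T b i a := by
    intro a i b
    simp only [hT, Matrix.mul_apply, Matrix.sub_apply]
    exact Finset.sum_congr rfl fun p _ => by rw [ht, C.torsion]
  have h3 : ∀ a i b, T a i b = 0 := by
    intro a i b
    apply two_mul_cancel_of_algebra
    linear_combination h2 a i b + h1 b i a - h2 b a i - h1 i a b + h2 i b a + h1 a b i
  have h4 : C.G * (Γ' a - C.Γ a) = 0 := by
    ext i b
    exact h3 a i b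
  have h5 : Γ' a - C.Γ a = 0 := by
    rw [← one_mul (Γ' a - C.Γ a), ← C.inv_mul, mul_assoc, h4, mul_zero]
  exact sub_eq_zero.1 h5

/-- A change of coordinates between two local descriptions of a metric connection. -/
structure CoordChange (C C' : MetricConnection n R) where
  J : Matrix (Fin n) (Fin n) R
  K : Matrix (Fin n) (Fin n) R
  inv : K * J = 1
  chain : ∀ a f, C.D a f = ∑ b, J b a * C'.D b f
  closed : ∀ a b c, C.D a (J b c) = C.D c (J b a)
  metric : C.G = Jᵀ * C'.G * J

namespace CoordChange

variable {C C' : MetricConnection n R} (T : CoordChange C C')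

/-- The components of the second connection in the direction of the coordinates of the first. -/
def pullΓ (a : Fin n) : Matrix (Fin n) (Fin n) R := ∑ b, T.J b a • C'.Γ b

theorem mul_inv : T.J * T.K = 1 := mul_eq_one_comm.1 T.inv

theorem dMat_chain (a : Fin n) (A : Matrix (Fin n) (Fin n) R) :
    dMat (C.D a) A = ∑ b, T.J b a • dMat (C'.D b) A := by
  ext i j
  simp only [dMat_apply, T.chain, Matrix.sum_apply, Matrix.smul_apply, smul_eq_mul]

theorem dVec_chain (a : Fin n) (u : Fin n → R) :
    dVec (C.D a) u = ∑ b, T.J b a • dVec (C'.D b) u := by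
  ext i
  simp only [dVec_apply, T.chain, Finset.sum_apply, Pi.smul_apply, smul_eq_mul]

/-- The transformation law of the Christoffel symbols. -/
theorem J_mul_Γ (a : Fin n) : T.J * C.Γ a = dMat (C.D a) T.J + T.pullΓ a * T.J := by
  -- The pulled-back connection is torsion-free and metric, so uniqueness identifies it without
  -- differentiating the Christoffel formula.
  have h := C.Γ_unique (Γ' := fun a => T.K * (dMat (C.D a) T.J + T.pullΓ a * T.J)) ?_ ?_ a
  · rw [← h, ← mul_assoc, T.mul_inv, one_mul]
  · intro a b c
    simp only [Matrix.mul_apply]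
    refine Finset.sum_congr rfl fun i _ => ?_
    congr 1
    simp only [Matrix.add_apply, dMat_apply, T.closed a i b, Matrix.mul_apply, pullΓ,
      Matrix.sum_apply, Matrix.smul_apply, smul_eq_mul, Finset.sum_mul]
    rw [Finset.sum_comm]
    congr 1
    refine Finset.sum_congr rfl fun p _ => Finset.sum_congr rfl fun q _ => ?_
    rw [C'.torsion]
    ring
  · intro a
    have hG' : dMat (C.D a) C'.G = (T.pullΓ a)ᵀ * C'.G + C'.G * T.pullΓ a := by
      rw [T.dMat_chain, pullΓ, transpose_sum, Finset.sum_mul, Finset.mul_sum,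
        ← Finset.sum_add_distrib]
      refine Finset.sum_congr rfl fun b _ => ?_
      rw [C'.compat, smul_add, transpose_smul, Matrix.smul_mul, Matrix.mul_smul]
    have h1 : T.Jᵀ * C'.G * T.J * (T.K * (dMat (C.D a) T.J + T.pullΓ a * T.J))
        = T.Jᵀ * C'.G * (dMat (C.D a) T.J + T.pullΓ a * T.J) := by
      rw [← mul_assoc, mul_assoc (T.Jᵀ * C'.G), T.mul_inv, mul_one]
    have h2 : (T.K * (dMat (C.D a) T.J + T.pullΓ a * T.J))ᵀ * (T.Jᵀ * C'.G * T.J)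
        = (dMat (C.D a) T.J + T.pullΓ a * T.J)ᵀ * C'.G * T.J := by
      rw [transpose_mul, mul_assoc, ← mul_assoc T.Kᵀ, ← mul_assoc T.Kᵀ, ← transpose_mul,
        T.mul_inv, transpose_one, one_mul, ← mul_assoc]
    rw [T.metric, h1, h2, dMat_mul, dMat_mul, dMat_transpose, hG', transpose_add, transpose_mul]
    noncomm_ring

theorem trace_Γ (a : Fin n) :
    (C.Γ a).trace = (T.K * dMat (C.D a) T.J).trace + ∑ b, T.J b a * (C'.Γ b).trace := by
  have h : C.Γ a = T.K * dMat (C.D a) T.J + T.K * (T.pullΓ a * T.J) := by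
    rw [← mul_add, ← T.J_mul_Γ, ← mul_assoc, T.inv, one_mul]
  rw [h, trace_add, trace_mul_comm T.K (T.pullΓ a * T.J), mul_assoc, T.mul_inv, mul_one, pullΓ,
    trace_sum]
  simp only [trace_smul, smul_eq_mul]

variable {φ : R} {γ γ' : Fin n → R}

/-- Both sides use the derivative index of the first chart, where the chain rule applies directly;
`covVec_eq` then inverts the Jacobian. The hypothesis `hφ` makes the derivative of the transition
function cancel the difference of the weights. -/
theorem sum_covVec (hφ : ∀ a, C.D a φ = φ * (γ a - ∑ b, T.J b a * γ' b)) {μ μ' : Fin n → R}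
    (hμ : μ' = φ • (T.J *ᵥ μ)) (a : Fin n) :
    ∑ b, T.J b a • C'.covVec γ' μ' b = φ • (T.J *ᵥ C.covVec γ μ a) := by
  have h1 : ∑ b, T.J b a • C'.covVec γ' μ' b
      = dVec (C.D a) μ' + T.pullΓ a *ᵥ μ' + (∑ b, T.J b a * γ' b) • μ' := by
    rw [T.dVec_chain, pullΓ, sum_mulVec, Finset.sum_smul, ← Finset.sum_add_distrib,
      ← Finset.sum_add_distrib]
    refine Finset.sum_congr rfl fun b _ => ?_
    rw [covVec, smul_mulVec]
    module
  have h2 := congrArg (φ • · *ᵥ μ) (T.J_mul_Γ a)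
  simp only [add_mulVec, ← mulVec_mulVec] at h2
  rw [h1, covVec, hμ, dVec_smul, dVec_mulVec, hφ]
  simp only [mulVec_add, mulVec_smul]
  linear_combination (norm := module) -h2

theorem sum_covMat (hφ : ∀ a, C.D a φ = φ * (γ a - ∑ b, T.J b a * γ' b))
    {σ σ' : Matrix (Fin n) (Fin n) R} (hσ : σ' = φ • (T.J * σ * T.Jᵀ)) (a : Fin n) :
    ∑ b, T.J b a • C'.covMat γ' σ' b = φ • (T.J * C.covMat γ σ a * T.Jᵀ) := by
  have h1 : ∑ b, T.J b a • C'.covMat γ' σ' b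
      = dMat (C.D a) σ' + T.pullΓ a * σ' + σ' * (T.pullΓ a)ᵀ + (∑ b, T.J b a * γ' b) • σ' := by
    rw [T.dMat_chain, pullΓ, Finset.sum_mul, Finset.sum_smul, transpose_sum, Finset.mul_sum,
      ← Finset.sum_add_distrib, ← Finset.sum_add_distrib, ← Finset.sum_add_distrib]
    refine Finset.sum_congr rfl fun b _ => ?_
    rw [covMat, transpose_smul, Matrix.smul_mul, Matrix.mul_smul]
    module
  have h2 := congrArg (fun A => φ • (A * (σ * T.Jᵀ))) (T.J_mul_Γ a)
  have h3 := congrArg (fun A => φ • ((T.J * σ) * Aᵀ)) (T.J_mul_Γ a)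
  simp only [transpose_mul, transpose_add, add_mul, mul_add, smul_add, mul_assoc] at h2 h3
  rw [h1, covMat, hσ, dMat_smul, dMat_mul, dMat_mul, dMat_transpose, hφ]
  simp only [mul_add, add_mul, Matrix.mul_smul, Matrix.smul_mul, smul_add, mul_assoc]
  linear_combination (norm := module) -h2 - h3

theorem covVec_eq (hφ : ∀ a, C.D a φ = φ * (γ a - ∑ b, T.J b a * γ' b)) {μ μ' : Fin n → R}
    (hμ : μ' = φ • (T.J *ᵥ μ)) (b : Fin n) :
    C'.covVec γ' μ' b = φ • ∑ a, T.K a b • (T.J *ᵥ C.covVec γ μ a) := by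
  have h : ∀ a, T.K a b • φ • (T.J *ᵥ C.covVec γ μ a)
      = ∑ c, (T.K a b * T.J c a) • C'.covVec γ' μ' c := fun a => by
    rw [← T.sum_covVec hφ hμ, Finset.smul_sum]
    simp only [smul_smul]
  simp only [Finset.smul_sum, smul_comm φ, h]
  rw [Finset.sum_comm]
  have h2 : ∀ c, ∑ a, T.K a b * T.J c a = (1 : Matrix (Fin n) (Fin n) R) c b := fun c => by
    rw [← T.mul_inv, Matrix.mul_apply]
    exact Finset.sum_congr rfl fun a _ => mul_comm _ _
  simp only [← Finset.sum_smul, h2, Matrix.one_apply, ite_smul, one_smul, zero_smul,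
    Finset.sum_ite_eq', Finset.mem_univ, if_true]

theorem covMat_eq (hφ : ∀ a, C.D a φ = φ * (γ a - ∑ b, T.J b a * γ' b))
    {σ σ' : Matrix (Fin n) (Fin n) R} (hσ : σ' = φ • (T.J * σ * T.Jᵀ)) (b : Fin n) :
    C'.covMat γ' σ' b = φ • ∑ a, T.K a b • (T.J * C.covMat γ σ a * T.Jᵀ) := by
  have h : ∀ a, T.K a b • φ • (T.J * C.covMat γ σ a * T.Jᵀ)
      = ∑ c, (T.K a b * T.J c a) • C'.covMat γ' σ' c := fun a => by
    rw [← T.sum_covMat hφ hσ, Finset.smul_sum]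
    simp only [smul_smul]
  simp only [Finset.smul_sum, smul_comm φ, h]
  rw [Finset.sum_comm]
  have h2 : ∀ c, ∑ a, T.K a b * T.J c a = (1 : Matrix (Fin n) (Fin n) R) c b := fun c => by
    rw [← T.mul_inv, Matrix.mul_apply]
    exact Finset.sum_congr rfl fun a _ => mul_comm _ _
  simp only [← Finset.sum_smul, h2, Matrix.one_apply, ite_smul, one_smul, zero_smul,
    Finset.sum_ite_eq', Finset.mem_univ, if_true]

theorem sum_K_mul_J (a d : Fin n) :
    ∑ b, T.K a b * T.J b d = (1 : Matrix (Fin n) (Fin n) R) a d := by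
  rw [← T.inv, Matrix.mul_apply]

/-- The divergence of a weighted vector is a weighted function. -/
theorem div_covVec (hφ : ∀ a, C.D a φ = φ * (γ a - ∑ b, T.J b a * γ' b)) {μ μ' : Fin n → R}
    (hμ : μ' = φ • (T.J *ᵥ μ)) :
    ∑ b, C'.covVec γ' μ' b b = φ * ∑ a, C.covVec γ μ a a := by
  simp only [T.covVec_eq hφ hμ, Pi.smul_apply, Finset.sum_apply, smul_eq_mul, mulVec, dotProduct]
  rw [← Finset.mul_sum, Finset.sum_comm]
  congr 1
  refine Finset.sum_congr rfl fun a _ => ?_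
  simp only [Finset.mul_sum]
  rw [Finset.sum_comm]
  simp only [← mul_assoc, ← Finset.sum_mul, T.sum_K_mul_J]
  simp [Matrix.one_apply]

/-- The divergence of a weighted bivector is a weighted vector. -/
theorem div_covMat (hφ : ∀ a, C.D a φ = φ * (γ a - ∑ b, T.J b a * γ' b))
    {σ σ' : Matrix (Fin n) (Fin n) R} (hσ : σ' = φ • (T.J * σ * T.Jᵀ)) (c : Fin n) :
    ∑ b, C'.covMat γ' σ' b b c = φ * ∑ d, T.J c d * ∑ a, C.covMat γ σ a a d := by
  have h1 : ∀ a, ∑ b, T.K a b * (T.J * C.covMat γ σ a * T.Jᵀ) b c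
      = ∑ d, T.J c d * C.covMat γ σ a a d := by
    intro a
    have : ∑ b, T.K a b * (T.J * C.covMat γ σ a * T.Jᵀ) b c
        = (T.K * (T.J * C.covMat γ σ a * T.Jᵀ)) a c := by rw [Matrix.mul_apply]
    rw [this, ← mul_assoc, ← mul_assoc, T.inv, one_mul, Matrix.mul_apply]
    exact Finset.sum_congr rfl fun d _ => by rw [transpose_apply, mul_comm]
  simp only [T.covMat_eq hφ hσ, Matrix.smul_apply, Matrix.sum_apply, smul_eq_mul]
  rw [← Finset.mul_sum, Finset.sum_comm]
  simp only [h1]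
  rw [Finset.sum_comm]
  simp only [Finset.mul_sum]

end CoordChange

end MetricConnection

end

/-! ### The Levi-Civita connection over the ring of smooth functions -/

section

open Matrix

variable {n : ℕ} {M : Type*} [TopologicalSpace M] [ChartedSpace (EuclideanSpace ℝ (Fin n)) M]

theorem smoothRing.contMDiffOn_of_eval {V : Set M} (r : smoothRing (n := n) V) {f : M → ℝ}
    (h : ∀ x : V, f x = smoothRing.eval x r) : ContMDiffOn (𝓡 n) 𝓘(ℝ, ℝ) ∞ f V :=
  (smoothRing.contMDiffOn_ext r).congr fun x hx =>
    (h ⟨x, hx⟩).trans (smoothRing.ext_apply r ⟨x, hx⟩).symm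

theorem smoothRing.eval_mulVec {V : Set M} (x : V) (A : Matrix (Fin n) (Fin n) (smoothRing (n := n) V))
    (u : Fin n → smoothRing (n := n) V) (i : Fin n) :
    smoothRing.eval x ((A *ᵥ u) i) = ∑ j, smoothRing.eval x (A i j) * smoothRing.eval x (u j) := by
  simp [mulVec, dotProduct]

theorem smoothRing.eval_mul_apply {V : Set M} (x : V)
    (A B : Matrix (Fin n) (Fin n) (smoothRing (n := n) V)) (i k : Fin n) :
    smoothRing.eval x ((A * B) i k)
      = ∑ j, smoothRing.eval x (A i j) * smoothRing.eval x (B j k) := by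
  simp [Matrix.mul_apply]

variable [IsManifold (𝓡 n) ∞ M]

theorem ContMDiffOn.abs_rpow {V : Set M} {e : Chart n M} (hV : V ⊆ e.1.source) {f : M → ℝ}
    (hf : ContMDiffOn (𝓡 n) 𝓘(ℝ, ℝ) ∞ f V) (h0 : ∀ x ∈ V, f x ≠ 0) (p : ℝ) :
    ContMDiffOn (𝓡 n) 𝓘(ℝ, ℝ) ∞ (fun x => |f x| ^ p) V := by
  rw [contMDiffOn_iff_contDiffOn_chart e hV] at hf ⊢
  have h1 : ∀ y ∈ e.1 '' V, f (e.1.symm y) ≠ 0 := by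
    rintro _ ⟨z, hz, rfl⟩
    rw [e.1.left_inv (hV hz)]
    exact h0 z hz
  exact (hf.abs h1).rpow_const_of_ne fun y hy => abs_ne_zero.2 (h1 y hy)

theorem pd_abs_rpow (e : Chart n M) (a : Fin n) {V : Set M} (hVo : IsOpen V)
    (hV : V ⊆ e.1.source) {f : M → ℝ} (hf : ContMDiffOn (𝓡 n) 𝓘(ℝ, ℝ) ∞ f V) {x : M}
    (hx : x ∈ V) (h0 : f x ≠ 0) (p : ℝ) :
    f x * pd e a (fun y => |f y| ^ p) x = p * |f x| ^ p * pd e a f x := by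
  have hd := differentiableAt_chart e hVo hV hf hx
  have h1 : f (e.1.symm (e.1 x)) = f x := by rw [e.1.left_inv (hV hx)]
  have h2 : HasDerivAt (fun t : ℝ => |t| ^ p) (SignType.sign (f x) * p * |f x| ^ (p - 1)) (f x) :=
    (hasDerivAt_abs h0).rpow_const (Or.inl (abs_ne_zero.2 h0))
  rw [← h1] at h2
  have h3 := (h2.comp_hasFDerivAt (e.1 x) hd.hasFDerivAt).fderiv
  have h4 : pd e a (fun y => |f y| ^ p) x
      = (SignType.sign (f x) * p * |f x| ^ (p - 1)) * pd e a f x := by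
    rw [h1] at h3
    exact congrArg (· (EuclideanSpace.single a 1)) h3
  rw [h4]
  have h5 : |f x| ^ p = f x * SignType.sign (f x) * |f x| ^ (p - 1) := by
    have h6 : f x * SignType.sign (f x) = |f x| := by
      rw [mul_comm]; exact sign_mul_self (f x)
    rw [h6, mul_comm, Real.rpow_sub_one (abs_ne_zero.2 h0)]
    field_simp
  rw [h5]
  ring

namespace PseudoRiemMetric

variable (g : PseudoRiemMetric n M) (e : Chart n M)

theorem contMDiffOn_comp (i j : Fin n) :
    ContMDiffOn (𝓡 n) 𝓘(ℝ, ℝ) ∞ (fun x => g.comp e x i j) e.1.source :=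
  (smoothIn_iff e _).1 (g.smooth e i j)

theorem contMDiffOn_inv (i j : Fin n) :
    ContMDiffOn (𝓡 n) 𝓘(ℝ, ℝ) ∞ (fun x => (g.comp e x)⁻¹ i j) e.1.source := by
  set A : Matrix (Fin n) (Fin n) (smoothRing (n := n) e.1.source) :=
    Matrix.of fun i j => smoothRing.mk _ (g.contMDiffOn_comp e i j)
  have hA : ∀ x : e.1.source, (smoothRing.eval x).toRingHom.mapMatrix A = g.comp e x := fun x => by
    ext i j; rfl
  have h1 : ContMDiffOn (𝓡 n) 𝓘(ℝ, ℝ) ∞ (fun x => (g.comp e x).det) e.1.source :=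
    smoothRing.contMDiffOn_of_eval A.det fun x => by
      rw [← hA, ← RingHom.map_det]; rfl
  have h2 : ContMDiffOn (𝓡 n) 𝓘(ℝ, ℝ) ∞ (fun x => (g.comp e x).adjugate i j) e.1.source :=
    smoothRing.contMDiffOn_of_eval (A.adjugate i j) fun x => by
      rw [← hA, ← RingHom.map_adjugate]; rfl
  have h3 := (h1.inv₀ fun x hx => g.nondegenerate e x hx).mul h2
  refine h3.congr fun x _ => ?_
  simp [Matrix.inv_def, Ring.inverse_eq_inv']

theorem contMDiffOn_christoffel (c a b : Fin n) :
    ContMDiffOn (𝓡 n) 𝓘(ℝ, ℝ) ∞ (fun x => christoffel g e x c a b) e.1.source := by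
  set P : Fin n → Fin n → Fin n → smoothRing (n := n) e.1.source := fun a i j =>
    smoothRing.deriv e e.1.open_source subset_rfl a (smoothRing.mk _ (g.contMDiffOn_comp e i j))
  refine smoothRing.contMDiffOn_of_eval (algebraMap ℝ _ (1 / 2) *
    ∑ d, smoothRing.mk _ (g.contMDiffOn_inv e c d) * (P a b d + P b a d - P d a b)) fun x => ?_
  simp only [P, map_mul, map_sum, map_add, map_sub, smoothRing.eval_deriv_mk, smoothRing.eval_mk,
    AlgHom.commutes]
  rfl

theorem christoffel_symm (x : M) (c a b : Fin n) :
    christoffel g e x c a b = christoffel g e x c b a := by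
  unfold christoffel
  congr 1
  refine Finset.sum_congr rfl fun d _ => ?_
  congr 1
  simp only [g.symm e _ a b]
  ring

theorem sum_comp_mul_christoffel {x : M} (hx : x ∈ e.1.source) (i a b : Fin n) :
    ∑ p, g.comp e x i p * christoffel g e x p a b
      = (1 / 2) * (pd e a (fun y => g.comp e y b i) x + pd e b (fun y => g.comp e y a i) x
        - pd e i (fun y => g.comp e y a b) x) := by
  set q : Fin n → ℝ := fun d => pd e a (fun y => g.comp e y b d) x
    + pd e b (fun y => g.comp e y a d) x - pd e d (fun y => g.comp e y a b) x with hq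
  have h1 : ∀ p, christoffel g e x p a b = (1 / 2) * ((g.comp e x)⁻¹ *ᵥ q) p := fun p => rfl
  have h2 : g.comp e x *ᵥ ((g.comp e x)⁻¹ *ᵥ q) = q := by
    rw [mulVec_mulVec, Matrix.mul_nonsing_inv _ (isUnit_iff_ne_zero.2 (g.nondegenerate e x hx)),
      one_mulVec]
  calc ∑ p, g.comp e x i p * christoffel g e x p a b
      = (1 / 2) * (g.comp e x *ᵥ ((g.comp e x)⁻¹ *ᵥ q)) i := by
        rw [mulVec, dotProduct, Finset.mul_sum]
        exact Finset.sum_congr rfl fun p _ => by rw [h1]; ring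
    _ = _ := by rw [h2]

variable {V : Set M} (hVo : IsOpen V) (hV : V ⊆ e.1.source)

/-- The Levi-Civita connection in a chart. -/
def connection : MetricConnection n (smoothRing (n := n) V) where
  D := smoothRing.deriv e hVo hV
  D_comm := smoothRing.deriv_comm e hVo hV
  G := Matrix.of fun i j => smoothRing.mk _ ((g.contMDiffOn_comp e i j).mono hV)
  Ginv := Matrix.of fun i j => smoothRing.mk _ ((g.contMDiffOn_inv e i j).mono hV)
  Γ k := Matrix.of fun i j => smoothRing.mk _ ((g.contMDiffOn_christoffel e i k j).mono hV)
  symm := by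
    ext1 i j
    exact smoothRing.ext_eval fun x => g.symm e x j i
  inv_mul := by
    ext1 i j
    refine smoothRing.ext_eval fun x => ?_
    rw [smoothRing.eval_mul_apply]
    have h := congrFun (congrFun (Matrix.nonsing_inv_mul _
      (isUnit_iff_ne_zero.2 (g.nondegenerate e x (hV x.2)))) i) j
    rw [Matrix.mul_apply] at h
    refine h.trans ?_
    simp [Matrix.one_apply, apply_ite (smoothRing.eval x)]
  torsion a b c := smoothRing.ext_eval fun x => g.christoffel_symm e x c a b
  compat a := by
    ext1 i j
    refine smoothRing.ext_eval fun x => ?_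
    rw [Matrix.add_apply, map_add, smoothRing.eval_mul_apply, smoothRing.eval_mul_apply]
    simp only [dMat_apply, transpose_apply, of_apply, smoothRing.eval_mk,
      smoothRing.eval_deriv_mk]
    have h1 := g.sum_comp_mul_christoffel e (hV x.2) i a j
    have h2 := g.sum_comp_mul_christoffel e (hV x.2) j a i
    have h3 : ∑ p, christoffel g e x p a i * g.comp e x p j
        = ∑ p, g.comp e x j p * christoffel g e x p a i :=
      Finset.sum_congr rfl fun p _ => by rw [g.symm e x p j, mul_comm]
    rw [h3, h1, h2]
    simp only [g.symm e _ j i, g.symm e _ a i, g.symm e _ a j]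
    ring

variable (x : V)

@[simp] theorem eval_trace_Γ (k : Fin n) :
    smoothRing.eval x ((g.connection e hVo hV).Γ k).trace = christoffelTrace g e x k := by
  rw [Matrix.trace, map_sum]
  rfl

theorem eval_curv (i j k l : Fin n) :
    smoothRing.eval x ((g.connection e hVo hV).curv k l i j) = riemann g e x i j k l := by
  rw [MetricConnection.curv, Matrix.sub_apply, Matrix.add_apply, Matrix.sub_apply, map_sub,
    map_add, map_sub, smoothRing.eval_mul_apply, smoothRing.eval_mul_apply, riemann,
    Finset.sum_sub_distrib, ← add_sub_assoc]
  congr 3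
  · exact smoothRing.eval_deriv_mk e hVo hV k (fun y => christoffel g e y i l j)
      ((g.contMDiffOn_christoffel e i l j).mono hV) x
  · exact smoothRing.eval_deriv_mk e hVo hV l (fun y => christoffel g e y i k j)
      ((g.contMDiffOn_christoffel e i k j).mono hV) x

/-- The connection form of the densities of weight `w`. -/
def weight (w : ℝ) (a : Fin n) : smoothRing (n := n) V :=
  algebraMap ℝ _ (w / (n + 1)) * ((g.connection e hVo hV).Γ a).trace

theorem weight_closed (w : ℝ) (k l : Fin n) :
    (g.connection e hVo hV).D k (g.weight e hVo hV w l)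
      = (g.connection e hVo hV).D l (g.weight e hVo hV w k) := by
  rw [weight, weight, Derivation.leibniz, Derivation.leibniz, Derivation.map_algebraMap,
    Derivation.map_algebraMap, (g.connection e hVo hV).trace_Γ_closed k l, smul_zero, smul_zero]

@[simp] theorem eval_weight (w : ℝ) (a : Fin n) :
    smoothRing.eval x (g.weight e hVo hV w a) = w / (n + 1) * christoffelTrace g e x a := by
  rw [weight, map_mul, eval_trace_Γ, AlgHom.commutes]
  rfl

end PseudoRiemMetric

end

/-! ### Weighted tensors and their divergences -/

section

open Matrix

variable {n : ℕ} {M : Type*} [TopologicalSpace M] [ChartedSpace (EuclideanSpace ℝ (Fin n)) M]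
  [IsManifold (𝓡 n) ∞ M]

theorem contMDiffOn_jac (e e' : Chart n M) {V : Set M} (hVo : IsOpen V) (hV : V ⊆ e.1.source)
    (hV' : V ⊆ e'.1.source) (i j : Fin n) :
    ContMDiffOn (𝓡 n) 𝓘(ℝ, ℝ) ∞ (fun x => jac e e' x i j) V :=
  contMDiffOn_pd e j hVo hV ((contMDiffOn_coordFn e' i).mono hV')

theorem det_jac_ne_zero (e e' : Chart n M) {x : M} (hx : x ∈ e.1.source) (hx' : x ∈ e'.1.source) :
    (jac e e' x).det ≠ 0 := fun h => by
  have := congrArg Matrix.det (jac_mul_jac e e' hx hx')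
  rw [det_mul, h, mul_zero, det_one] at this
  exact zero_ne_one this

section

variable (g : PseudoRiemMetric n M) (e e' : Chart n M) {V : Set M} (hVo : IsOpen V)
  (hV : V ⊆ e.1.source) (hV' : V ⊆ e'.1.source)

/-- The change of coordinates between two charts, on an open subset of both domains. -/
def PseudoRiemMetric.coordChange :
    MetricConnection.CoordChange (g.connection e hVo hV) (g.connection e' hVo hV') where
  J := Matrix.of fun i j => smoothRing.mk _ (contMDiffOn_jac e e' hVo hV hV' i j)
  K := Matrix.of fun i j => smoothRing.mk _ (contMDiffOn_jac e' e hVo hV' hV i j)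
  inv := by
    ext1 i j
    refine smoothRing.ext_eval fun x => ?_
    rw [smoothRing.eval_mul_apply]
    have h := congrFun (congrFun (jac_mul_jac e e' (hV x.2) (hV' x.2)) i) j
    rw [Matrix.mul_apply] at h
    refine h.trans ?_
    simp [Matrix.one_apply, apply_ite (smoothRing.eval x)]
  chain a f := smoothRing.ext_eval fun x => by
    rw [map_sum]
    simp only [map_mul]
    exact pd_eq_sum_jac e e' a hVo hV hV' (smoothRing.contMDiffOn_ext f) x.2
  closed a b c := by
    have h : ∀ c, smoothRing.mk _ (contMDiffOn_jac e e' hVo hV hV' b c)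
        = smoothRing.deriv e hVo hV c
          (smoothRing.mk (coordFn e' b) ((contMDiffOn_coordFn e' b).mono hV')) := fun c =>
      (smoothRing.deriv_mk e hVo hV c (coordFn e' b) ((contMDiffOn_coordFn e' b).mono hV')).symm
    simp only [of_apply, h]
    exact smoothRing.deriv_comm e hVo hV a c _
  metric := by
    ext1 i j
    refine smoothRing.ext_eval fun x => ?_
    rw [smoothRing.eval_mul_apply]
    simp only [smoothRing.eval_mul_apply]
    refine (g.transform e e' x (hV x.2) (hV' x.2) i j).trans ?_
    simp only [Finset.sum_mul]
    rw [Finset.sum_comm]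
    refine Finset.sum_congr rfl fun l _ => Finset.sum_congr rfl fun k _ => ?_
    change _ = jac e e' x k i * g.comp e' x k l * jac e e' x l j
    ring

/-- The transition function of the densities of weight `w`. -/
def densityFactor (w : ℝ) : smoothRing (n := n) V :=
  smoothRing.mk (fun x => |(jac e e' x).det| ^ (w / (n + 1)))
    (ContMDiffOn.abs_rpow hV
      (smoothRing.contMDiffOn_of_eval (g.coordChange e e' hVo hV hV').J.det fun x => by
        change _ = (smoothRing.eval x).toRingHom _
        rw [RingHom.map_det]
        rfl)
      (fun _ hx => det_jac_ne_zero e e' (hV hx) (hV' hx)) _)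

/-- Jacobi's formula gives the logarithmic derivative of det J as the trace of J⁻¹∂J, which is the
inhomogeneous term in the transformation of the trace of Γ. This is the hypothesis `hφ` of the
tensoriality lemmas. -/
theorem deriv_densityFactor (w : ℝ) (a : Fin n) :
    (g.connection e hVo hV).D a (densityFactor g e e' hVo hV hV' w)
      = densityFactor g e e' hVo hV hV' w * (g.weight e hVo hV w a
        - ∑ b, (g.coordChange e e' hVo hV hV').J b a * g.weight e' hVo hV' w b) := by
  set T := g.coordChange e e' hVo hV hV' with hT
  have hdet : ∀ x : V, (jac e e' x).det = smoothRing.eval x T.J.det := fun x => by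
    change _ = (smoothRing.eval x).toRingHom _
    rw [RingHom.map_det]
    rfl
  have hsm := smoothRing.contMDiffOn_of_eval (f := fun x => (jac e e' x).det) T.J.det hdet
  have hadj : T.J.adjugate = T.J.det • T.K := by
    rw [← mul_one T.J.adjugate, ← T.mul_inv, ← mul_assoc, adjugate_mul, Matrix.smul_mul, one_mul]
  have hw : g.weight e hVo hV w a - ∑ b, T.J b a * g.weight e' hVo hV' w b
      = algebraMap ℝ _ (w / (n + 1)) * (T.K * dMat ((g.connection e hVo hV).D a) T.J).trace := by
    simp only [PseudoRiemMetric.weight]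
    rw [T.trace_Γ, mul_add, Finset.mul_sum, add_sub_assoc, ← Finset.sum_sub_distrib,
      Finset.sum_eq_zero, add_zero]
    intro b _
    ring
  rw [hw]
  refine smoothRing.ext_eval fun x => ?_
  have h0 := det_jac_ne_zero e e' (hV x.2) (hV' x.2)
  have h1 := pd_abs_rpow e a hVo hV hsm x.2 h0 (w / (n + 1))
  have h2 : pd e a (fun y => (jac e e' y).det) x
      = (jac e e' x).det * smoothRing.eval x (T.K * dMat ((g.connection e hVo hV).D a) T.J).trace := by
    have h3 := congrArg (smoothRing.eval x) (derivation_det ((g.connection e hVo hV).D a) T.J)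
    rw [hadj, Matrix.smul_mul, trace_smul, smul_eq_mul, map_mul, ← hdet] at h3
    rw [← h3]
    exact pd_congr e a hVo hV
      (fun y hy => (hdet ⟨y, hy⟩).trans (smoothRing.ext_apply T.J.det ⟨y, hy⟩).symm) x.2
  rw [h2] at h1
  rw [map_mul, map_mul, AlgHom.commutes]
  have h4 : smoothRing.eval x ((g.connection e hVo hV).D a (densityFactor g e e' hVo hV hV' w))
      = pd e a (fun y => |(jac e e' y).det| ^ (w / (n + 1))) x :=
    smoothRing.eval_deriv_mk e hVo hV a _ _ x
  rw [h4]
  apply mul_left_cancel₀ h0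
  rw [h1]
  change _ = (jac e e' x).det * (|(jac e e' x).det| ^ (w / (n + 1)) * (w / (n + 1) * _))
  ring

variable {w : ℝ}

/-- The components of a vector as smooth functions. -/
def WVector.vec (μ : WVector n M w) (b : Fin n) : smoothRing (n := n) V :=
  smoothRing.mk (fun x => μ.comp e x b) (((smoothIn_iff e _).1 (μ.smooth e b)).mono hV)

/-- The component of a density as a smooth function. -/
def WDensity.fn (ρ : WDensity n M w) : smoothRing (n := n) V :=
  smoothRing.mk (ρ.comp e) (((smoothIn_iff e _).1 (ρ.smooth e)).mono hV)

/-- The components of a bivector as smooth functions. -/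
def WSymBivector.mat (σ : WSymBivector n M w) : Matrix (Fin n) (Fin n) (smoothRing (n := n) V) :=
  Matrix.of fun b c =>
    smoothRing.mk (fun x => σ.comp e x b c) (((smoothIn_iff e _).1 (σ.smooth e b c)).mono hV)

@[simp] theorem WVector.eval_vec (μ : WVector n M w) (b : Fin n) (x : V) :
    smoothRing.eval x (μ.vec e hV b) = μ.comp e x b := rfl

@[simp] theorem WDensity.eval_fn (ρ : WDensity n M w) (x : V) :
    smoothRing.eval x (ρ.fn e hV) = ρ.comp e x := rfl

theorem WVector.vec_transform (μ : WVector n M w) : μ.vec e' hV'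
    = densityFactor g e e' hVo hV hV' w • ((g.coordChange e e' hVo hV hV').J *ᵥ μ.vec e hV) := by
  ext1 b
  refine smoothRing.ext_eval fun x => ?_
  rw [Pi.smul_apply, smul_eq_mul, map_mul, smoothRing.eval_mulVec]
  exact μ.transform e e' x (hV x.2) (hV' x.2) b

theorem WSymBivector.mat_transform (σ : WSymBivector n M w) : σ.mat e' hV'
    = densityFactor g e e' hVo hV hV' w • ((g.coordChange e e' hVo hV hV').J * σ.mat e hV
      * (g.coordChange e e' hVo hV hV').Jᵀ) := by
  ext1 b c
  refine smoothRing.ext_eval fun x => ?_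
  rw [Matrix.smul_apply, smul_eq_mul, map_mul, smoothRing.eval_mul_apply]
  simp only [smoothRing.eval_mul_apply]
  refine (σ.transform e e' x (hV x.2) (hV' x.2) b c).trans ?_
  change |(jac e e' x).det| ^ (w / (n + 1)) * _ = |(jac e e' x).det| ^ (w / (n + 1)) * _
  congr 1
  simp only [Finset.sum_mul]
  rw [Finset.sum_comm]
  refine Finset.sum_congr rfl fun l _ => Finset.sum_congr rfl fun k _ => ?_
  change _ = jac e e' x b k * σ.comp e x k l * jac e e' x c l
  ring

theorem eval_covVec (μ : WVector n M w) (x : V) (a b : Fin n) :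
    smoothRing.eval x ((g.connection e hVo hV).covVec (g.weight e hVo hV w) (μ.vec e hV) a b)
      = covVector g μ e x a b := by
  rw [MetricConnection.covVec, Pi.add_apply, Pi.add_apply, Pi.smul_apply, map_add, map_add,
    smoothRing.eval_mulVec, smul_eq_mul, map_mul, PseudoRiemMetric.eval_weight, covVector]
  congr 2
  exact smoothRing.eval_deriv_mk e hVo hV a (fun y => μ.comp e y b) _ x

theorem eval_covMat (σ : WSymBivector n M w) (x : V) (a b c : Fin n) :
    smoothRing.eval x ((g.connection e hVo hV).covMat (g.weight e hVo hV w) (σ.mat e hV) a b c)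
      = covSymBivector g σ e x a b c := by
  rw [MetricConnection.covMat, Matrix.add_apply, Matrix.add_apply, Matrix.add_apply,
    Matrix.smul_apply, map_add, map_add, map_add, smoothRing.eval_mul_apply,
    smoothRing.eval_mul_apply, smul_eq_mul, map_mul, PseudoRiemMetric.eval_weight, covSymBivector]
  congr 2
  · congr 1
    exact smoothRing.eval_deriv_mk e hVo hV a (fun y => σ.comp e y b c)
      (((smoothIn_iff e _).1 (σ.smooth e b c)).mono hV) x
  · exact Finset.sum_congr rfl fun d _ => mul_comm _ _

theorem eval_covDensity (ρ : WDensity n M w) (x : V) (a : Fin n) :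
    smoothRing.eval x ((g.connection e hVo hV).D a (ρ.fn e hV)
      + g.weight e hVo hV w a * ρ.fn e hV) = covDensity g ρ e x a := by
  rw [map_add, map_mul, PseudoRiemMetric.eval_weight, covDensity]
  congr 1
  exact smoothRing.eval_deriv_mk e hVo hV a (ρ.comp e) _ x

end

variable {w : ℝ}

/-- The vector `μ^b = -∇_a σ^{ab} / (n + 1)`. -/
def divBivector (g : PseudoRiemMetric n M) (σ : WSymBivector n M w) : WVector n M w where
  comp e := e.1.source.indicator fun x b => -(1 / ((n : ℝ) + 1)) * ∑ a, covSymBivector g σ e x a a b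
  comp_of_notMem e x hx := Set.indicator_of_notMem hx _
  smooth e b := by
    rw [smoothIn_iff]
    refine smoothRing.contMDiffOn_of_eval (algebraMap ℝ _ (-(1 / ((n : ℝ) + 1))) *
      ∑ a, (g.connection e e.1.open_source subset_rfl).covMat
        (g.weight e e.1.open_source subset_rfl w) (σ.mat e subset_rfl) a a b) fun x => ?_
    rw [Set.indicator_of_mem x.2, map_mul, map_sum, AlgHom.commutes]
    simp only [eval_covMat]
    rfl
  transform e e' x hx hx' b := by
    have h := congrArg (smoothRing.eval (⟨x, hx, hx'⟩ : ↥(e.1.source ∩ e'.1.source)))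
      ((g.coordChange e e' (e.1.open_source.inter e'.1.open_source) Set.inter_subset_left
        Set.inter_subset_right).div_covMat (deriv_densityFactor g e e' _ _ _ w)
        (σ.mat_transform g e e' _ _ _) b)
    rw [map_sum, map_mul, map_sum] at h
    simp only [map_mul, map_sum, eval_covMat] at h
    rw [Set.indicator_of_mem hx, Set.indicator_of_mem hx', h]
    change _ * (|(jac e e' x).det| ^ (w / (n + 1)) * ∑ d, jac e e' x b d * _) = _
    rw [mul_left_comm]
    congr 1
    rw [Finset.mul_sum]
    exact Finset.sum_congr rfl fun d _ => by ring

theorem divBivector_comp (g : PseudoRiemMetric n M) (σ : WSymBivector n M w) (e : Chart n M)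
    {x : M} (hx : x ∈ e.1.source) (b : Fin n) : (divBivector g σ).comp e x b
      = -(1 / ((n : ℝ) + 1)) * ∑ a, covSymBivector g σ e x a a b := by
  have h : e.1.source.indicator (fun x b => -(1 / ((n : ℝ) + 1)) *
      ∑ a, covSymBivector g σ e x a a b) x = _ := Set.indicator_of_mem hx _
  exact congrFun h b

/-- The density `ρ = -(∇_b μ^b - B g_{bc} σ^{bc}) / n`. -/
def divVector (g : PseudoRiemMetric n M) (B : M → ℝ) (hB : ContMDiff (𝓡 n) 𝓘(ℝ, ℝ) ∞ B)
    (σ : WSymBivector n M w) (μ : WVector n M w) : WDensity n M w where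
  comp e := e.1.source.indicator fun x => -(1 / (n : ℝ)) *
    (∑ b, covVector g μ e x b b - B x * ∑ b, ∑ c, σ.comp e x b c * g.comp e x c b)
  comp_of_notMem e x hx := Set.indicator_of_notMem hx _
  smooth e := by
    rw [smoothIn_iff]
    refine smoothRing.contMDiffOn_of_eval (algebraMap ℝ _ (-(1 / (n : ℝ))) *
      (∑ b, (g.connection e e.1.open_source subset_rfl).covVec
        (g.weight e e.1.open_source subset_rfl w) (μ.vec e subset_rfl) b b
        - smoothRing.mk B hB.contMDiffOn * (σ.mat e subset_rfl
          * (g.connection e e.1.open_source subset_rfl).G).trace)) fun x => ?_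
    rw [Set.indicator_of_mem x.2, map_mul, map_sub, map_mul, map_sum, AlgHom.commutes,
      Matrix.trace, map_sum]
    simp only [eval_covVec, diag_apply, smoothRing.eval_mul_apply]
    rfl
  transform e e' x hx hx' := by
    have hVo := e.1.open_source.inter e'.1.open_source
    have h := congrArg (smoothRing.eval (⟨x, hx, hx'⟩ : ↥(e.1.source ∩ e'.1.source)))
      ((g.coordChange e e' hVo Set.inter_subset_left
        Set.inter_subset_right).div_covVec (deriv_densityFactor g e e' _ _ _ w)
        (μ.vec_transform g e e' _ _ _))
    have h2 : (σ.mat e' Set.inter_subset_right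
          * (g.connection e' hVo Set.inter_subset_right).G).trace
        = densityFactor g e e' hVo Set.inter_subset_left Set.inter_subset_right w
          * (σ.mat e Set.inter_subset_left
            * (g.connection e hVo Set.inter_subset_left).G).trace := by
      -- The trace of σg is a density: the Jacobians from σ and from g cancel by cyclicity.
      rw [σ.mat_transform g e e' hVo Set.inter_subset_left Set.inter_subset_right,
        (g.coordChange e e' hVo Set.inter_subset_left Set.inter_subset_right).metric,
        Matrix.smul_mul, trace_smul, smul_eq_mul, mul_assoc, mul_assoc, trace_mul_comm]
      simp only [mul_assoc]
    have h3 := congrArg (smoothRing.eval (⟨x, hx, hx'⟩ : ↥(e.1.source ∩ e'.1.source))) h2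
    rw [map_mul, Matrix.trace, map_sum, Matrix.trace, map_sum] at h3
    simp only [diag_apply, smoothRing.eval_mul_apply] at h3
    change ∑ b, ∑ c, σ.comp e' x b c * g.comp e' x c b = |(jac e e' x).det| ^ (w / (n + 1))
      * ∑ b, ∑ c, σ.comp e x b c * g.comp e x c b at h3
    rw [map_sum, map_mul, map_sum] at h
    simp only [eval_covVec] at h
    change ∑ b, covVector g μ e' x b b = |(jac e e' x).det| ^ (w / (n + 1))
      * ∑ b, covVector g μ e x b b at h
    rw [Set.indicator_of_mem hx, Set.indicator_of_mem hx', h, h3]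
    ring

theorem divVector_comp (g : PseudoRiemMetric n M) (B : M → ℝ)
    (hB : ContMDiff (𝓡 n) 𝓘(ℝ, ℝ) ∞ B) (σ : WSymBivector n M w) (μ : WVector n M w)
    (e : Chart n M) {x : M} (hx : x ∈ e.1.source) : (divVector g B hB σ μ).comp e x
      = -(1 / (n : ℝ)) *
        (∑ b, covVector g μ e x b b - B x * ∑ b, ∑ c, σ.comp e x b c * g.comp e x c b) := by
  change e.1.source.indicator (fun x => _) x = _
  rw [Set.indicator_of_mem hx]

end

/-! ### From points with nullity to the whole manifold -/

section

open Matrix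

variable {n : ℕ} {M : Type*} [TopologicalSpace M] [ChartedSpace (EuclideanSpace ℝ (Fin n)) M]
  [IsManifold (𝓡 n) ∞ M]

theorem smoothRing.eq_of_dense {V U : Set M} (hVo : IsOpen V) (hU : Dense U)
    {f f' : smoothRing (n := n) V}
    (h : ∀ x : V, x.1 ∈ U → smoothRing.eval x f = smoothRing.eval x f') : f = f' := by
  have h1 : Set.EqOn (smoothRing.ext f) (smoothRing.ext f') (V ∩ U) := fun x hx => by
    rw [smoothRing.ext_apply f ⟨x, hx.1⟩, smoothRing.ext_apply f' ⟨x, hx.1⟩, h ⟨x, hx.1⟩ hx.2]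
  have h2 := h1.of_subset_closure (smoothRing.contMDiffOn_ext f).continuousOn
    (smoothRing.contMDiffOn_ext f').continuousOn Set.inter_subset_left
    (hU.open_subset_closure_inter hVo)
  refine smoothRing.ext_eval fun x => ?_
  rw [← smoothRing.ext_apply, ← smoothRing.ext_apply, h2 x.2]

theorem kron_eq_single (a b : Fin n) : kron a b = (Pi.single b 1 : Fin n → ℝ) a := by
  rw [kron, Pi.single_apply]

theorem sum_kron_mul (b : Fin n) (f : Fin n → ℝ) : ∑ a, kron b a * f a = f b := by
  simp [kron]

theorem sum_kron_self : ∑ a : Fin n, kron a a = n := by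
  simp [kron]

theorem covSymBivector_symm {w : ℝ} (g : PseudoRiemMetric n M) (σ : WSymBivector n M w)
    (e : Chart n M) (x : M) (a b c : Fin n) :
    covSymBivector g σ e x a b c = covSymBivector g σ e x a c b := by
  have h : ∀ i c, ∑ d, christoffel g e x i a d * σ.comp e x d c
      = ∑ d, christoffel g e x i a d * σ.comp e x c d := fun i c =>
    Finset.sum_congr rfl fun d _ => by rw [σ.symm e x d c]
  simp only [covSymBivector, σ.symm e _ b c, h b c, h c b]
  ring

theorem eq_div_of_covSymBivector_add {w : ℝ} (g : PseudoRiemMetric n M) (σ : WSymBivector n M w)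
    (e : Chart n M) (x : M) {μ : Fin n → ℝ}
    (h : ∀ a b c, covSymBivector g σ e x a b c + kron b a * μ c + kron c a * μ b = 0) (c : Fin n) :
    μ c = -(1 / ((n : ℝ) + 1)) * ∑ a, covSymBivector g σ e x a a c := by
  have h1 : ∑ a, (covSymBivector g σ e x a a c + kron a a * μ c + kron c a * μ a) = 0 :=
    Finset.sum_eq_zero fun a _ => h a a c
  rw [Finset.sum_add_distrib, Finset.sum_add_distrib, ← Finset.sum_mul, sum_kron_mul,
    sum_kron_self] at h1
  have h2 : (n : ℝ) + 1 ≠ 0 := by positivity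
  field_simp
  linear_combination h1

theorem trace_free_iff_covSymBivector_add {w : ℝ} (g : PseudoRiemMetric n M)
    (σ : WSymBivector n M w) (e : Chart n M) (x : M) {μ : Fin n → ℝ}
    (hμ : ∀ c, μ c = -(1 / ((n : ℝ) + 1)) * ∑ a, covSymBivector g σ e x a a c) (a b c : Fin n) :
    covSymBivector g σ e x a b c
      - 1 / ((n : ℝ) + 1) * (kron b a * ∑ d, covSymBivector g σ e x d d c
        + kron c a * ∑ d, covSymBivector g σ e x d b d) = 0
    ↔ covSymBivector g σ e x a b c + kron b a * μ c + kron c a * μ b = 0 := by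
  have h : ∑ d, covSymBivector g σ e x d b d = ∑ d, covSymBivector g σ e x d d b :=
    Finset.sum_congr rfl fun d _ => covSymBivector_symm g σ e x d b d
  rw [hμ, hμ, h]
  refine Eq.congr ?_ rfl
  ring

theorem eq_div_of_covVector_add {w : ℝ} (hn : n ≠ 0) (g : PseudoRiemMetric n M)
    (μ : WVector n M w) (e : Chart n M) (x : M) {ρ : ℝ} {X : Fin n → Fin n → ℝ}
    (h : ∀ a b, covVector g μ e x a b + kron b a * ρ - X a b = 0) :
    ρ = -(1 / (n : ℝ)) * (∑ a, covVector g μ e x a a - ∑ a, X a a) := by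
  have h1 : ∑ a, (covVector g μ e x a a + kron a a * ρ - X a a) = 0 :=
    Finset.sum_eq_zero fun a _ => h a a
  rw [Finset.sum_sub_distrib, Finset.sum_add_distrib, ← Finset.sum_mul, sum_kron_self] at h1
  have h2 : (n : ℝ) ≠ 0 := Nat.cast_ne_zero.2 hn
  field_simp
  linear_combination h1

theorem schouten_symm (g : PseudoRiemMetric n M) (e : Chart n M) {x : M} (hx : x ∈ e.1.source)
    (j k : Fin n) : schouten g e x j k = schouten g e x k j := by
  set C := g.connection e e.1.open_source subset_rfl
  have h := congrArg (smoothRing.eval (n := n) (⟨x, hx⟩ : e.1.source))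
    (C.curv_isCurvatureLike.ricci_symm C.inv_mul C.Ginv_symm j k)
  rw [map_sum, map_sum] at h
  simp only [C, PseudoRiemMetric.eval_curv] at h
  rw [schouten, schouten, ricci, ricci, h]

section

variable {g : PseudoRiemMetric n M} {B : M → ℝ} (hB : ContMDiff (𝓡 n) 𝓘(ℝ, ℝ) ∞ B)
  (e : Chart n M)

/-- A Weyl null vector is automatically an eigenvector of the Schouten tensor, so B is its
eigenvalue, and the constant curvature part cancels the curvature on it. The vector need not depend
smoothly on the point. -/
theorem exists_reducedCurv_nullity (hgB : IsNullityFunction g B) (x : e.1.source)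
    (hx : HasWeylNullityAt g x) : ∃ v : Fin n → ℝ, v ≠ 0 ∧ ∀ k l,
      (smoothRing.eval (n := n) x).toRingHom.mapMatrix
        ((g.connection e e.1.open_source subset_rfl).reducedCurv
          (smoothRing.mk (n := n) (V := e.1.source) B hB.contMDiffOn) k l) *ᵥ v = 0 := by
  obtain ⟨v, hv, hW⟩ := hx e x.2
  set C := g.connection e e.1.open_source subset_rfl with hC
  set ev := (smoothRing.eval (n := n) x).toRingHom with hev
  have hR : ∀ i j k l, (ev.mapMatrix (C.curv k l)) i j = riemann g e x i j k l := fun i j k l =>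
    PseudoRiemMetric.eval_curv g e _ _ x i j k l
  have hG : ev.mapMatrix C.G = g.comp e x := rfl
  set p : Fin n → ℝ := fun l => ∑ j, schouten g e x j l * v j with hp
  have hRv : ∀ k l, ev.mapMatrix (C.curv k l) *ᵥ v = p l • Pi.single k 1 - p k • Pi.single l 1 := by
    intro k l
    ext i
    have h1 := hW i k l
    simp only [weyl, add_mul, sub_mul, Finset.sum_add_distrib, Finset.sum_sub_distrib,
      mul_assoc, ← Finset.mul_sum] at h1
    simp only [mulVec, dotProduct, hR, Pi.sub_apply, Pi.smul_apply, smul_eq_mul, ← kron_eq_single]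
    linear_combination h1
  have hinv : ev.mapMatrix C.Ginv * ev.mapMatrix C.G = 1 := by
    rw [← map_mul, C.inv_mul, map_one]
  obtain ⟨b, hb⟩ := exists_eigenvalue_of_nullity (G := ev.mapMatrix C.G)
    (congrArg ev.mapMatrix C.symm) hinv (C.curv_isCurvatureLike.map ev).skew hv hRv
  have hBb : B x = b := by
    refine hgB e x x.2 v b hv hW fun i => ?_
    have h1 : ∑ j, schoutenUp g e x i j * v j = (ev.mapMatrix C.Ginv *ᵥ p) i := by
      simp only [schoutenUp, Finset.sum_mul, mulVec, dotProduct, hp, Finset.mul_sum]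
      rw [Finset.sum_comm]
      refine Finset.sum_congr rfl fun k _ => Finset.sum_congr rfl fun j _ => ?_
      rw [schouten_symm g e x.2 j k, mul_assoc]
      rfl
    rw [h1, hb, mulVec_smul, mulVec_mulVec, hinv, one_mulVec, Pi.smul_apply, smul_eq_mul]
  refine ⟨v, hv, fun k l => ?_⟩
  have h1 : ev.mapMatrix (C.reducedCurv (smoothRing.mk (n := n) (V := e.1.source) B hB.contMDiffOn) k l)
      = ev.mapMatrix (C.curv k l) - b • (vecMulVec (Pi.single k 1) (g.comp e x l)
        - vecMulVec (Pi.single l 1) (g.comp e x k)) := by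
    rw [MetricConnection.reducedCurv, map_sub, ← hBb]
    congr 1
    ext i j
    simp only [MetricConnection.unitCurv, RingHom.mapMatrix_apply, Matrix.map_apply,
      Matrix.smul_apply, Matrix.sub_apply, vecMulVec_apply, smul_eq_mul, map_mul, map_sub,
      Pi.single_apply, apply_ite ev, map_one, map_zero]
    rfl
  have h2 : ∀ k l : Fin n, vecMulVec (Pi.single k 1 : Fin n → ℝ) (g.comp e x l) *ᵥ v
      = (g.comp e x *ᵥ v) l • (Pi.single k 1 : Fin n → ℝ) := by
    intro k l
    rw [vecMulVec_mulVec]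
    ext i
    simp [mulVec, mul_comm]
  rw [h1, sub_mulVec, hRv, smul_mulVec, sub_mulVec, h2, h2, hb, hG]
  simp only [Pi.smul_apply, smul_eq_mul, smul_sub, smul_smul, sub_self]

variable {σ : WSymBivector n M (-2)}

theorem SolvesMetrisability.covMat_eq (hσ : SolvesMetrisability g σ) (l : Fin n) :
    (g.connection e e.1.open_source subset_rfl).covMat
      (g.weight e e.1.open_source subset_rfl (-2)) (σ.mat e subset_rfl) l
      = -symProd l ((divBivector g σ).vec e subset_rfl) := by
  ext1 b c
  refine smoothRing.ext_eval fun x => ?_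
  have h := (trace_free_iff_covSymBivector_add g σ e x
    (divBivector_comp g σ e x.2) l b c).1 (hσ e x x.2 l b c)
  rw [eval_covMat, eq_neg_of_add_eq_zero_left ((add_assoc _ _ _).symm.trans h), Matrix.neg_apply,
    map_neg, symProd, Matrix.add_apply, map_add, transpose_apply, vecMulVec_apply,
    vecMulVec_apply, map_mul, map_mul, WVector.eval_vec, WVector.eval_vec, kron, kron,
    Pi.single_apply, Pi.single_apply, apply_ite (smoothRing.eval x),
    apply_ite (smoothRing.eval x), map_one, map_zero]

theorem SolvesMetrisability.dMat_eq (hσ : SolvesMetrisability g σ) (l : Fin n) :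
    dMat ((g.connection e e.1.open_source subset_rfl).D l) (σ.mat e subset_rfl)
      = -((g.connection e e.1.open_source subset_rfl).Γ l * σ.mat e subset_rfl)
        - σ.mat e subset_rfl * ((g.connection e e.1.open_source subset_rfl).Γ l)ᵀ
        - g.weight e e.1.open_source subset_rfl (-2) l • σ.mat e subset_rfl
        - symProd l ((divBivector g σ).vec e subset_rfl) := by
  rw [sub_eq_add_neg _ (symProd l _), ← hσ.covMat_eq, MetricConnection.covMat]
  abel

theorem WSymBivector.mat_symm : (σ.mat e (subset_refl e.1.source))ᵀ = σ.mat e subset_rfl := by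
  ext1 b c
  exact smoothRing.ext_eval fun x => σ.symm e x c b

/-- The trace part of N_l is -ρ by the choice of ρ, and nullity excludes any other part on a dense
set. Both sides are continuous. -/
theorem SolvesMetrisability.covVec_sub_eq (hn : n ≠ 0) (hσ : SolvesMetrisability g σ)
    (hg : HasWeylNullityAE g) (hgB : IsNullityFunction g B) (l : Fin n) :
    (g.connection e e.1.open_source subset_rfl).covVec
        (g.weight e e.1.open_source subset_rfl (-2)) ((divBivector g σ).vec e subset_rfl) l
      - smoothRing.mk (n := n) (V := e.1.source) B hB.contMDiffOn • (σ.mat e subset_rfl *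
        (g.connection e e.1.open_source subset_rfl).G) *ᵥ Pi.single l 1
      = -(divVector g B hB σ (divBivector g σ)).fn e subset_rfl • Pi.single l 1 := by
  obtain ⟨U, -, hU, hnull⟩ := hg
  set C := g.connection e e.1.open_source subset_rfl with hC
  set Br : smoothRing (n := n) e.1.source := smoothRing.mk (n := n) (V := e.1.source) B hB.contMDiffOn with hBr
  set N : Fin n → Fin n → smoothRing (n := n) e.1.source := fun l =>
    C.covVec (g.weight e e.1.open_source subset_rfl (-2)) ((divBivector g σ).vec e subset_rfl) l
      - Br • (σ.mat e subset_rfl * C.G) *ᵥ Pi.single l 1 with hN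
  change N l = _
  have hcurv := C.reducedCurv_mul_add (σ.mat_symm e)
    (g.weight_closed e e.1.open_source subset_rfl (-2)) (hσ.dMat_eq e) (N := N) (B := Br) (fun l => rfl)
  ext1 c
  refine smoothRing.eq_of_dense e.1.open_source hU fun x hx => ?_
  obtain ⟨v, hv, hZv⟩ := exists_reducedCurv_nullity hB e hgB x (hnull x hx)
  set ev := (smoothRing.eval (n := n) x).toRingHom with hev
  have hZ : IsCurvatureLike (ev.mapMatrix C.G) (fun k l => ev.mapMatrix (C.reducedCurv Br k l)) :=
    (C.reducedCurv_isCurvatureLike Br).map ev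
  have hinv : ev.mapMatrix C.Ginv * ev.mapMatrix C.G = 1 := by
    rw [← map_mul, C.inv_mul, map_one]
  have hmap : ∀ k l, ev.mapMatrix (C.reducedCurv Br k l) * ev.mapMatrix (σ.mat e subset_rfl)
      + ev.mapMatrix (σ.mat e subset_rfl) * (ev.mapMatrix (C.reducedCurv Br k l))ᵀ
      = symProd k (ev ∘ N l) - symProd l (ev ∘ N k) := by
    intro k l
    have h := congrArg ev.mapMatrix (hcurv k l)
    rw [map_add, map_sub, map_mul, map_mul, MetricConnection.ProlongedSolution.map_symProd,
      MetricConnection.ProlongedSolution.map_symProd] at h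
    exact h
  have h := congrFun (eq_smul_single_of_nullity hn hv (hZ.sum_smul_eq_zero hinv hZv)
    (N := fun l => ev ∘ N l) hmap l) c
  refine h.trans ?_
  have hNi : ∀ i, ev (N i i) = covVector g (divBivector g σ) e x i i
      - B x * ∑ c, σ.comp e x i c * g.comp e x c i := by
    intro i
    change smoothRing.eval x (N i i) = _
    rw [hN]
    simp only [Pi.sub_apply, map_sub, hC, eval_covVec, Pi.smul_apply, smul_eq_mul, map_mul,
      mulVec_single_one, col_apply, smoothRing.eval_mul_apply]
    rfl
  have hsum : (∑ i, ev (N i i)) / n = -(divVector g B hB σ (divBivector g σ)).comp e x := by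
    rw [divVector_comp _ _ _ _ _ _ x.2]
    simp only [hNi, Finset.sum_sub_distrib, Finset.mul_sum]
    ring
  simp only [Function.comp, hsum, Pi.smul_apply, smul_eq_mul, map_mul, map_neg, WDensity.eval_fn,
    Pi.single_apply, apply_ite (smoothRing.eval x), map_one, map_zero]

/-- The solution of the first two equations of the prolonged system given by a solution of the
metrisability equation. -/
def SolvesMetrisability.prolongedSolution (hn : n ≠ 0) (hσ : SolvesMetrisability g σ)
    (hg : HasWeylNullityAE g) (hgB : IsNullityFunction g B) :
    (g.connection e e.1.open_source subset_rfl).ProlongedSolution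
      (smoothRing.mk (n := n) (V := e.1.source) B hB.contMDiffOn) where
  σ := σ.mat e subset_rfl
  μ := (divBivector g σ).vec e subset_rfl
  ρ := (divVector g B hB σ (divBivector g σ)).fn e subset_rfl
  γ := g.weight e e.1.open_source subset_rfl (-2)
  symm := σ.mat_symm e
  closed := g.weight_closed e e.1.open_source subset_rfl (-2)
  deriv_σ := hσ.dMat_eq e
  deriv_μ l := by
    have h := hσ.covVec_sub_eq hB e hn hg hgB l
    rw [MetricConnection.covVec] at h
    linear_combination (norm := module) h

theorem SolvesMetrisability.obstruction_eq_zero (hn : 2 ≤ n) (hσ : SolvesMetrisability g σ)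
    (hg : HasWeylNullityAE g) (hgB : IsNullityFunction g B) (l : Fin n) :
    (hσ.prolongedSolution hB e (by omega) hg hgB).obstruction l = 0 := by
  set S := hσ.prolongedSolution hB e (by omega) hg hgB with hS
  obtain ⟨U, hUo, hU, hnull⟩ := hg
  refine smoothRing.ext_eval fun x => ?_
  by_contra hx
  -- On the open set where the obstruction is nonzero, each point with nullity must have X a
  -- multiple of the identity.
  set O := e.1.source ∩ smoothRing.ext (S.obstruction l) ⁻¹' {0}ᶜ with hO
  have hOo : IsOpen O := (smoothRing.contMDiffOn_ext _).continuousOn.isOpen_inter_preimage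
    e.1.open_source isOpen_compl_singleton
  have hxO : x.1 ∈ O := ⟨x.2, by
    rw [Set.mem_preimage, smoothRing.ext_apply]
    simpa using hx⟩
  obtain ⟨y, hyO, hyU⟩ := hU.inter_open_nonempty O hOo ⟨x, hxO⟩
  have hne : ∀ z (hz : z ∈ O), smoothRing.eval (n := n) (⟨z, hz.1⟩ : e.1.source) (S.obstruction l) ≠ 0 :=
    fun z hz => by
      have := hz.2
      rwa [Set.mem_preimage, smoothRing.ext_apply _ ⟨z, hz.1⟩] at this
  have hscal : ∀ z (hz : z ∈ O), z ∈ U → ∃ r : ℝ,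
      (smoothRing.eval (n := n) (⟨z, hz.1⟩ : e.1.source)).toRingHom.mapMatrix S.X = r • 1 := by
    intro z hz hzU
    by_contra hX
    obtain ⟨v, hv, hZv⟩ := exists_reducedCurv_nullity hB e hgB ⟨z, hz.1⟩ (hnull z hzU)
    exact hne z hz (S.map_obstruction_eq_zero _ hn hv hZv (not_exists.1 hX) l)
  obtain ⟨r, hr⟩ := hscal y hyO hyU
  refine hne y hyO (S.map_obstruction_eq_zero_of_map_μ
    (smoothRing.eval (n := n) (⟨y, hyO.1⟩ : e.1.source)).toRingHom
    (S.map_μ_eq_zero_of_scalar _ hn hr fun a => ?_) l)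
  ext i j
  change smoothRing.eval _ (smoothRing.deriv e e.1.open_source subset_rfl a
    (((n : smoothRing (n := n) e.1.source) • S.X - S.X.trace • 1) i j)) = 0
  rw [smoothRing.eval_deriv]
  -- The trace-free part of X vanishes on O ∩ U. That U is open, and not only dense, is what permits
  -- differentiating there.
  refine (pd_congr (g := fun _ => 0) e a (hOo.inter hUo) (fun z hz => hz.1.1) (fun z hz => ?_)
    ⟨hyO, hyU⟩).trans (by simp [pd])
  obtain ⟨r, hr⟩ := hscal z hz.1 hz.2
  rw [smoothRing.ext_apply _ ⟨z, hz.1.1⟩]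
  have h1 : ∀ i j, smoothRing.eval (n := n) (⟨z, hz.1.1⟩ : e.1.source) (S.X i j)
      = r * (1 : Matrix (Fin n) (Fin n) ℝ) i j := fun i j => congrFun (congrFun hr i) j
  have h2 : smoothRing.eval (n := n) (⟨z, hz.1.1⟩ : e.1.source) ((1 : Matrix (Fin n) (Fin n) _) i j)
      = (1 : Matrix (Fin n) (Fin n) ℝ) i j := by
    rw [Matrix.one_apply, Matrix.one_apply, apply_ite (smoothRing.eval _), map_one, map_zero]
  rw [Matrix.sub_apply, Matrix.smul_apply, Matrix.smul_apply, smul_eq_mul, smul_eq_mul, map_sub,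
    map_mul, map_mul, map_natCast, Matrix.trace, map_sum, h2]
  simp only [diag_apply, h1, Matrix.one_apply_eq, mul_one, Finset.sum_const, Finset.card_univ,
    Fintype.card_fin, nsmul_eq_mul]
  ring

theorem SolvesMetrisability.covVector_add_eq_zero (hn : n ≠ 0) (hσ : SolvesMetrisability g σ)
    (hg : HasWeylNullityAE g) (hgB : IsNullityFunction g B) {x : M} (hx : x ∈ e.1.source)
    (a b : Fin n) : covVector g (divBivector g σ) e x a b
      + kron b a * (divVector g B hB σ (divBivector g σ)).comp e x
      - ∑ c, B x * g.comp e x a c * σ.comp e x b c = 0 := by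
  have h := congrArg (smoothRing.eval (n := n) (⟨x, hx⟩ : e.1.source))
    (congrFun (hσ.covVec_sub_eq hB e hn hg hgB a) b)
  simp only [Pi.sub_apply, map_sub, eval_covVec, Pi.smul_apply, smul_eq_mul, map_mul,
      mulVec_single_one, col_apply, smoothRing.eval_mul_apply, map_neg, WDensity.eval_fn,
      Pi.single_apply, apply_ite (smoothRing.eval _), map_one, map_zero] at h
  change _ - B x * ∑ c, σ.comp e x b c * g.comp e x c a = -_ * kron b a at h
  have h2 : B x * ∑ c, σ.comp e x b c * g.comp e x c a
      = ∑ c, B x * g.comp e x a c * σ.comp e x b c := by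
    rw [Finset.mul_sum]
    exact Finset.sum_congr rfl fun c _ => by rw [g.symm e x c a]; ring
  rw [h2] at h
  linear_combination h

theorem SolvesMetrisability.covDensity_sub_eq_zero (hn : 2 ≤ n) (hσ : SolvesMetrisability g σ)
    (hg : HasWeylNullityAE g) (hgB : IsNullityFunction g B) {x : M} (hx : x ∈ e.1.source)
    (a : Fin n) : covDensity g (divVector g B hB σ (divBivector g σ)) e x a
      - 2 * ∑ b, B x * g.comp e x a b * (divBivector g σ).comp e x b
      + 1 / ((n : ℝ) - 1) * ∑ b, ∑ c, σ.comp e x b c *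
        (g.comp e x a b * pd e c B x - g.comp e x b c * pd e a B x) = 0 := by
  set S := hσ.prolongedSolution hB e (by omega) hg hgB with hS
  set ev := smoothRing.eval (n := n) (⟨x, hx⟩ : e.1.source) with hev
  have h : ev (S.obstruction a) = 0 := by
    rw [hσ.obstruction_eq_zero hB e hn hg hgB, map_zero]
  have hA : ev (S.A a) = covDensity g (divVector g B hB σ (divBivector g σ)) e x a
      - 2 * ∑ b, B x * g.comp e x a b * (divBivector g σ).comp e x b := by
    rw [MetricConnection.ProlongedSolution.A, map_sub, map_mul, map_mul, map_ofNat,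
      smoothRing.eval_mulVec]
    refine congrArg₂ _ (eval_covDensity g e _ _ _ _ _) ?_
    rw [mul_assoc, Finset.mul_sum]
    congr 1
    refine Finset.sum_congr rfl fun b _ => ?_
    rw [mul_assoc]
    rfl
  have hdB : ∀ c, ev (S.dB c) = pd e c B x := fun c =>
    smoothRing.eval_deriv_mk e e.1.open_source subset_rfl c B hB.contMDiffOn ⟨x, hx⟩
  have hX : ∀ i j, ev (S.X i j) = ∑ b, σ.comp e x i b * g.comp e x b j := fun i j =>
    smoothRing.eval_mul_apply _ _ _ _ _
  have hcor : ∑ b, ∑ c, σ.comp e x b c *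
        (g.comp e x a b * pd e c B x - g.comp e x b c * pd e a B x)
      = ev ((S.dB ᵥ* S.X) a) - ev S.X.trace * ev (S.dB a) := by
    rw [vecMul, dotProduct, Matrix.trace, map_sum, map_sum, Finset.sum_mul]
    simp only [map_mul, diag_apply, hX, hdB, Finset.mul_sum, Finset.sum_mul, mul_sub,
      Finset.sum_sub_distrib]
    congr 1
    · rw [Finset.sum_comm]
      refine Finset.sum_congr rfl fun c _ => Finset.sum_congr rfl fun b _ => ?_
      rw [σ.symm e x b c, g.symm e x a b]
      ring
    · refine Finset.sum_congr rfl fun b _ => Finset.sum_congr rfl fun c _ => ?_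
      rw [g.symm e x b c]
      ring
  rw [MetricConnection.ProlongedSolution.obstruction, map_sub, map_add, map_mul, map_mul, map_sub,
    map_natCast, map_one] at h
  have h1 : (n : ℝ) - 1 ≠ 0 := by
    rw [sub_ne_zero]
    exact_mod_cast (by omega : n ≠ 1)
  rw [← hA, hcor]
  field_simp
  linear_combination h

end

end

/-! ### Tractors and the bijection -/

section

open Matrix

variable {n : ℕ} {M : Type*} [TopologicalSpace M] [ChartedSpace (EuclideanSpace ℝ (Fin n)) M]

/-- The cocycle property that makes the changes of scale compose, so a triple in one scale
determines a tractor. -/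
theorem upsilon_add (g h k : PseudoRiemMetric n M) (e : Chart n M) (x : M) (a : Fin n) :
    upsilon g k e x a = upsilon g h e x a + upsilon h k e x a := by
  simp only [upsilon]
  ring

theorem upsilon_self (g : PseudoRiemMetric n M) (e : Chart n M) (x : M) (a : Fin n) :
    upsilon g g e x a = 0 := by
  simp [upsilon]

theorem S2Tractor.ext_of_scale {m : Set (PseudoRiemMetric n M)} (g : m) {V V' : S2Tractor m} (hσ : V.σ = V'.σ)
    (hμ : V.μ g = V'.μ g) (hρ : V.ρ g = V'.ρ g) : V = V' := by
  refine S2Tractor.ext hσ (funext fun h => ?_) (funext fun h => ?_)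
  · ext e x b
    by_cases hx : x ∈ e.1.source
    · rw [V.μ_transform g h e x hx, V'.μ_transform g h e x hx, hσ, hμ]
    · rw [(V.μ h).comp_of_notMem e x hx, (V'.μ h).comp_of_notMem e x hx]
  · ext e x
    by_cases hx : x ∈ e.1.source
    · rw [V.ρ_transform g h e x hx, V'.ρ_transform g h e x hx, hσ, hμ, hρ]
    · rw [(V.ρ h).comp_of_notMem e x hx, (V'.ρ h).comp_of_notMem e x hx]

theorem nablaMetr_eq_zero_iff {m : Set (PseudoRiemMetric n M)} {g : m} {B : M → ℝ}
    {V : S2Tractor m} {e : Chart n M} {x : M} (a : Fin n) : nablaMetr g B V e x a = 0 ↔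
    (∀ b c, covSymBivector g.1 V.σ e x a b c + kron b a * (V.μ g).comp e x c
      + kron c a * (V.μ g).comp e x b = 0) ∧
    (∀ b, covVector g.1 (V.μ g) e x a b + kron b a * (V.ρ g).comp e x
      - ∑ c, B x * g.1.comp e x a c * V.σ.comp e x b c = 0) ∧
    covDensity g.1 (V.ρ g) e x a - 2 * ∑ b, B x * g.1.comp e x a b * (V.μ g).comp e x b
      + 1 / ((n : ℝ) - 1) * ∑ b, ∑ c, V.σ.comp e x b c *
        (g.1.comp e x a b * pd e c B x - g.1.comp e x b c * pd e a B x) = 0 := by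
  simp only [nablaMetr, nablaT1, Prod.smul_mk, Prod.mk_add_mk, smul_zero, add_zero, smul_eq_mul,
    Prod.mk_eq_zero, funext_iff, Pi.zero_apply]

variable [IsManifold (𝓡 n) ∞ M]

/-- The inhomogeneous term in the transformation of the Christoffel trace depends only on the
charts, so it cancels in the difference for two metrics. -/
theorem upsilon_transform (g h : PseudoRiemMetric n M) (e e' : Chart n M) {x : M}
    (hx : x ∈ e.1.source) (hx' : x ∈ e'.1.source) :
    upsilon g h e x = (jac e e' x)ᵀ *ᵥ upsilon g h e' x := by
  have hVo := e.1.open_source.inter e'.1.open_source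
  have key : ∀ g : PseudoRiemMetric n M, ∀ a, christoffelTrace g e x a
      = smoothRing.eval (n := n) (⟨x, hx, hx'⟩ : ↥(e.1.source ∩ e'.1.source))
          ((Matrix.of fun i j => smoothRing.mk _ (contMDiffOn_jac e' e hVo Set.inter_subset_right
            Set.inter_subset_left i j)) * dMat (smoothRing.deriv e hVo Set.inter_subset_left a)
            (Matrix.of fun i j => smoothRing.mk _ (contMDiffOn_jac e e' hVo
              Set.inter_subset_left Set.inter_subset_right i j))).trace
        + ∑ b, jac e e' x b a * christoffelTrace g e' x b := by
    intro g a
    have h := congrArg (smoothRing.eval (n := n) (⟨x, hx, hx'⟩ : ↥(e.1.source ∩ e'.1.source)))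
      ((g.coordChange e e' hVo Set.inter_subset_left Set.inter_subset_right).trace_Γ a)
    rw [map_add, map_sum] at h
    simp only [map_mul, PseudoRiemMetric.eval_trace_Γ] at h
    exact h
  ext a
  rw [upsilon, key g, key h, mulVec, dotProduct, add_sub_add_left_eq_sub,
    ← Finset.sum_sub_distrib, Finset.mul_sum]
  refine Finset.sum_congr rfl fun b _ => ?_
  rw [upsilon, transpose_apply]
  ring

theorem contMDiffOn_upsilon (g h : PseudoRiemMetric n M) (e : Chart n M) (a : Fin n) :
    ContMDiffOn (𝓡 n) 𝓘(ℝ, ℝ) ∞ (fun x => upsilon g h e x a) e.1.source := by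
  refine smoothRing.contMDiffOn_of_eval (algebraMap ℝ _ (1 / ((n : ℝ) + 1)) *
    (((h.connection e e.1.open_source subset_rfl).Γ a).trace
      - ((g.connection e e.1.open_source subset_rfl).Γ a).trace)) fun x => ?_
  rw [map_mul, map_sub, PseudoRiemMetric.eval_trace_Γ, PseudoRiemMetric.eval_trace_Γ,
    AlgHom.commutes]
  rfl

section

variable {w : ℝ} (g h : PseudoRiemMetric n M) (σ : WSymBivector n M w) (μ : WVector n M w)
  (ρ : WDensity n M w)

/-- The vector `μ^b - Υ_c σ^{bc}`. -/
def changeVector : WVector n M w where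
  comp e x b := μ.comp e x b - ∑ c, upsilon g h e x c * σ.comp e x b c
  comp_of_notMem e x hx := by
    ext b
    simp [μ.comp_of_notMem e x hx, σ.comp_of_notMem e x hx]
  smooth e b := by
    rw [smoothIn_iff]
    refine smoothRing.contMDiffOn_of_eval (μ.vec e subset_rfl b
      - ∑ c, smoothRing.mk _ (contMDiffOn_upsilon g h e c) * σ.mat e subset_rfl b c) fun x => ?_
    rw [map_sub, map_sum]
    simp only [map_mul]
    rfl
  transform e e' x hx hx' b := by
    simp only [upsilon_transform g h e e' hx hx', μ.transform e e' x hx hx',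
      σ.transform e e' x hx hx', mulVec, dotProduct, transpose_apply, mul_sub,
      Finset.sum_sub_distrib, Finset.mul_sum, Finset.sum_mul]
    congr 1
    rw [Finset.sum_comm]
    refine Finset.sum_congr rfl fun k _ => ?_
    rw [Finset.sum_comm]
    refine Finset.sum_congr rfl fun l _ => Finset.sum_congr rfl fun c _ => ?_
    ring

/-- The density `ρ - 2 Υ_b μ^b + Υ_b Υ_c σ^{bc}`. -/
def changeDensity : WDensity n M w where
  comp e x := ρ.comp e x - 2 * ∑ b, upsilon g h e x b * μ.comp e x b
    + ∑ b, ∑ c, upsilon g h e x b * upsilon g h e x c * σ.comp e x b c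
  comp_of_notMem e x hx := by
    simp [μ.comp_of_notMem e x hx, σ.comp_of_notMem e x hx, ρ.comp_of_notMem e x hx]
  smooth e := by
    rw [smoothIn_iff]
    refine smoothRing.contMDiffOn_of_eval (ρ.fn e subset_rfl
      - 2 * ∑ b, smoothRing.mk _ (contMDiffOn_upsilon g h e b) * μ.vec e subset_rfl b
      + ∑ b, ∑ c, smoothRing.mk _ (contMDiffOn_upsilon g h e b)
        * smoothRing.mk _ (contMDiffOn_upsilon g h e c) * σ.mat e subset_rfl b c) fun x => ?_
    simp only [map_add, map_sub, map_sum, map_mul, map_ofNat]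
    rfl
  transform e e' x hx hx' := by
    set φ := |(jac e e' x).det| ^ (w / (n + 1)) with hφ
    set J := jac e e' x with hJ
    set u := upsilon g h e' x with hu
    have h1 : ∑ b, u b * μ.comp e' x b = φ * ∑ b, (Jᵀ *ᵥ u) b * μ.comp e x b := by
      simp only [μ.transform e e' x hx hx', mulVec, dotProduct, transpose_apply, Finset.mul_sum,
        Finset.sum_mul]
      rw [Finset.sum_comm]
      refine Finset.sum_congr rfl fun k _ => Finset.sum_congr rfl fun b _ => ?_
      ring
    have h2 : ∑ b, ∑ c, u b * u c * σ.comp e' x b c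
        = φ * ∑ b, ∑ c, (Jᵀ *ᵥ u) b * (Jᵀ *ᵥ u) c * σ.comp e x b c := by
      have hs : (Matrix.of (σ.comp e' x)) = φ • (J * Matrix.of (σ.comp e x) * Jᵀ) := by
        ext b c
        rw [of_apply, σ.transform e e' x hx hx', Matrix.smul_apply, smul_eq_mul, Matrix.mul_apply]
        simp only [Matrix.mul_apply, Finset.sum_mul]
        rw [Finset.sum_comm]
        congr 1
        refine Finset.sum_congr rfl fun l _ => Finset.sum_congr rfl fun k _ => ?_
        rw [of_apply, transpose_apply]
        ring
      have hq : ∀ (u : Fin n → ℝ) (s : Fin n → Fin n → ℝ),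
          ∑ b, ∑ c, u b * u c * s b c = u ⬝ᵥ (Matrix.of s *ᵥ u) := by
        intro u s
        simp only [dotProduct, mulVec, Finset.mul_sum, of_apply]
        refine Finset.sum_congr rfl fun k _ => Finset.sum_congr rfl fun b _ => ?_
        ring
      rw [hq, hq, hs, smul_mulVec, dotProduct_smul, smul_eq_mul, ← mulVec_mulVec, ← mulVec_mulVec,
        dotProduct_mulVec u J, mulVec_transpose]
    rw [upsilon_transform g h e e' hx hx', ρ.transform e e' x hx hx', h1, h2]
    ring

end

variable {m : Set (PseudoRiemMetric n M)}

/-- The tractor given in the scale `g` by the triple `(σ, μ, ρ)`. -/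
def S2Tractor.ofScale (g : m) (σ : WSymBivector n M (-2)) (μ : WVector n M (-2))
    (ρ : WDensity n M (-2)) : S2Tractor m where
  σ := σ
  μ h := changeVector g.1 h.1 σ μ
  ρ h := changeDensity g.1 h.1 σ μ ρ
  μ_transform h k e x hx b := by
    simp only [changeVector, upsilon_add g.1 h.1 k.1, add_mul, Finset.sum_add_distrib]
    ring
  ρ_transform h k e x hx := by
    set u := upsilon g.1 h.1 e x with hu
    set v := upsilon h.1 k.1 e x with hv
    have h0 : ∀ b, upsilon g.1 k.1 e x b = u b + v b := upsilon_add g.1 h.1 k.1 e x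
    -- By symmetry of σ, the two mixed terms of the square agree; together they match what -2Υ_bμ^b
    -- contributes after the first change of scale.
    have h1 : ∑ b, ∑ c, u b * v c * σ.comp e x b c = ∑ b, ∑ c, v b * u c * σ.comp e x b c := by
      rw [Finset.sum_comm]
      refine Finset.sum_congr rfl fun b _ => Finset.sum_congr rfl fun c _ => ?_
      rw [σ.symm e x c b]
      ring
    have h2 : ∑ b, ∑ c, (u b + v b) * (u c + v c) * σ.comp e x b c
        = ∑ b, ∑ c, u b * u c * σ.comp e x b c + 2 * ∑ b, ∑ c, v b * u c * σ.comp e x b c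
          + ∑ b, ∑ c, v b * v c * σ.comp e x b c := by
      rw [two_mul]
      nth_rewrite 1 [← h1]
      simp only [← Finset.sum_add_distrib]
      refine Finset.sum_congr rfl fun b _ => Finset.sum_congr rfl fun c _ => ?_
      ring
    have h3 : ∑ b, v b * (μ.comp e x b - ∑ c, u c * σ.comp e x b c)
        = ∑ b, v b * μ.comp e x b - ∑ b, ∑ c, v b * u c * σ.comp e x b c := by
      simp only [mul_sub, Finset.sum_sub_distrib, Finset.mul_sum, mul_assoc]
    simp only [changeVector, changeDensity, h0, h2]
    rw [h3]
    simp only [add_mul, Finset.sum_add_distrib]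
    ring

theorem S2Tractor.ofScale_μ (g : m) (σ : WSymBivector n M (-2)) (μ : WVector n M (-2))
    (ρ : WDensity n M (-2)) : (S2Tractor.ofScale g σ μ ρ).μ g = μ := by
  ext e x b
  change μ.comp e x b - ∑ c, upsilon g.1 g.1 e x c * σ.comp e x b c = _
  simp [upsilon_self]

theorem S2Tractor.ofScale_ρ (g : m) (σ : WSymBivector n M (-2)) (μ : WVector n M (-2))
    (ρ : WDensity n M (-2)) : (S2Tractor.ofScale g σ μ ρ).ρ g = ρ := by
  ext e x
  change ρ.comp e x - 2 * ∑ b, upsilon g.1 g.1 e x b * μ.comp e x b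
    + ∑ b, ∑ c, upsilon g.1 g.1 e x b * upsilon g.1 g.1 e x c * σ.comp e x b c = _
  simp [upsilon_self]

section

variable {g : m} {B : M → ℝ} {V : S2Tractor m} {e : Chart n M} {x : M}

theorem μ_comp_eq_of_nablaMetr (h : ∀ a, nablaMetr g B V e x a = 0) (b : Fin n) :
    (V.μ g).comp e x b = -(1 / ((n : ℝ) + 1)) * ∑ a, covSymBivector g.1 V.σ e x a a b :=
  eq_div_of_covSymBivector_add g.1 V.σ e x
    (fun a b c => ((nablaMetr_eq_zero_iff a).1 (h a)).1 b c) b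

theorem ρ_comp_eq_of_nablaMetr (hn : n ≠ 0) (h : ∀ a, nablaMetr g B V e x a = 0) :
    (V.ρ g).comp e x = -(1 / (n : ℝ)) * (∑ a, covVector g.1 (V.μ g) e x a a
      - ∑ a, ∑ c, B x * g.1.comp e x a c * V.σ.comp e x a c) :=
  eq_div_of_covVector_add hn g.1 (V.μ g) e x
    (fun a b => ((nablaMetr_eq_zero_iff a).1 (h a)).2.1 b)

end

theorem bijOn_metrisability (hn : 2 ≤ n) (g : m) (hnull : HasWeylNullityAE g.1) {B : M → ℝ}
    (hB : IsNullityFunction g.1 B) (hBsmooth : ContMDiff (𝓡 n) 𝓘(ℝ, ℝ) ∞ B) :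
    Set.BijOn (fun V : S2Tractor m => V.σ)
      {V | ∀ (e : Chart n M) (x : M), x ∈ e.1.source → ∀ a, nablaMetr g B V e x a = 0}
      {σ | SolvesMetrisability g.1 σ} := by
  refine ⟨fun V hV e x hx a b c => ?_, fun V hV V' hV' hσ => ?_, fun σ hσ => ?_⟩
  · exact (trace_free_iff_covSymBivector_add g.1 V.σ e x
      (μ_comp_eq_of_nablaMetr (hV e x hx)) a b c).2
      (((nablaMetr_eq_zero_iff a).1 (hV e x hx a)).1 b c)
  · change V.σ = V'.σ at hσ
    have hμ : V.μ g = V'.μ g := by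
      ext e x b
      by_cases hx : x ∈ e.1.source
      · rw [μ_comp_eq_of_nablaMetr (hV e x hx), μ_comp_eq_of_nablaMetr (hV' e x hx), hσ]
      · rw [(V.μ g).comp_of_notMem e x hx, (V'.μ g).comp_of_notMem e x hx]
    refine S2Tractor.ext_of_scale g hσ hμ ?_
    ext e x
    by_cases hx : x ∈ e.1.source
    · rw [ρ_comp_eq_of_nablaMetr (by omega) (hV e x hx),
        ρ_comp_eq_of_nablaMetr (by omega) (hV' e x hx), hσ, hμ]
    · rw [(V.ρ g).comp_of_notMem e x hx, (V'.ρ g).comp_of_notMem e x hx]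
  · refine ⟨S2Tractor.ofScale g σ (divBivector g.1 σ)
      (divVector g.1 B hBsmooth σ (divBivector g.1 σ)), fun e x hx a => ?_, rfl⟩
    rw [nablaMetr_eq_zero_iff, S2Tractor.ofScale_μ, S2Tractor.ofScale_ρ]
    exact ⟨fun b c => (trace_free_iff_covSymBivector_add g.1 σ e x
        (divBivector_comp g.1 σ e hx) a b c).1 (hσ e x hx a b c),
      fun b => SolvesMetrisability.covVector_add_eq_zero hBsmooth e (by omega) hσ hnull hB hx a b,
      SolvesMetrisability.covDensity_sub_eq_zero hBsmooth e hn hσ hnull hB hx a⟩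

end


end

theorem theorem4p10 {n : ℕ} (hn : 2 ≤ n) {M : Type*} [TopologicalSpace M]
    [ChartedSpace (EuclideanSpace ℝ (Fin n)) M] [IsManifold (𝓡 n) ∞ M]
    (m : Set (PseudoRiemMetric n M)) (hm : IsMetricProjectiveStructure m) (g : m)
    (hnull : HasWeylNullityAE g.1)
    (B : M → ℝ) (hB : IsNullityFunction g.1 B) (hBsmooth : ContMDiff (𝓡 n) 𝓘(ℝ, ℝ) ∞ B) :
    Set.BijOn (fun V : S2Tractor m => V.σ)
        {V | ∀ (e : Chart n M) (x : M), x ∈ e.1.source → ∀ a, nablaMetr g B V e x a = 0}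
        {σ | SolvesMetrisability g.1 σ} ∧
      ((∃ b : ℝ, ∀ x, B x = b) →
        Set.BijOn (fun V : S2Tractor m => V.σ)
          {V | ∀ (e : Chart n M) (x : M), x ∈ e.1.source → ∀ a, nablaT1 g B V e x a = 0}
          {σ | SolvesMetrisability g.1 σ}) := by
  have key := bijOn_metrisability hn g hnull hB hBsmooth
  refine ⟨key, fun ⟨b, hb⟩ => ?_⟩
  -- For constant B, the correction in the bottom slot vanishes and the two connections coincide.
  obtain rfl : B = fun _ => b := funext hb
  have h : ∀ (V : S2Tractor m) (e : Chart n M) (x : M) (a : Fin n),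
      nablaMetr g (fun _ => b) V e x a = nablaT1 g (fun _ => b) V e x a := by
    intro V e x a
    have hpd : ∀ c, pd e c (fun _ : M => b) x = 0 := fun c => by simp [pd]
    simp only [nablaMetr, hpd, mul_zero, sub_self, Finset.sum_const_zero]
    exact (congrArg (nablaT1 g (fun _ => b) V e x a + ·) (smul_zero _)).trans (add_zero _)
  simpa only [h] using key
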